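/- Let $n\ge 2$ and $N\ge 1$ be integers and let $p,q\in\mathbb C^{*}$ be generic: $q$ is not a root of unity (but $q=1$ is allowed), and $p\notin q^{2\mathbb Q_{\ge 0}}$, i.e. $p^{b}\ne q^{2a}$ for all integers $a\ge 0$, $b\ge 1$. On $\mathbb C[z_1^{\pm1},\dots,z_N^{\pm1}]$ let $K_{i,j}$ exchange $z_i$ and $z_j$, let $p^{D_i}$ replace $z_i$ by $pz_i$, and put $$g_{i,j}=\frac{q^{-1}z_i-qz_j}{z_i-z_j}(K_{i,j}-1)+q,\qquad \xi_{i,j}=K_{i,j}g_{i,j},\qquad Y_i=\xi_{i,i+1}^{-1}\cdots\xi_{i,N}^{-1}\,p^{D_i}\,\xi_{1,i}\cdots\xi_{i-1,i}.$$ For $\lambda\in\mathbb Z^N$ let $\lambda^+$ be its non-increasing rearrangement and $\sigma$ the permutation with $\lambda^+_{\sigma(i)}=\lambda_i$ and $\sigma(i)<\sigma(j)$ whenever $i<j$, $\lambda_i=\lambda_j$; put $\zeta_i(\lambda)=p^{\lambda_i}q^{2\sigma(i)-N-1}$. Write $\lambda\succ\mu$ if either $\lambda^+\neq\mu^+$ and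 $\lambda^+$ dominates $\mu^+$ (that is, $\sum_{j\le i}\lambda^+_j\ge\sum_{j\le i}\mu^+_j$ for all $i$, with equality for $i=N$), or $\lambda^+=\mu^+$ and the last non-zero entry of $\lambda-\mu$ is negative. For every $\lambda\in\mathbb Z^N$ there is a unique Laurent polynomial $\Phi^\lambda$ (the non-symmetric Macdonald polynomial) with $$Y_i\Phi^\lambda=\zeta_i(\lambda)\Phi^\lambda\ (1\le i\le N),\qquad \Phi^\lambda=z^\lambda+\sum_{\mu\prec\lambda}c(\lambda,\mu)z^\mu .$$ Let $V=\mathbb C^n$ with standard basis $v_1,\dots,v_n$ and matrix units $E^{a,b}v_c=\delta_{b,c}v_a$, and let $S_{i,i+1}$ be the operator $$S=-q^{-1}\sum_{a}E^{a,a}\otimes E^{a,a}+(q-q^{-1})\sum_{a<b}E^{a,a}\otimes E^{b,b}-\sum_{a\ne b}E^{a,b}\otimes E^{b,a}$$ acting in the $i$-th and $(i+1)$-st factors of $\otimes^N V$. With $V(z)=\mathbb C[z^{\pm1}]\otimes V$ and $\otimes^N V(z)=\mathbb C[z_1^{\pm1},\dots,z_N^{\pm1}]\otimes(\otimes^N V)$,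 the finite $q$-wedge product is $$\wedge^N V(z)=\otimes^N V(z)\Big/\sum_{i=1}^{N-1}\operatorname{Ker}\bigl(g_{i,i+1}+S_{i,i+1}^{-1}\bigr),$$ and $\Lambda$ denotes the quotient map. Let $\mathcal M_N^n$ be the set of $m=(m_1\le\dots\le m_N)\in\mathbb Z^N$ in which no value occurs more than $n$ times, and for $m\in\mathcal M_N^n$ let $\mathcal E(m)$ be the set of $e=(\epsilon_1,\dots,\epsilon_N)\in\{1,\dots,n\}^N$ with $\epsilon_i>\epsilon_{i+1}$ whenever $m_i=m_{i+1}$. Then the vectors $$\phi(m,e)=\Lambda\bigl(\Phi^m\otimes v_{\epsilon_1}\otimes\cdots\otimes v_{\epsilon_N}\bigr),\qquad m\in\mathcal M_N^n,\ e\in\mathcal E(m),$$ form a basis of $\wedge^N V(z)$. -/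

import Mathlib

open scoped TensorProduct

noncomputable section

namespace QWedge

/-! ### Laurent polynomials and the operators acting on them -/

/-- The ring `ℂ[z₁^{±1}, …, z_N^{±1}]` of Laurent polynomials, as the group algebra of `ℤ^N`. -/
abbrev Laurent (N : ℕ) : Type := AddMonoidAlgebra ℂ (Fin N → ℤ)

/-- The monomial `z^l`. -/
def mono {N : ℕ} (l : Fin N → ℤ) : Laurent N := AddMonoidAlgebra.single l 1

/-- The variable `z_i`. -/
def var {N : ℕ} (i : Fin N) : Laurent N := mono (Pi.single i 1)

/-- The linear operator with prescribed values on the monomials. -/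
def ofMono {N : ℕ} (F : (Fin N → ℤ) → Laurent N) : Module.End ℂ (Laurent N) :=
  Finsupp.linearCombination ℂ F ∘ₗ (AddMonoidAlgebra.coeffLinearEquiv ℂ).toLinearMap

theorem ofMono_mono {N : ℕ} (F : (Fin N → ℤ) → Laurent N) (l : Fin N → ℤ) :
    ofMono F (mono l) = F l := by
  simp [ofMono, mono]

theorem end_ext {N : ℕ} {A B : Module.End ℂ (Laurent N)} (h : ∀ l, A (mono l) = B (mono l)) :
    A = B := by
  apply AddMonoidAlgebra.lhom_ext'
  intro l
  apply LinearMap.ext_ring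
  exact h l

/-- The operator `K_{i,j}` exchanging the variables `z_i` and `z_j`. -/
def K {N : ℕ} (i j : Fin N) : Module.End ℂ (Laurent N) :=
  ofMono fun l => mono (l ∘ Equiv.swap i j)

/-- The divided difference: the operator `f ↦ (K_{i,j} f - f) / (z_i - z_j)` (for `i ≠ j`), given by
its values on monomials, see `var_sub_mul_divDiff`. One of the two sums is always empty. -/
def divDiff {N : ℕ} (i j : Fin N) : Module.End ℂ (Laurent N) :=
  ofMono fun l =>
    (∑ k ∈ Finset.range (l j - l i).toNat,
        mono (Function.update (Function.update l i (l i + k)) j (l j - 1 - k)))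
      - ∑ k ∈ Finset.range (l i - l j).toNat,
        mono (Function.update (Function.update l i (l j + k)) j (l i - 1 - k))

theorem mono_mul_mono {N : ℕ} (l m : Fin N → ℤ) : mono l * mono m = mono (l + m) := by
  simp [mono, AddMonoidAlgebra.single_mul_single]

theorem telescope {N : ℕ} {i j : Fin N} (hij : i ≠ j) (l : Fin N → ℤ) (a b : ℤ) (d : ℕ)
    (h : b - a = d) :
    (var i - var j) * ∑ k ∈ Finset.range d,
        mono (Function.update (Function.update l i (a + k)) j (b - 1 - k))
      = mono (Function.update (Function.update l i b) j a)
        - mono (Function.update (Function.update l i a) j b) := by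
  rw [Finset.mul_sum]
  have key : ∀ k ∈ Finset.range d, (var i - var j) *
      mono (Function.update (Function.update l i (a + k)) j (b - 1 - k))
      = mono (Function.update (Function.update l i (a + ((k + 1 : ℕ) : ℤ))) j (b - (k + 1 : ℕ)))
        - mono (Function.update (Function.update l i (a + (k : ℕ))) j (b - (k : ℕ))) := by
    intro k _
    rw [sub_mul, var, var, mono_mul_mono, mono_mul_mono]
    congr 2
    · funext x
      by_cases hx : x = j
      · subst hx; simp [hij]; ring
      · by_cases hx' : x = i
        · subst hx'; simp [hij]; ring
        · simp [hx, hx']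
    · funext x
      by_cases hx : x = j
      · subst hx; simp; ring
      · by_cases hx' : x = i
        · subst hx'; simp [hij]
        · simp [hx, hx']
  rw [Finset.sum_congr rfl key, Finset.sum_range_sub
    (fun k : ℕ => mono (Function.update (Function.update l i (a + (k : ℤ))) j (b - (k : ℤ))))]
  have h1 : a + (d : ℤ) = b := by omega
  have h2 : b - (d : ℤ) = a := by omega
  simp [h1, h2]

theorem K_mono {N : ℕ} (i j : Fin N) (l : Fin N → ℤ) :
    K i j (mono l) = mono (l ∘ Equiv.swap i j) := ofMono_mono _ _

theorem comp_swap_eq {N : ℕ} {i j : Fin N} (hij : i ≠ j) (l : Fin N → ℤ) :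
    l ∘ Equiv.swap i j = Function.update (Function.update l i (l j)) j (l i) := by
  funext x
  by_cases hx : x = j
  · subst hx; simp
  · by_cases hx' : x = i
    · subst hx'; simp [hij]
    · simp [hx, hx', Equiv.swap_apply_of_ne_of_ne]

theorem var_sub_mul_divDiff {N : ℕ} {i j : Fin N} (hij : i ≠ j) (f : Laurent N) :
    (var i - var j) * divDiff i j f = K i j f - f := by
  have : LinearMap.mulLeft ℂ (var i - var j) ∘ₗ divDiff i j = K i j - 1 := by
    apply end_ext
    intro l
    have e0 : Function.update (Function.update l i (l i)) j (l j) = l := by simp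
    simp only [LinearMap.comp_apply, LinearMap.mulLeft_apply, LinearMap.sub_apply,
      Module.End.one_apply, K_mono, divDiff, ofMono_mono]
    rcases le_total (l i) (l j) with h | h
    · have h0 : (l i - l j).toNat = 0 := by omega
      rw [h0, Finset.sum_range_zero, sub_zero,
        telescope hij l (l i) (l j) _ (by omega), e0, comp_swap_eq hij]
    · have h0 : (l j - l i).toNat = 0 := by omega
      rw [h0, Finset.sum_range_zero, zero_sub, mul_neg,
        telescope hij l (l j) (l i) _ (by omega), e0, comp_swap_eq hij]
      ring
  exact LinearMap.congr_fun this f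

/-- The operator `g_{i,j} = (q⁻¹ z_i - q z_j) / (z_i - z_j) · (K_{i,j} - 1) + q`. -/
def g {N : ℕ} (q : ℂ) (i j : Fin N) : Module.End ℂ (Laurent N) :=
  LinearMap.mulLeft ℂ (q⁻¹ • var i - q • var j) * divDiff i j + q • 1

/-- The inverse of `g_{i,j}`, see `g_mul_gInv` and `gInv_mul_g`. -/
def gInv {N : ℕ} (q : ℂ) (i j : Fin N) : Module.End ℂ (Laurent N) :=
  g q i j - (q - q⁻¹) • 1

/-- `g_{i,j}` is given by its defining formula, multiplied by `z_i - z_j`. -/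
theorem var_sub_mul_g {N : ℕ} (q : ℂ) {i j : Fin N} (hij : i ≠ j) (f : Laurent N) :
    (var i - var j) * g q i j f
      = (q⁻¹ • var i - q • var j) * (K i j f - f) + (var i - var j) * q • f := by
  rw [← var_sub_mul_divDiff hij f]
  simp only [g, LinearMap.add_apply, Module.End.mul_apply, LinearMap.mulLeft_apply,
    LinearMap.smul_apply, Module.End.one_apply, mul_add]
  ring

theorem var_sub_ne_zero {N : ℕ} {i j : Fin N} (hij : i ≠ j) : (var i - var j : Laurent N) ≠ 0 := by
  intro h
  rw [sub_eq_zero] at h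
  have := congrArg (fun f => AddMonoidAlgebra.coeff f (Pi.single i 1)) h
  have hne : (Pi.single j 1 : Fin N → ℤ) ≠ Pi.single i 1 := by
    intro e
    have := congrFun e i
    simp [hij] at this
  simp [var, mono, hne] at this

theorem K_mul {N : ℕ} (i j : Fin N) (f h : Laurent N) : K i j (f * h) = K i j f * K i j h := by
  have e : ∀ f : Laurent N, K i j f
      = AddMonoidAlgebra.mapDomainRingHom ℂ
        ((LinearMap.funLeft ℤ ℤ (Equiv.swap i j)).toAddMonoidHom :
          (Fin N → ℤ) →+ (Fin N → ℤ)) f := by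
    intro f
    induction f using AddMonoidAlgebra.induction_linear with
    | zero => simp
    | add f g hf hg => rw [map_add, map_add, hf, hg]
    | single l c =>
      have : (AddMonoidAlgebra.single l c : Laurent N) = c • mono l := by simp [mono]
      rw [this, map_smul, K_mono]
      simp [mono]
      rfl
  rw [e, e, e, map_mul]

theorem K_var_sub {N : ℕ} (q : ℂ) (i j : Fin N) :
    K i j (q⁻¹ • var i - q • var j) = q⁻¹ • var j - q • var i := by
  have h1 : (Pi.single i 1 : Fin N → ℤ) ∘ Equiv.swap i j = Pi.single j 1 := by
    funext x
    simp only [Function.comp_apply, Pi.single_apply, Equiv.swap_apply_eq_iff, Equiv.swap_apply_left]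
  have h2 : (Pi.single j 1 : Fin N → ℤ) ∘ Equiv.swap i j = Pi.single i 1 := by
    funext x
    simp only [Function.comp_apply, Pi.single_apply, Equiv.swap_apply_eq_iff, Equiv.swap_apply_right]
  rw [map_sub, map_smul, map_smul, var, var, K_mono, K_mono, h1, h2]

theorem K_K {N : ℕ} (i j : Fin N) (f : Laurent N) : K i j (K i j f) = f := by
  have : K i j * K i j = (1 : Module.End ℂ (Laurent N)) := by
    apply end_ext
    intro l
    simp only [Module.End.mul_apply, K_mono, Module.End.one_apply]
    congr 1
    funext x
    simp
  exact LinearMap.congr_fun this f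

theorem K_divDiff {N : ℕ} {i j : Fin N} (hij : i ≠ j) (f : Laurent N) :
    K i j (divDiff i j f) = divDiff i j f := by
  apply mul_left_cancel₀ (var_sub_ne_zero hij)
  have h := congrArg (K i j) (var_sub_mul_divDiff hij f)
  have hv : K i j (var i - var j) = -(var i - var j) := by
    have := K_var_sub (1 : ℂ) i j
    simp only [inv_one, one_smul] at this
    rw [this]; ring
  rw [K_mul, hv, map_sub, K_K] at h
  rw [var_sub_mul_divDiff hij]
  linear_combination -h

theorem divDiff_mul_divDiff {N : ℕ} (q : ℂ) {i j : Fin N} (hij : i ≠ j) (f : Laurent N) :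
    divDiff i j ((q⁻¹ • var i - q • var j) * divDiff i j f) = -(q + q⁻¹) • divDiff i j f := by
  apply mul_left_cancel₀ (var_sub_ne_zero hij)
  rw [var_sub_mul_divDiff hij, K_mul, K_divDiff hij, K_var_sub]
  simp only [Algebra.smul_def, map_neg, map_add]
  ring

/-- The quadratic Hecke relation for `g_{i,j}`. -/
theorem g_mul_g {N : ℕ} {q : ℂ} (hq : q ≠ 0) {i j : Fin N} (hij : i ≠ j) :
    g q i j * g q i j = (q - q⁻¹) • g q i j + 1 := by
  apply LinearMap.ext
  intro f
  have hg : ∀ f : Laurent N, g q i j f = (q⁻¹ • var i - q • var j) * divDiff i j f + q • f := by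
    intro f
    simp [g]
  have hc : (algebraMap ℂ (Laurent N) q) * algebraMap ℂ (Laurent N) q⁻¹ = 1 := by
    rw [← map_mul, mul_inv_cancel₀ hq, map_one]
  rw [Module.End.mul_apply, LinearMap.add_apply, LinearMap.smul_apply, Module.End.one_apply,
    hg (g q i j f), hg f, map_add, map_smul, divDiff_mul_divDiff q hij]
  simp only [Algebra.smul_def, map_neg, map_add, map_sub]
  linear_combination f * hc

theorem g_mul_gInv {N : ℕ} {q : ℂ} (hq : q ≠ 0) {i j : Fin N} (hij : i ≠ j) :
    g q i j * gInv q i j = 1 := by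
  rw [gInv, mul_sub, g_mul_g hq hij, mul_smul_comm, mul_one]
  abel

theorem gInv_mul_g {N : ℕ} {q : ℂ} (hq : q ≠ 0) {i j : Fin N} (hij : i ≠ j) :
    gInv q i j * g q i j = 1 := by
  rw [gInv, sub_mul, g_mul_g hq hij, smul_mul_assoc, one_mul]
  abel

/-- The operator `ξ_{i,j} = K_{i,j} g_{i,j}`. -/
def xi {N : ℕ} (q : ℂ) (i j : Fin N) : Module.End ℂ (Laurent N) := K i j * g q i j

/-- The inverse `g_{i,j}⁻¹ K_{i,j}` of `ξ_{i,j}`. -/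
def xiInv {N : ℕ} (q : ℂ) (i j : Fin N) : Module.End ℂ (Laurent N) := gInv q i j * K i j

theorem xi_mul_xiInv {N : ℕ} {q : ℂ} (hq : q ≠ 0) {i j : Fin N} (hij : i ≠ j) :
    xi q i j * xiInv q i j = 1 ∧ xiInv q i j * xi q i j = 1 := by
  have hK : K i j * K i j = (1 : Module.End ℂ (Laurent N)) := LinearMap.ext (K_K i j)
  constructor
  · rw [xi, xiInv, mul_assoc, ← mul_assoc (g q i j), g_mul_gInv hq hij, one_mul, hK]
  · rw [xi, xiInv, mul_assoc, ← mul_assoc (K i j), hK, one_mul, gInv_mul_g hq hij]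

/-- The operator `p^{D_i} : f(z₁, …, z_i, …, z_N) ↦ f(z₁, …, p z_i, …, z_N)`. -/
def pD {N : ℕ} (p : ℂ) (i : Fin N) : Module.End ℂ (Laurent N) :=
  ofMono fun l => p ^ l i • mono l

/-- The operator
`Y_i = ξ_{i,i+1}⁻¹ ⋯ ξ_{i,N}⁻¹ · p^{D_i} · ξ_{1,i} ⋯ ξ_{i-1,i}`. -/
def Y {N : ℕ} (p q : ℂ) (i : Fin N) : Module.End ℂ (Laurent N) :=
  (((List.finRange N).filter (i < ·)).map (fun j => xiInv q i j)).prod * pD p i *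
    (((List.finRange N).filter (· < i)).map (fun j => xi q j i)).prod

/-! ### The order on `ℤ^N` and the non-symmetric Macdonald polynomials -/

/-- The permutation arranging `l` in non-increasing order, keeping the order of equal entries. -/
def sortPerm {N : ℕ} (l : Fin N → ℤ) : Equiv.Perm (Fin N) := Tuple.sort fun i => -l i

/-- The partition `l⁺` (negative parts permitted) obtained by ordering the entries of `l`. -/
def plus {N : ℕ} (l : Fin N → ℤ) : Fin N → ℤ := l ∘ sortPerm l

/-- The permutation `σ` with `l⁺_{σ(i)} = l_i`, and with `σ(i) < σ(j)` when `i < j`, `l_i = l_j`. -/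
def sigma {N : ℕ} (l : Fin N → ℤ) : Equiv.Perm (Fin N) := (sortPerm l).symm

theorem plus_antitone {N : ℕ} (l : Fin N → ℤ) : Antitone (plus l) := by
  intro a b hab
  have := Tuple.monotone_sort (fun i => -l i) hab
  simpa [plus, sortPerm] using this

theorem plus_sigma {N : ℕ} (l : Fin N → ℤ) (i : Fin N) : plus l (sigma l i) = l i := by
  simp [plus, sigma]

theorem sigma_lt {N : ℕ} (l : Fin N → ℤ) {i j : Fin N} (hij : i < j) (h : l i = l j) :
    sigma l i < sigma l j := by
  by_contra hlt
  have hne : sigma l j ≠ sigma l i := fun e => hij.ne' ((sigma l).injective e)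
  have hlt' : sigma l j < sigma l i := lt_of_le_of_ne (not_lt.mp hlt) hne
  have := (Tuple.eq_sort_iff.mp (rfl : sortPerm l = Tuple.sort fun i => -l i)).2 _ _ hlt'
    (by simp [sigma, h])
  simp only [sigma, Equiv.apply_symm_apply] at this
  exact absurd hij (not_lt.mpr this.le)

/-- The dominance order on partitions, `a ⪰ b`. -/
def Dominates {N : ℕ} (a b : Fin N → ℤ) : Prop :=
  (∀ i, ∑ j ∈ Finset.Iic i, b j ≤ ∑ j ∈ Finset.Iic i, a j) ∧ ∑ j, a j = ∑ j, b j

/-- The strict order `l ≻ m` on `ℤ^N`: either `l⁺ ≻ m⁺`, or `l⁺ = m⁺` and the last non-zero entry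
of `l - m` is negative. -/
def Succ {N : ℕ} (l m : Fin N → ℤ) : Prop :=
  (Dominates (plus l) (plus m) ∧ plus l ≠ plus m) ∨
    (plus l = plus m ∧ ∃ i, l i - m i < 0 ∧ ∀ j, i < j → l j - m j = 0)

/-- `ζ_i(l) = p^{l_i} q^{2σ(i) - N - 1}`, where `σ(i)` is counted from `1`. -/
def zeta {N : ℕ} (p q : ℂ) (l : Fin N → ℤ) (i : Fin N) : ℂ :=
  p ^ l i * q ^ (2 * (((sigma l i : ℕ) : ℤ) + 1) - N - 1)

/-- `f` is the non-symmetric Macdonald polynomial `Φ^l`: a common eigenvector of the operators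
`Y_i` with eigenvalues `ζ_i(l)`, of the form `z^l + ∑_{l ≻ m} c(l,m) z^m`. -/
structure IsMacdonald {N : ℕ} (p q : ℂ) (l : Fin N → ℤ) (f : Laurent N) : Prop where
  eigen : ∀ i, Y p q i f = zeta p q l i • f
  coeff_self : f.coeff l = 1
  triangular : ∀ m, m ≠ l → f.coeff m ≠ 0 → Succ l m

/-! ### The tensor power of `V = ℂⁿ` and the `q`-wedge product -/

/-- The tensor power `⊗^N V` of `V = ℂⁿ`. -/
abbrev TPow (n N : ℕ) : Type := ⨂[ℂ] _ : Fin N, (Fin n → ℂ)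

/-- The pure tensor `v_e = v_{e_1} ⊗ ⋯ ⊗ v_{e_N}` of vectors of the standard basis. -/
def vTensor {n N : ℕ} (e : Fin N → Fin n) : TPow n N :=
  PiTensorProduct.tprod ℂ fun i => Pi.single (e i) 1

/-- The matrix unit `E^{a,b}`, `v_c ↦ δ_{b,c} v_a`. -/
def E {n : ℕ} (a b : Fin n) : Module.End ℂ (Fin n → ℂ) :=
  LinearMap.single ℂ (fun _ : Fin n => ℂ) a ∘ₗ LinearMap.proj b

/-- The matrix unit `E^{a,b}` acting in the `i`-th tensor factor. -/
def Eat {n N : ℕ} (i : Fin N) (a b : Fin n) : Module.End ℂ (TPow n N) :=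
  PiTensorProduct.map (Function.update (fun _ => LinearMap.id) i (E a b))

/-- The operator `S` acting in the `i`-th and `j`-th tensor factors. -/
def S {n N : ℕ} (q : ℂ) (i j : Fin N) : Module.End ℂ (TPow n N) :=
  -q⁻¹ • (∑ a : Fin n, Eat i a a * Eat j a a)
    + (q - q⁻¹) • (∑ a : Fin n, ∑ b : Fin n, if a < b then Eat i a a * Eat j b b else 0)
    + (-1 : ℂ) • (∑ a : Fin n, ∑ b : Fin n, if a ≠ b then Eat i a b * Eat j b a else 0)

/-- The inverse of `S_{i,j}`, see `S_mul_SInv` and `SInv_mul_S`. -/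
def SInv {n N : ℕ} (q : ℂ) (i j : Fin N) : Module.End ℂ (TPow n N) :=
  S q i j + (q⁻¹ - q) • 1

theorem tpow_ext {n N : ℕ} {A B : Module.End ℂ (TPow n N)}
    (h : ∀ e, A (vTensor e) = B (vTensor e)) : A = B := by
  apply (Basis.piTensorProduct fun _ : Fin N => Pi.basisFun ℂ (Fin n)).ext
  intro e
  simpa [vTensor] using h e

theorem Eat_vTensor {n N : ℕ} (i : Fin N) (a b : Fin n) (e : Fin N → Fin n) :
    Eat i a b (vTensor e) = if e i = b then vTensor (Function.update e i a) else 0 := by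
  rw [Eat, vTensor, PiTensorProduct.map_tprod]
  split_ifs with h
  · rw [vTensor]
    congr 1
    funext x
    by_cases hx : x = i
    · subst hx
      simp [E, h]
    · simp [hx]
  · apply MultilinearMap.map_coord_zero _ i
    simp [E, h]

/-- The action of `S_{i,j}` on the basis tensors. -/
theorem S_vTensor {n N : ℕ} (q : ℂ) {i j : Fin N} (hij : i ≠ j) (e : Fin N → Fin n) :
    S q i j (vTensor e) =
      if e i = e j then -q⁻¹ • vTensor e
      else (if e i < e j then q - q⁻¹ else 0) • vTensor e
        + (-1 : ℂ) • vTensor (e ∘ Equiv.swap i j) := by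
  have hE : ∀ a b c d : Fin n, (Eat i a b * Eat j c d) (vTensor e) =
      if e j = d ∧ e i = b then vTensor (Function.update (Function.update e j c) i a) else 0 := by
    intro a b c d
    rw [Module.End.mul_apply, Eat_vTensor]
    by_cases h : e j = d
    · simp [h, Eat_vTensor, hij]
    · simp [h]
  have hsw : Function.update (Function.update e j (e i)) i (e j) = e ∘ Equiv.swap i j := by
    funext x
    by_cases hx : x = i
    · subst hx; simp
    · by_cases hx' : x = j
      · subst hx'; simp [hx]
      · simp [hx, hx', Equiv.swap_apply_of_ne_of_ne]
  have hself : Function.update (Function.update e j (e j)) i (e i) = e := by simp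
  have h1 : ∑ a : Fin n, (Eat i a a * Eat j a a) (vTensor e)
      = if e i = e j then vTensor e else 0 := by
    rw [Finset.sum_eq_single (e i)]
    · rw [hE]
      by_cases h : e i = e j
      · rw [if_pos h, if_pos ⟨h.symm, rfl⟩]
        congr 1
        funext x
        by_cases hx : x = i
        · subst hx; simp
        · by_cases hx' : x = j
          · subst hx'; simp [hx, h]
          · simp [hx, hx']
      · simp [h, Ne.symm h]
    · intro a _ ha
      rw [hE, if_neg]
      exact fun h => ha h.2.symm
    · simp
  have h2 : ∑ a : Fin n, ∑ b : Fin n,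
      (if a < b then Eat i a a * Eat j b b else 0 : Module.End ℂ (TPow n N)) (vTensor e)
      = if e i < e j then vTensor e else 0 := by
    rw [Finset.sum_eq_single (e i), Finset.sum_eq_single (e j)]
    · by_cases h : e i < e j
      · rw [if_pos h, if_pos h, hE, if_pos ⟨rfl, rfl⟩, hself]
      · rw [if_neg h, if_neg h, LinearMap.zero_apply]
    · intro b _ hb
      split_ifs
      · rw [hE, if_neg]
        exact fun h => hb h.1.symm
      · simp
    · simp
    · intro a _ ha
      apply Finset.sum_eq_zero
      intro b _
      split_ifs
      · rw [hE, if_neg]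
        exact fun h => ha h.2.symm
      · simp
    · simp
  have h3 : ∑ a : Fin n, ∑ b : Fin n,
      (if a ≠ b then Eat i a b * Eat j b a else 0 : Module.End ℂ (TPow n N)) (vTensor e)
      = if e i = e j then 0 else vTensor (e ∘ Equiv.swap i j) := by
    rw [Finset.sum_eq_single (e j), Finset.sum_eq_single (e i)]
    · by_cases h : e i = e j
      · simp [h]
      · rw [if_pos (Ne.symm h), if_neg h, hE, if_pos ⟨rfl, rfl⟩, hsw]
    · intro b _ hb
      split_ifs
      · rw [hE, if_neg]
        exact fun h => hb h.2.symm
      · simp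
    · simp
    · intro a _ ha
      apply Finset.sum_eq_zero
      intro b _
      split_ifs
      · rw [hE, if_neg]
        exact fun h => ha h.1.symm
      · simp
    · simp
  rw [S, LinearMap.add_apply, LinearMap.add_apply, LinearMap.smul_apply, LinearMap.smul_apply,
    LinearMap.smul_apply]
  simp only [LinearMap.sum_apply]
  rw [h1, h2, h3]
  by_cases h : e i = e j
  · simp only [h, if_true, lt_irrefl, if_false, smul_zero, add_zero]
  · by_cases h' : e i < e j <;>
      simp only [h, h', if_true, if_false, smul_zero, zero_smul, zero_add]

/-- The quadratic Hecke relation for `S_{i,j}`. -/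
theorem S_mul_S {n N : ℕ} {q : ℂ} (hq : q ≠ 0) {i j : Fin N} (hij : i ≠ j) :
    (S q i j * S q i j : Module.End ℂ (TPow n N)) = (q - q⁻¹) • S q i j + 1 := by
  apply tpow_ext
  intro e
  have hs : (e ∘ Equiv.swap i j) ∘ Equiv.swap i j = e := by funext x; simp
  rw [Module.End.mul_apply, LinearMap.add_apply, LinearMap.smul_apply, Module.End.one_apply]
  rcases lt_trichotomy (e i) (e j) with h | h | h
  · simp only [S_vTensor q hij, h, h.ne, h.ne', h.not_gt, map_add, map_smul, if_true, if_false,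
      Function.comp_apply, Equiv.swap_apply_left, Equiv.swap_apply_right, hs, smul_add, smul_smul,
      zero_smul, zero_add]
    module
  · simp only [S_vTensor q hij, h, map_smul, if_true, smul_smul]
    nth_rewrite 3 [← one_smul ℂ (vTensor e)]
    rw [← add_smul]
    congr 1
    field_simp
    ring
  · simp only [S_vTensor q hij, h, h.ne, h.ne', h.not_gt, map_smul, if_true, if_false,
      Function.comp_apply, Equiv.swap_apply_left, Equiv.swap_apply_right, hs, smul_add, smul_smul,
      zero_smul, zero_add]
    module

theorem S_mul_SInv {n N : ℕ} {q : ℂ} (hq : q ≠ 0) {i j : Fin N} (hij : i ≠ j) :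
    (S q i j * SInv q i j : Module.End ℂ (TPow n N)) = 1 := by
  rw [SInv, mul_add, S_mul_S hq hij, mul_smul_comm, mul_one, add_right_comm, ← add_smul]
  simp

theorem SInv_mul_S {n N : ℕ} {q : ℂ} (hq : q ≠ 0) {i j : Fin N} (hij : i ≠ j) :
    (SInv q i j * S q i j : Module.End ℂ (TPow n N)) = 1 := by
  rw [SInv, add_mul, S_mul_S hq hij, smul_mul_assoc, one_mul, add_right_comm, ← add_smul]
  simp

/-- The tensor power `⊗^N V(z) = ℂ[z₁^{±1}, …, z_N^{±1}] ⊗ (⊗^N V)` of `V(z) = ℂ[z^{±1}] ⊗ V`. -/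
abbrev TVz (n N : ℕ) : Type := Laurent N ⊗[ℂ] TPow n N

/-- The subspace `Ω = ∑_{i=1}^{N-1} Ker(g_{i,i+1} + S_{i,i+1}⁻¹)` of `⊗^N V(z)`. -/
def Omega (n N : ℕ) (q : ℂ) : Submodule ℂ (TVz n N) :=
  ⨆ (i : Fin N) (j : Fin N) (_ : (i : ℕ) + 1 = j),
    LinearMap.ker (LinearMap.rTensor (TPow n N) (g q i j)
      + LinearMap.lTensor (Laurent N) (SInv q i j))

/-- The `q`-wedge product `∧^N V(z) = ⊗^N V(z) / Ω`. -/
abbrev Wedge (n N : ℕ) (q : ℂ) : Type := TVz n N ⧸ Omega n N q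

/-- The quotient map `Λ : ⊗^N V(z) → ∧^N V(z)`. -/
def Lam (n N : ℕ) (q : ℂ) : TVz n N →ₗ[ℂ] Wedge n N q := (Omega n N q).mkQ

/-! ### Labels and genericity -/

/-- The set `M_N^n` of non-decreasing `n`-strict sequences: no value occurs more than `n` times. -/
def MSet (n N : ℕ) : Set (Fin N → ℤ) :=
  {m | Monotone m ∧ ∀ a : ℤ, (Finset.univ.filter fun i => m i = a).card ≤ n}

/-- The set `E(m)`: sequences in `{1, …, n}` with `e_i > e_{i+1}` whenever `m_i = m_{i+1}`. -/
def ESet (n : ℕ) {N : ℕ} (m : Fin N → ℤ) : Set (Fin N → Fin n) :=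
  {e | ∀ i j : Fin N, (i : ℕ) + 1 = j → m i = m j → e j < e i}

/-- The set of labels `(m, e)` with `m ∈ M_N^n` and `e ∈ E(m)`. -/
abbrev Label (n N : ℕ) : Type :=
  {x : (Fin N → ℤ) × (Fin N → Fin n) // x.1 ∈ MSet n N ∧ x.2 ∈ ESet n x.1}

/-- The vector `φ(m,e) = Λ(Φ^m ⊗ v_e)`, for a given family `Φ`. -/
def phi {n N : ℕ} (q : ℂ) (Φ : (Fin N → ℤ) → Laurent N) (x : Label n N) : Wedge n N q :=
  Lam n N q (Φ x.1.1 ⊗ₜ[ℂ] vTensor x.1.2)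

/-- Generic parameters: `q ≠ 0` is not a root of unity (`q = 1` is allowed), `p ≠ 0`, and
`p ∉ q^{2ℚ_{≥0}}`, that is, `p` is not a `b`-th root of `q^{2a}` for integers `a ≥ 0`, `b ≥ 1`. -/
structure IsGeneric (p q : ℂ) : Prop where
  q_ne_zero : q ≠ 0
  q_not_root : ∀ k : ℕ, 0 < k → q ^ k = 1 → q = 1
  p_ne_zero : p ≠ 0
  p_not_pow : ∀ a b : ℕ, 0 < b → p ^ b ≠ q ^ (2 * a)

end QWedge

end

noncomputable section

namespace QWedge

/-! ### Adjacent transpositions and inversions -/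

/-! The operators `Y` commute and are triangular for the order `Succ`, with diagonal entries `zeta`.
For generic parameters the joint spectrum is simple (`IsGeneric.zeta_injective`), and every exponent
has finitely many exponents below it. So the joint eigenvectors exist, are unique, and form a basis
of the Laurent polynomials (`exists_isMacdonald`, `IsMacdonald.unique`, `macdonaldBasis`). The
affine Hecke intertwiners describe the adjacent `g` on this basis: it acts on `Φ l` as the scalar
`q` when `l i = l j`, and otherwise `Φ (l ∘ swap i j)` is a combination of `g (Φ l)` and `Φ l`
(`IsMacdonald.g_of_eq`, `IsMacdonald.g_of_lt`).

Spanning: in the quotient, `g` on polynomials may be traded for `S` on tensors (`Lam_g_tmul`). This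
sorts the exponent into non-decreasing order. On a block of equal exponents `g` is the scalar `q`,
so there `S - q` acts as zero, which orders the tensor indices decreasingly up to a scalar and kills
repeated indices because `q + q⁻¹ ≠ 0`.

Independence: for each label a functional on the quotient is built that vanishes on all the other
vectors (`exists_dual_functional`). A functional on the tensor product that intertwines `g` with `S`
is the same as a Hecke homomorphism from the Laurent polynomials to the dual of the tensor power,
and it vanishes on `Omega` by `Omega_le_ker`. Such homomorphisms are plentiful by
`exists_hecke_hom`: the images of `Φ m` for non-decreasing `m` may be chosen freely, subject to `T w
= q w` on equal neighbours. The remaining values are forced by products of R-matrices, and the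
Yang-Baxter equation makes them independent of the chosen path. At `m` one takes the q-antisymmetric
functional supported on the orbit of `e`, and zero at the other non-decreasing exponents. -/

theorem ne_of_adj {N : ℕ} {i j : Fin N} (hij : (i : ℕ) + 1 = j) : i ≠ j := by
  rintro rfl
  omega

theorem lt_of_adj {N : ℕ} {i j : Fin N} (hij : (i : ℕ) + 1 = j) : i < j := by
  rw [Fin.lt_def]
  omega

theorem swap_lt_swap {N : ℕ} {i j : Fin N} (hij : (i : ℕ) + 1 = j) {a b : Fin N} (hab : a < b)
    (h : ¬ (a = i ∧ b = j)) : Equiv.swap i j a < Equiv.swap i j b := by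
  rw [Equiv.swap_apply_def, Equiv.swap_apply_def]
  simp only [Fin.ext_iff] at h ⊢
  rw [Fin.lt_def] at hab ⊢
  split_ifs <;> omega

/-- The set of inversions of a sequence. -/
def invSet {N : ℕ} {α : Type*} [LinearOrder α] (x : Fin N → α) : Finset (Fin N × Fin N) :=
  Finset.univ.filter fun p => p.1 < p.2 ∧ x p.2 < x p.1

/-- An adjacent transposition preserves the order of every pair of positions except `(i, j)`, so it
carries old inversions to new ones and `(i, j)` is the only addition. This count drives every
straightening induction below. -/
theorem card_invSet_comp_swap {N : ℕ} {α : Type*} [LinearOrder α] {i j : Fin N}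
    (hij : (i : ℕ) + 1 = j) (x : Fin N → α) (h : x i < x j) :
    (invSet (x ∘ Equiv.swap i j)).card = (invSet x).card + 1 := by
  have key : invSet (x ∘ Equiv.swap i j) = insert (i, j)
      ((invSet x).map (Equiv.prodCongr (Equiv.swap i j) (Equiv.swap i j)).toEmbedding) := by
    ext ⟨a, b⟩
    simp only [invSet, Finset.mem_filter, Finset.mem_univ, true_and, Function.comp_apply,
      Finset.mem_insert, Prod.mk.injEq, Finset.mem_map_equiv, Equiv.prodCongr_symm,
      Equiv.prodCongr_apply, Prod.map_apply, Equiv.symm_swap]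
    by_cases hab : a = i ∧ b = j
    · obtain ⟨rfl, rfl⟩ := hab
      simp [h, lt_of_adj hij]
    · simp only [hab, false_or]
      refine and_congr_left fun hx => ⟨fun h' => swap_lt_swap hij h' hab, fun h' => ?_⟩
      by_cases h'' : Equiv.swap i j a = i ∧ Equiv.swap i j b = j
      · rw [h''.1, h''.2] at hx
        exact absurd h hx.not_gt
      · simpa using swap_lt_swap hij h' h''
  rw [key, Finset.card_insert_of_notMem, Finset.card_map]
  simp only [invSet, Finset.mem_map_equiv, Finset.mem_filter, Finset.mem_univ, true_and,
    Equiv.prodCongr_symm, Equiv.prodCongr_apply, Prod.map_apply, Equiv.symm_swap,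
    Equiv.swap_apply_left, Equiv.swap_apply_right, not_and]
  intro h'
  exact absurd h' (lt_of_adj hij).not_gt

theorem comp_swap_comp_swap {N : ℕ} {α : Type*} (i j : Fin N) (x : Fin N → α) :
    (x ∘ Equiv.swap i j) ∘ Equiv.swap i j = x := by
  funext k
  simp

theorem comp_swap_of_eq {N : ℕ} {α : Type*} {i j : Fin N} {x : Fin N → α} (h : x i = x j) :
    x ∘ Equiv.swap i j = x := by
  funext k
  simp only [Function.comp_apply, Equiv.swap_apply_def]
  split_ifs with h1 h2
  · rw [h1, h]
  · rw [h2, h]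
  · rfl

theorem monotone_of_adj {N : ℕ} {α : Type*} [Preorder α] {x : Fin N → α}
    (h : ∀ i j : Fin N, (i : ℕ) + 1 = j → x i ≤ x j) : Monotone x := by
  cases N with
  | zero => intro a; exact a.elim0
  | succ N =>
    rw [Fin.monotone_iff_le_succ]
    intro i
    exact h _ _ (by simp)

theorem strictMono_of_adj {N : ℕ} {α : Type*} [Preorder α] {x : Fin N → α}
    (h : ∀ i j : Fin N, (i : ℕ) + 1 = j → x i < x j) : StrictMono x := by
  cases N with
  | zero => intro a; exact a.elim0
  | succ N =>
    rw [Fin.strictMono_iff_lt_succ]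
    intro i
    exact h _ _ (by simp)

/-! ### The sorting permutation -/

theorem plus_comp_perm {N : ℕ} (l : Fin N → ℤ) (τ : Equiv.Perm (Fin N)) :
    plus (l ∘ τ) = plus l := by
  have h := Tuple.comp_perm_comp_sort_eq_comp_sort (f := fun i => -l i) (σ := τ)
  funext k
  have := congrFun h k
  simp only [Function.comp_apply, neg_inj] at this
  exact this

theorem sum_plus {N : ℕ} (l : Fin N → ℤ) (φ : ℤ → ℤ) : ∑ i, φ (plus l i) = ∑ i, φ (l i) :=
  Equiv.sum_comp (sortPerm l) fun i => φ (l i)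

/-- Exchanging two distinct neighbours does not alter the relative order of equal entries, so the
transported permutation still satisfies the characterization of the stable sort. -/
theorem sigma_comp_swap {N : ℕ} {i j : Fin N} (hij : (i : ℕ) + 1 = j) (l : Fin N → ℤ)
    (h : l i ≠ l j) (k : Fin N) : sigma (l ∘ Equiv.swap i j) k = sigma l (Equiv.swap i j k) := by
  have key : (sortPerm l).trans (Equiv.swap i j) = sortPerm (l ∘ Equiv.swap i j) := by
    refine Tuple.eq_sort_iff.mpr ?_
    have hs := (Tuple.eq_sort_iff (σ := sortPerm l) (f := fun i => -l i)).mp rfl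
    refine ⟨?_, ?_⟩
    · intro a b hab
      simpa using hs.1 hab
    · intro a b hab he
      simp only [Equiv.trans_apply, Function.comp_apply, Equiv.swap_apply_self] at he ⊢
      apply swap_lt_swap hij (hs.2 a b hab he)
      rintro ⟨e1, e2⟩
      rw [e1, e2] at he
      exact h (neg_inj.mp he)
  rw [sigma, ← key]
  simp [sigma]

theorem sigma_lt_iff {N : ℕ} (l : Fin N → ℤ) (k i : Fin N) :
    sigma l k < sigma l i ↔ l i < l k ∨ (l k = l i ∧ k < i) := by
  have anti : ∀ a b : Fin N, sigma l a ≤ sigma l b → l b ≤ l a := fun a b hab => by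
    have := plus_antitone l hab
    rwa [plus_sigma, plus_sigma] at this
  constructor
  · intro h
    rcases (anti k i h.le).lt_or_eq with h1 | h1
    · exact Or.inl h1
    · refine Or.inr ⟨h1.symm, ?_⟩
      by_contra h2
      rcases (not_lt.mp h2).lt_or_eq with h3 | h3
      · exact absurd (sigma_lt l h3 h1) h.not_gt
      · rw [h3] at h
        exact lt_irrefl _ h
  · rintro (h | ⟨h1, h2⟩)
    · by_contra h'
      exact absurd (anti i k (not_lt.mp h')) h.not_ge
    · exact sigma_lt l h2 h1

/-- Counted from zero, the position of `i` is the number of indices sorted before it. In this form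
the exponent of `q` in `zeta` can be matched with a product of one factor per index. -/
theorem sigma_eq_card {N : ℕ} (l : Fin N → ℤ) (i : Fin N) :
    (sigma l i : ℕ) = (Finset.univ.filter fun k => l i < l k ∨ (l k = l i ∧ k < i)).card := by
  have : (Finset.univ.filter fun k => l i < l k ∨ (l k = l i ∧ k < i))
      = (Finset.Iio (sigma l i)).map (sigma l).symm.toEmbedding := by
    ext k
    simp [Finset.mem_map_equiv, ← sigma_lt_iff]
  rw [this, Finset.card_map, Fin.card_Iio]

/-! ### Dominance -/

/-- Sums of `max (x - t) 0` do not depend on the order of the entries, so dominance can be tested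
without sorting. For the partial sum up to `k`, take `t` to be the `k`-th sorted entry of `a`: the
positive parts then sum exactly to the partial sum for `a` and bound the one for `b`. -/
theorem dominates_of_sum_max {N : ℕ} {a b : Fin N → ℤ}
    (h : ∀ t, ∑ i, max (b i - t) 0 ≤ ∑ i, max (a i - t) 0) (hs : ∑ i, a i = ∑ i, b i) :
    Dominates (plus a) (plus b) := by
  refine ⟨fun k => ?_, ?_⟩
  · set t := plus a k with ht
    have h1 : ∑ j ∈ Finset.Iic k, (plus b j - t) ≤ ∑ j, max (plus b j - t) 0 :=
      (Finset.sum_le_sum fun j _ => le_max_left _ _).trans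
        (Finset.sum_le_sum_of_subset_of_nonneg (Finset.subset_univ _)
          fun j _ _ => le_max_right _ _)
    have h2 : ∑ j, max (plus a j - t) 0 = ∑ j ∈ Finset.Iic k, (plus a j - t) := by
      rw [← Finset.sum_subset (Finset.subset_univ (Finset.Iic k))]
      · refine Finset.sum_congr rfl fun j hj => max_eq_left ?_
        have := plus_antitone a (Finset.mem_Iic.mp hj)
        omega
      · intro j _ hj
        have := plus_antitone a (not_le.mp fun h => hj (Finset.mem_Iic.mpr h)).le
        apply max_eq_right
        omega
    have h3 := sum_plus b fun x => max (x - t) 0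
    have h4 := sum_plus a fun x => max (x - t) 0
    have h5 := h t
    rw [← h3, ← h4, h2] at h5
    have h6 := h1.trans h5
    rw [Finset.sum_sub_distrib, Finset.sum_sub_distrib] at h6
    omega
  · rw [sum_plus a fun x => x, sum_plus b fun x => x, hs]

theorem Dominates.trans {N : ℕ} {a b c : Fin N → ℤ} (h : Dominates a b) (h' : Dominates b c) :
    Dominates a c :=
  ⟨fun i => (h'.1 i).trans (h.1 i), h.2.trans h'.2⟩

theorem Dominates.antisymm {N : ℕ} {a b : Fin N → ℤ} (h : Dominates a b) (h' : Dominates b a) :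
    a = b := by
  have hsum : ∀ i, ∑ j ∈ Finset.Iic i, a j = ∑ j ∈ Finset.Iic i, b j :=
    fun i => le_antisymm (h'.1 i) (h.1 i)
  funext i
  induction i using WellFoundedLT.induction with
  | ind i ih =>
    have := hsum i
    rw [← Finset.Iio_insert, Finset.sum_insert (by simp), Finset.sum_insert (by simp),
      Finset.sum_congr rfl fun j hj => ih j (Finset.mem_Iio.mp hj)] at this
    exact add_right_cancel this

/-- The part of the order `Succ` that compares the sorted sequences. -/
def SuccPlus {N : ℕ} (l m : Fin N → ℤ) : Prop :=
  Dominates (plus l) (plus m) ∧ plus l ≠ plus m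

theorem SuccPlus.succ {N : ℕ} {l m : Fin N → ℤ} (h : SuccPlus l m) : Succ l m := Or.inl h

theorem SuccPlus.trans {N : ℕ} {l m k : Fin N → ℤ} (h : SuccPlus l m) (h' : SuccPlus m k) :
    SuccPlus l k :=
  ⟨h.1.trans h'.1, fun e => h.2 (h.1.antisymm (e ▸ h'.1))⟩

theorem Succ.trans {N : ℕ} {l m k : Fin N → ℤ} (h : Succ l m) (h' : Succ m k) : Succ l k := by
  rcases h with h | ⟨e, i, hi, hi'⟩
  · rcases h' with h' | ⟨e', -⟩
    · exact Or.inl (SuccPlus.trans h h')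
    · exact Or.inl (e' ▸ h)
  · rcases h' with h' | ⟨e', i', hi1, hi2⟩
    · exact Or.inl (e ▸ h')
    · refine Or.inr ⟨e.trans e', ?_⟩
      rcases lt_trichotomy i i' with hlt | rfl | hlt
      · refine ⟨i', ?_, fun j hj => ?_⟩
        · have := hi' i' hlt
          omega
        · have := hi' j (hlt.trans hj)
          have := hi2 j hj
          omega
      · refine ⟨i, by omega, fun j hj => ?_⟩
        have := hi' j hj
        have := hi2 j hj
        omega
      · refine ⟨i, ?_, fun j hj => ?_⟩
        · have := hi2 i hlt
          omega
        · have := hi' j hj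
          have := hi2 j (hlt.trans hj)
          omega

theorem Succ.irrefl {N : ℕ} (l : Fin N → ℤ) : ¬ Succ l l := by
  rintro (h | ⟨-, i, hi, -⟩)
  · exact h.2 rfl
  · omega

theorem Succ.dominates {N : ℕ} {l m : Fin N → ℤ} (h : Succ l m) :
    Dominates (plus l) (plus m) := by
  rcases h with h | ⟨e, -⟩
  · exact h.1
  · rw [e]
    exact ⟨fun _ => le_rfl, rfl⟩

theorem finite_setOf_succ {N : ℕ} (l : Fin N → ℤ) : {m | Succ l m}.Finite := by
  rcases N with _ | N
  · exact Set.toFinite _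
  set M := plus l 0
  set s := ∑ i, l i
  apply (Set.finite_Icc (fun _ : Fin (N + 1) => min M (s - N * M)) (fun _ => M)).subset
  intro m hm
  have hd := hm.dominates
  have h0 : plus m 0 ≤ M := by
    have := hd.1 0
    simpa [show Finset.Iic (0 : Fin (N + 1)) = {0} from by ext; simp] using this
  have hle : ∀ i, m i ≤ M := fun i => by
    rw [← plus_sigma m i]
    exact (plus_antitone m (Fin.zero_le _)).trans h0
  have hsum : s = ∑ i, m i := by
    have := hd.2
    rwa [sum_plus l fun x => x, sum_plus m fun x => x] at this
  refine ⟨fun i => ?_, hle⟩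
  -- The total is fixed and the other `N` of the `N + 1` entries are at most `M`.
  refine (min_le_right _ _).trans (?_ : s - N * M ≤ m i)
  have h1 : ∑ j ∈ Finset.univ.erase i, m j ≤ ∑ j ∈ Finset.univ.erase i, M :=
    Finset.sum_le_sum fun j _ => hle j
  rw [Finset.sum_const, Finset.card_erase_of_mem (Finset.mem_univ _), Finset.card_univ,
    Fintype.card_fin, nsmul_eq_mul] at h1
  have h2 := Finset.add_sum_erase Finset.univ m (Finset.mem_univ i)
  simp only [Nat.add_sub_cancel] at h1
  omega

/-- The number of elements below `l`. -/
def rank {N : ℕ} (l : Fin N → ℤ) : ℕ := {m | Succ l m}.ncard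

/-- Turns the partial order into a natural-number measure, for well-founded induction and for
picking maximal exponents. -/
theorem Succ.rank_lt {N : ℕ} {l m : Fin N → ℤ} (h : Succ l m) : rank m < rank l := by
  have hsub : {k | Succ m k} ⊆ {k | Succ l k} := fun k hk => Succ.trans h hk
  apply Set.ncard_lt_ncard _ (finite_setOf_succ l)
  rw [Set.ssubset_iff_of_subset hsub]
  exact ⟨m, h, Succ.irrefl m⟩

/-- Moving part of the gap from the larger entry to the smaller one averages them, which lowers the
sorted sequence in dominance. These are the interior monomials of a divided difference. -/
theorem succPlus_update {N : ℕ} {i j : Fin N} (hij : i ≠ j) (l : Fin N → ℤ) (k : ℕ) (hk : 0 < k)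
    (hk' : (k : ℤ) < l j - l i) :
    SuccPlus l (Function.update (Function.update l i (l i + k)) j (l j - k)) := by
  set m := Function.update (Function.update l i (l i + k)) j (l j - k) with hm
  have hsplit : ∀ (φ : ℤ → ℤ) (x : Fin N → ℤ),
      ∑ a, φ (x a) = φ (x i) + φ (x j) + ∑ a ∈ (Finset.univ.erase i).erase j, φ (x a) := by
    intro φ x
    rw [← Finset.add_sum_erase _ (fun a => φ (x a)) (Finset.mem_univ i),
      ← Finset.add_sum_erase _ (fun a => φ (x a)) (Finset.mem_erase.mpr ⟨hij.symm,
        Finset.mem_univ j⟩), add_assoc]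
  have hmi : m i = l i + k := by simp [hm, hij]
  have hmj : m j = l j - k := by simp [hm]
  have hrest : ∀ φ : ℤ → ℤ, ∑ a ∈ (Finset.univ.erase i).erase j, φ (m a)
      = ∑ a ∈ (Finset.univ.erase i).erase j, φ (l a) := by
    intro φ
    refine Finset.sum_congr rfl fun a ha => ?_
    simp only [Finset.mem_erase] at ha
    simp [hm, ha.1, ha.2.1]
  refine ⟨dominates_of_sum_max (fun t => ?_) ?_, fun e => ?_⟩
  · rw [hsplit (fun x => max (x - t) 0) m, hsplit (fun x => max (x - t) 0) l,
      hrest fun x => max (x - t) 0, hmi, hmj]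
    omega
  · rw [hsplit (fun x => x) m, hsplit (fun x => x) l, hrest fun x => x, hmi, hmj]
    ring
  -- Strictness: the sum of squares is invariant under sorting but drops by `2k(l j - l i - k) > 0`.
  · have h1 := sum_plus l fun x => x * x
    have h2 := sum_plus m fun x => x * x
    rw [e] at h1
    have h3 := h1.symm.trans h2
    rw [hsplit (fun x => x * x) m, hsplit (fun x => x * x) l, hrest fun x => x * x, hmi, hmj] at h3
    have h4 : (k : ℤ) * (l j - l i - k) > 0 := by
      apply mul_pos <;> omega
    nlinarith

theorem succ_comp_swap {N : ℕ} {i j : Fin N} (hij : i < j) (l : Fin N → ℤ) (h : l j < l i) :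
    Succ (l) (l ∘ Equiv.swap i j) := by
  refine Or.inr ⟨(plus_comp_perm l _).symm, j, ?_, fun k hk => ?_⟩
  · simp [h]
  · simp [Equiv.swap_apply_of_ne_of_ne (hij.trans hk).ne' hk.ne']

/-! ### Separation of the spectrum -/

/-- For generic `p` and `q`, the numbers `p^{l_i} q^{2τ(i)}` determine `l` and `τ`, when `τ` sorts
`l` in non-increasing order. -/
theorem IsGeneric.spectrum_injective {p q : ℂ} (hpq : IsGeneric p q) {N : ℕ} {l m : Fin N → ℤ}
    {σ τ : Equiv.Perm (Fin N)} (hl : Antitone (l ∘ σ.symm)) (hm : Antitone (m ∘ τ.symm))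
    (h : ∀ i, p ^ l i * q ^ (2 * ((σ i : ℕ) : ℤ)) = p ^ m i * q ^ (2 * ((τ i : ℕ) : ℤ))) :
    l = m ∧ (q ≠ 1 → σ = τ) := by
  have hp := hpq.p_ne_zero
  have hq := hpq.q_ne_zero
  have hzp : ∀ {a b : ℤ}, 0 < a → 0 ≤ b → p ^ a ≠ q ^ (2 * b) := by
    intro a b ha hb e
    lift a to ℕ using ha.le
    lift b to ℕ using hb
    apply hpq.p_not_pow b a (by omega)
    exact_mod_cast e
  -- Here genericity says that `p` is not a root of unity, so the powers of `p` alone determine `l`;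
  -- the permutation is invisible.
  by_cases hq1 : q = 1
  · refine ⟨?_, fun h => absurd hq1 h⟩
    subst hq1
    funext i
    have hi := h i
    simp only [one_zpow, mul_one] at hi
    by_contra hne
    have h1 : p ^ (l i - m i) = 1 := by rw [zpow_sub₀ hp, hi, div_self (zpow_ne_zero _ hp)]
    rcases lt_or_gt_of_ne hne with hlt | hlt
    · refine hzp (a := m i - l i) (b := 0) (by omega) le_rfl ?_
      rw [← neg_sub, zpow_neg, h1]
      simp
    · refine hzp (a := l i - m i) (b := 0) (by omega) le_rfl ?_
      rw [h1]
      simp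
  have hqz : ∀ a b : ℤ, q ^ (2 * a) = q ^ (2 * b) → a = b := by
    intro a b e
    by_contra hne
    have hroot : ∀ c : ℤ, 0 < c → q ^ c ≠ 1 := by
      intro c hc e
      lift c to ℕ using hc.le
      exact hq1 (hpq.q_not_root c (by omega) (by exact_mod_cast e))
    have h1 : q ^ (2 * a - 2 * b) = 1 := by rw [zpow_sub₀ hq, e, div_self (zpow_ne_zero _ hq)]
    rcases lt_or_gt_of_ne hne with hlt | hlt
    · refine hroot (2 * b - 2 * a) (by omega) ?_
      rw [← neg_sub, zpow_neg, h1, inv_one]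
    · exact hroot _ (by omega) h1
  -- A positive power of `p` is never a non-negative power of `q²`, so a discrepancy in the exponent
  -- of `p` forces one of the same sign in the positions.
  have hcmp : ∀ i, (l i = m i ∧ σ i = τ i) ∨ (m i < l i ∧ τ i < σ i) ∨ (l i < m i ∧ σ i < τ i) := by
    intro i
    have e : p ^ (l i - m i) = q ^ (2 * (((τ i : ℕ) : ℤ) - ((σ i : ℕ) : ℤ))) := by
      rw [zpow_sub₀ hp, mul_sub, zpow_sub₀ hq, div_eq_div_iff (zpow_ne_zero _ hp)
        (zpow_ne_zero _ hq), h i]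
      ring
    rcases lt_trichotomy (l i) (m i) with hlt | heq | hlt
    · right; right
      refine ⟨hlt, ?_⟩
      by_contra hge
      have hge' := not_lt.mp hge
      rw [Fin.le_def] at hge'
      refine hzp (a := m i - l i) (b := ((σ i : ℕ) : ℤ) - ((τ i : ℕ) : ℤ)) (by omega) (by omega) ?_
      rw [← neg_sub (l i), zpow_neg, e, ← zpow_neg]
      congr 1
      ring
    · left
      refine ⟨heq, ?_⟩
      rw [heq, sub_self, zpow_zero, ← zpow_zero q, ← mul_zero (2 : ℤ)] at e
      have := hqz _ _ e
      apply Fin.ext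
      omega
    · right; left
      refine ⟨hlt, ?_⟩
      by_contra hge
      have hge' := not_lt.mp hge
      rw [Fin.le_def] at hge'
      exact hzp (a := l i - m i) (b := ((τ i : ℕ) : ℤ) - ((σ i : ℕ) : ℤ)) (by omega) (by omega) e
  -- At the first position `k` where the two sortings differ, put `a = σ.symm k` and `b = τ.symm k`.
  -- Then `σ a < τ a` gives `l a < m a`, and `τ b < σ b` gives `m b < l b`. Sortedness adds `l b ≤ l
  -- a` and `m a ≤ m b`, and the four inequalities form a contradictory cycle.
  have hfix : ∀ k, τ (σ.symm k) = k := by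
    intro k
    induction k using WellFoundedLT.induction with
    | ind k ih =>
      by_contra hne
      have hge : ∀ k', τ (σ.symm k') ≠ k' → k ≤ k' := fun k' hk' =>
        not_lt.mp fun hlt => hk' (ih k' hlt)
      have hgt : k < τ (σ.symm k) := by
        rcases lt_or_ge k (τ (σ.symm k)) with h1 | h1
        · exact h1
        · have h2 := ih _ (lt_of_le_of_ne h1 hne)
          exact absurd (by simpa using h2) hne
      set k' := σ (τ.symm k) with hk'
      have hk'1 : τ (σ.symm k') = k := by simp [hk']
      have hkk' : k < k' := by
        apply lt_of_le_of_ne (hge k' _)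
        · intro e
          rw [← e] at hk'1
          exact hne hk'1
        · intro e
          rw [hk'1] at e
          rw [← e] at hk'1
          exact hne hk'1
      rcases hcmp (σ.symm k) with h1 | h1 | h1
      · rw [Equiv.apply_symm_apply] at h1
        exact hne h1.2.symm
      · rw [Equiv.apply_symm_apply] at h1
        exact absurd h1.2 hgt.not_gt
      · rcases hcmp (σ.symm k') with h2 | h2 | h2
        · rw [Equiv.apply_symm_apply, hk'1] at h2
          exact hkk'.ne h2.2.symm
        · have h3 : l (σ.symm k') ≤ l (σ.symm k) := hl hkk'.le
          have h4 : m (σ.symm k) ≤ m (σ.symm k') := by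
            have := hm (a := τ (σ.symm k')) (b := τ (σ.symm k)) (by rw [hk'1]; exact hgt.le)
            simpa using this
          omega
        · rw [Equiv.apply_symm_apply, hk'1] at h2
          exact absurd h2.2 hkk'.not_gt
  have hστ : σ = τ := by
    ext i
    have := hfix (σ i)
    rw [Equiv.symm_apply_apply] at this
    rw [this]
  refine ⟨?_, fun _ => hστ⟩
  funext i
  rcases hcmp i with h1 | h1 | h1
  · exact h1.1
  · rw [hστ] at h1
    exact absurd h1.2 (lt_irrefl _)
  · rw [hστ] at h1
    exact absurd h1.2 (lt_irrefl _)

theorem comp_sigma_symm {N : ℕ} (l : Fin N → ℤ) : l ∘ (sigma l).symm = plus l := rfl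

theorem zeta_eq {p q : ℂ} (hq : q ≠ 0) {N : ℕ} (l : Fin N → ℤ) (i : Fin N) :
    zeta p q l i = p ^ l i * q ^ (2 * ((sigma l i : ℕ) : ℤ)) * q ^ (1 - N : ℤ) := by
  rw [zeta, mul_assoc, ← zpow_add₀ hq]
  congr 2
  ring

theorem IsGeneric.zeta_injective {p q : ℂ} (hpq : IsGeneric p q) {N : ℕ} {l m : Fin N → ℤ}
    (h : ∀ i, zeta p q l i = zeta p q m i) : l = m := by
  refine (hpq.spectrum_injective (σ := sigma l) (τ := sigma m) ?_ ?_ fun i => ?_).1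
  · rw [comp_sigma_symm]; exact plus_antitone l
  · rw [comp_sigma_symm]; exact plus_antitone m
  · have := h i
    rw [zeta_eq hpq.q_ne_zero, zeta_eq hpq.q_ne_zero] at this
    exact mul_right_cancel₀ (zpow_ne_zero _ hpq.q_ne_zero) this

theorem zeta_comp_swap {p q : ℂ} {N : ℕ} {i j : Fin N} (hij : (i : ℕ) + 1 = j) (l : Fin N → ℤ)
    (h : l i ≠ l j) (k : Fin N) :
    zeta p q (l ∘ Equiv.swap i j) k = zeta p q l (Equiv.swap i j k) := by
  rw [zeta, zeta, sigma_comp_swap hij l h, Function.comp_apply]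

theorem zeta_ne_zero {p q : ℂ} (hpq : IsGeneric p q) {N : ℕ} (l : Fin N → ℤ) (i : Fin N) :
    zeta p q l i ≠ 0 :=
  mul_ne_zero (zpow_ne_zero _ hpq.p_ne_zero) (zpow_ne_zero _ hpq.q_ne_zero)

theorem IsGeneric.q_sq_ne_one {p q : ℂ} (hpq : IsGeneric p q) (hq1 : q ≠ 1) : q ^ 2 ≠ 1 :=
  fun h => hq1 (hpq.q_not_root 2 (by norm_num) h)

/-- If `q² = -1` then `q⁴ = 1`, hence `q = 1`, which is absurd. This makes the Hecke eigenvalues `q`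
and `-q⁻¹` distinct. -/
theorem IsGeneric.q_sq_ne_neg_one {p q : ℂ} (hpq : IsGeneric p q) : q ^ 2 + 1 ≠ 0 := by
  intro h
  have h1 : q = 1 := hpq.q_not_root 4 (by norm_num) (by linear_combination (q ^ 2 - 1) * h)
  rw [h1] at h
  norm_num at h

/-- For `l_i = l_{i+1}` no spectral vector is obtained from `ζ(l)` by exchanging the entries `i` and
`i+1`. -/
theorem IsGeneric.zeta_swap_ne {p q : ℂ} (hpq : IsGeneric p q) (hq1 : q ≠ 1) {N : ℕ}
    {i j : Fin N} (hij : i ≠ j) {l : Fin N → ℤ} (h : l i = l j) (m : Fin N → ℤ)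
    (hm : ∀ k, zeta p q m k = zeta p q l (Equiv.swap i j k)) : False := by
  have hl : l ∘ Equiv.swap i j = l := comp_swap_of_eq h
  -- Since `l i = l j`, the sorting permutation of `l` preceded by the swap still sorts `l`, only
  -- not stably. The spectrum would then force `m = l` and equality of two permutations that differ
  -- by a transposition.
  have key := hpq.spectrum_injective (l := m) (m := l) (σ := sigma m)
    (τ := (Equiv.swap i j).trans (sigma l)) (by rw [comp_sigma_symm]; exact plus_antitone m)
    (by
      have : l ∘ ((Equiv.swap i j).trans (sigma l)).symm = plus l := by
        funext k
        simp only [Function.comp_apply, Equiv.symm_trans_apply, Equiv.symm_swap]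
        rw [← Function.comp_apply (f := l), hl]
        rfl
      rw [this]
      exact plus_antitone l)
    (fun k => by
      have := hm k
      rw [zeta_eq hpq.q_ne_zero, zeta_eq hpq.q_ne_zero] at this
      have := mul_right_cancel₀ (zpow_ne_zero _ hpq.q_ne_zero) this
      rw [this, Equiv.trans_apply, ← Function.comp_apply (f := l), hl])
  obtain ⟨rfl, h2⟩ := key
  have := congrArg (fun σ => σ i) (h2 hq1)
  simp [hij] at this

/-- For `l_i = l_{i+1}` the ratio of the spectral parameters is `q²`. -/
theorem zeta_of_eq {p q : ℂ} (hq : q ≠ 0) {N : ℕ} {i j : Fin N} (hij : (i : ℕ) + 1 = j)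
    {l : Fin N → ℤ} (h : l i = l j) : zeta p q l j = q ^ 2 * zeta p q l i := by
  -- The indices sorted before `j` are those sorted before `i`, together with `i` itself.
  have hs : (sigma l j : ℕ) = sigma l i + 1 := by
    rw [sigma_eq_card, sigma_eq_card, ← Finset.card_insert_of_notMem (a := i) (by simp)]
    congr 1
    ext k
    simp only [Finset.mem_filter, Finset.mem_univ, true_and, Finset.mem_insert, h, Fin.lt_def,
      Fin.ext_iff]
    constructor
    · rintro (h1 | ⟨h1, h2⟩)
      · exact Or.inr (Or.inl h1)
      · rcases Nat.lt_succ_iff_lt_or_eq.mp (hij ▸ h2) with h3 | h3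
        · exact Or.inr (Or.inr ⟨h1, h3⟩)
        · exact Or.inl h3
    · rintro (h1 | h1 | ⟨h1, h2⟩)
      · right
        refine ⟨?_, by omega⟩
        rw [Fin.ext h1, h]
      · exact Or.inl h1
      · exact Or.inr ⟨h1, by omega⟩
  rw [zeta_eq hq, zeta_eq hq, hs, h]
  push_cast
  rw [mul_add, zpow_add₀ hq, mul_one]
  have : q ^ (2 : ℤ) = q ^ 2 := by norm_cast
  rw [this]
  ring

/-- For `l_i < l_j` the spectral parameters differ. -/
theorem IsGeneric.zeta_ne_of_lt {p q : ℂ} (hpq : IsGeneric p q) {N : ℕ} {i j : Fin N}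
    {l : Fin N → ℤ} (h : l i < l j) : zeta p q l j ≠ zeta p q l i := by
  have hs : sigma l j < sigma l i := (sigma_lt_iff l j i).mpr (Or.inl h)
  have hp := hpq.p_ne_zero
  have hq := hpq.q_ne_zero
  rw [zeta_eq hq, zeta_eq hq]
  intro e
  have e := mul_right_cancel₀ (zpow_ne_zero _ hq) e
  rw [Fin.lt_def] at hs
  apply hpq.p_not_pow (sigma l i - sigma l j : ℕ) (l j - l i).toNat (by omega)
  rw [← zpow_natCast, ← zpow_natCast]
  push_cast [hs.le]
  rw [Int.toNat_of_nonneg (by omega), zpow_sub₀ hp, mul_sub, zpow_sub₀ hq,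
    div_eq_div_iff (zpow_ne_zero _ hp) (zpow_ne_zero _ hq), e]
  ring

theorem IsGeneric.zeta_ne {p q : ℂ} (hpq : IsGeneric p q) {N : ℕ} {i j : Fin N}
    {l : Fin N → ℤ} (h : l i ≠ l j) : zeta p q l j ≠ zeta p q l i := by
  rcases lt_or_gt_of_ne h with h | h
  · exact hpq.zeta_ne_of_lt h
  · exact (hpq.zeta_ne_of_lt h).symm

/-! ### Relations between the operators `K`, `p^D` and `g` -/

theorem K_one {N : ℕ} (i j : Fin N) : K i j (1 : Laurent N) = 1 := by
  have h : (1 : Laurent N) = mono 0 := rfl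
  rw [h, K_mono]
  rfl

theorem K_algebraMap {N : ℕ} (i j : Fin N) (z : ℂ) :
    K i j (algebraMap ℂ (Laurent N) z) = algebraMap ℂ (Laurent N) z := by
  rw [Algebra.algebraMap_eq_smul_one, map_smul, K_one]

theorem K_var {N : ℕ} (i j a : Fin N) : K i j (var a : Laurent N) = var (Equiv.swap i j a) := by
  rw [var, K_mono, var]
  congr 1
  funext x
  simp only [Function.comp_apply, Pi.single_apply, Equiv.swap_apply_eq_iff]

theorem pD_mono {N : ℕ} (p : ℂ) (i : Fin N) (l : Fin N → ℤ) :
    pD p i (mono l) = p ^ l i • mono l := ofMono_mono _ _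

theorem pD_mul {N : ℕ} {p : ℂ} (hp : p ≠ 0) (i : Fin N) (f h : Laurent N) :
    pD p i (f * h) = pD p i f * pD p i h := by
  have key : ∀ l m : Fin N → ℤ,
      pD p i (mono l * mono m) = pD p i (mono l) * pD p i (mono m) := by
    intro l m
    rw [mono_mul_mono, pD_mono, pD_mono, pD_mono, smul_mul_smul_comm, mono_mul_mono, Pi.add_apply,
      zpow_add₀ hp]
  have h1 : ∀ l, pD p i ∘ₗ LinearMap.mulLeft ℂ (mono l)
      = LinearMap.mulLeft ℂ (pD p i (mono l)) ∘ₗ pD p i :=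
    fun l => end_ext fun m => key l m
  have h2 : pD p i ∘ₗ LinearMap.mulRight ℂ h
      = LinearMap.mulRight ℂ (pD p i h) ∘ₗ pD p i :=
    end_ext fun l => LinearMap.congr_fun (h1 l) h
  exact LinearMap.congr_fun h2 f

theorem pD_var_self {N : ℕ} (p : ℂ) (i : Fin N) : pD p i (var i) = p • var i := by
  rw [var, pD_mono]
  simp

theorem pD_var_of_ne {N : ℕ} (p : ℂ) {i j : Fin N} (h : j ≠ i) : pD p i (var j) = var j := by
  rw [var, pD_mono]
  simp [h.symm]

theorem var_sub_mul_g' {N : ℕ} (q : ℂ) {i j : Fin N} (hij : i ≠ j) (f : Laurent N) :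
    (var i - var j) * g q i j f
      = (algebraMap ℂ _ q⁻¹ * var i - algebraMap ℂ _ q * var j) * K i j f
        + (algebraMap ℂ _ q - algebraMap ℂ _ q⁻¹) * var i * f := by
  rw [var_sub_mul_g q hij]
  simp only [Algebra.smul_def]
  ring

/-- A multiplicative operator that permutes the variables up to a common scalar conjugates
`g_{a,b}` to `g_{a',b'}`. -/
theorem map_g {N : ℕ} (q : ℂ) {θ : Module.End ℂ (Laurent N)}
    (hmul : ∀ f h, θ (f * h) = θ f * θ h) {c : ℂ} (hc : c ≠ 0) {a b a' b' : Fin N} (hab : a ≠ b)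
    (hab' : a' ≠ b') (ha : θ (var a) = c • var a') (hb : θ (var b) = c • var b')
    (hK : ∀ f, θ (K a b f) = K a' b' (θ f)) (f : Laurent N) :
    θ (g q a b f) = g q a' b' (θ f) := by
  apply mul_left_cancel₀ (var_sub_ne_zero hab')
  have h := congrArg θ (var_sub_mul_g q hab f)
  simp only [map_add, map_sub, hmul, hK, ha, hb, map_smul] at h
  rw [var_sub_mul_g q hab']
  have hcc : algebraMap ℂ (Laurent N) c⁻¹ * algebraMap ℂ (Laurent N) c = 1 := by
    rw [← map_mul, inv_mul_cancel₀ hc, map_one]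
  simp only [Algebra.smul_def] at h ⊢
  -- The formula defining `g` is homogeneous of degree zero in the variables, so the common scalar
  -- `c` cancels.
  linear_combination (algebraMap ℂ (Laurent N) c⁻¹) * h
    - ((var a' - var b') * θ (g q a b f)
      - ((algebraMap ℂ _ q⁻¹ * var a' - algebraMap ℂ _ q * var b') * (K a' b' (θ f) - θ f)
        + (var a' - var b') * (algebraMap ℂ _ q * θ f))) * hcc

theorem K_mul_K {N : ℕ} (i j a b : Fin N) :
    K i j * K a b = K (Equiv.swap i j a) (Equiv.swap i j b) * K i j := by
  apply end_ext
  intro l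
  simp only [Module.End.mul_apply, K_mono]
  congr 1
  funext x
  have := congrArg (fun σ : Equiv.Perm (Fin N) => σ (Equiv.swap i j x))
    (Equiv.swap_apply_apply (Equiv.swap i j) a b)
  simp only [Equiv.Perm.mul_apply, Equiv.swap_inv, Equiv.swap_apply_self] at this
  simp only [Function.comp_apply]
  congr 1
  have h2 := congrArg (Equiv.swap i j) this
  rw [Equiv.swap_apply_self] at h2
  rw [Equiv.swap_apply_apply]
  simp

theorem K_semiconj_g {N : ℕ} (q : ℂ) (i j : Fin N) {a b a' b' : Fin N} (hab : a ≠ b)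
    (ha : Equiv.swap i j a = a') (hb : Equiv.swap i j b = b') :
    SemiconjBy (K i j) (g q a b) (g q a' b') := by
  subst ha hb
  have hab' : Equiv.swap i j a ≠ Equiv.swap i j b := (Equiv.swap i j).injective.ne hab
  have h := map_g q (θ := K i j) (K_mul i j) one_ne_zero hab hab'
    (by rw [one_smul, K_var]) (by rw [one_smul, K_var])
    (fun f => LinearMap.congr_fun (K_mul_K i j a b) f)
  exact LinearMap.ext h

theorem K_semiconj_xi {N : ℕ} (q : ℂ) (i j : Fin N) {a b a' b' : Fin N} (hab : a ≠ b)
    (ha : Equiv.swap i j a = a') (hb : Equiv.swap i j b = b') :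
    SemiconjBy (K i j) (xi q a b) (xi q a' b') := by
  refine SemiconjBy.mul_right ?_ (K_semiconj_g q i j hab ha hb)
  subst ha hb
  exact K_mul_K i j a b

theorem K_semiconj_xiInv {N : ℕ} (q : ℂ) (i j : Fin N) {a b a' b' : Fin N} (hab : a ≠ b)
    (ha : Equiv.swap i j a = a') (hb : Equiv.swap i j b = b') :
    SemiconjBy (K i j) (xiInv q a b) (xiInv q a' b') := by
  refine SemiconjBy.mul_right ?_ ?_
  · have h := K_semiconj_g q i j hab ha hb
    rw [SemiconjBy] at h ⊢
    rw [gInv, gInv, mul_sub, sub_mul, h]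
    simp
  · subst ha hb
    exact K_mul_K i j a b

theorem K_semiconj_pD {N : ℕ} (p : ℂ) (i j a : Fin N) :
    SemiconjBy (K i j) (pD p a) (pD p (Equiv.swap i j a)) := by
  apply end_ext
  intro l
  simp [K_mono, pD_mono]

theorem pD_comm {N : ℕ} (p : ℂ) (a b : Fin N) : Commute (pD p a) (pD p b) := by
  apply end_ext
  intro l
  simp [pD_mono, smul_smul, mul_comm]

theorem pD_comm_K {N : ℕ} (p : ℂ) {a b k : Fin N} (ha : a ≠ k) (hb : b ≠ k) :
    Commute (pD p k) (K a b) := by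
  have := K_semiconj_pD p a b k
  rw [Equiv.swap_apply_of_ne_of_ne ha.symm hb.symm] at this
  exact Commute.symm this

theorem pD_comm_g {N : ℕ} {p : ℂ} (hp : p ≠ 0) (q : ℂ) {a b k : Fin N} (hab : a ≠ b)
    (ha : a ≠ k) (hb : b ≠ k) : Commute (pD p k) (g q a b) := by
  apply LinearMap.ext
  intro f
  refine map_g q (pD_mul hp k) one_ne_zero hab hab ?_ ?_ (fun f => ?_) f
  · rw [one_smul, pD_var_of_ne p ha]
  · rw [one_smul, pD_var_of_ne p hb]
  · exact LinearMap.congr_fun (pD_comm_K p ha hb) f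

theorem pD_mul_pD_comm_K {N : ℕ} (p : ℂ) (a b : Fin N) :
    Commute (pD p a * pD p b) (K a b) := by
  have h1 := K_semiconj_pD p a b a
  have h2 := K_semiconj_pD p a b b
  rw [Equiv.swap_apply_left] at h1
  rw [Equiv.swap_apply_right] at h2
  have := SemiconjBy.mul_right h1 h2
  rw [(pD_comm p b a).eq] at this
  exact Commute.symm this

theorem pD_mul_pD_comm_g {N : ℕ} {p : ℂ} (hp : p ≠ 0) (q : ℂ) {a b : Fin N} (hab : a ≠ b) :
    Commute (pD p a * pD p b) (g q a b) := by
  apply LinearMap.ext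
  intro f
  refine map_g q (θ := pD p a * pD p b) (fun f h => ?_) hp hab hab ?_ ?_ (fun f => ?_) f
  · simp only [Module.End.mul_apply, pD_mul hp]
  · rw [Module.End.mul_apply, pD_var_of_ne p hab, pD_var_self]
  · rw [Module.End.mul_apply, pD_var_self, map_smul, pD_var_of_ne p hab.symm]
  · exact LinearMap.congr_fun (pD_mul_pD_comm_K p a b) f

/-- Linearity of `g` over the polynomials symmetric in the two variables, as for any divided
difference. -/
theorem g_mul_of_K_eq {N : ℕ} (q : ℂ) {a b : Fin N} (hab : a ≠ b) {h : Laurent N}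
    (hh : K a b h = h) (f : Laurent N) : g q a b (h * f) = h * g q a b f := by
  apply mul_left_cancel₀ (var_sub_ne_zero hab)
  rw [mul_left_comm, var_sub_mul_g' q hab, var_sub_mul_g' q hab, K_mul, hh]
  ring

theorem g_comm_g {N : ℕ} (q : ℂ) {a b c d : Fin N} (hab : a ≠ b) (hcd : c ≠ d) (hac : a ≠ c)
    (had : a ≠ d) (hbc : b ≠ c) (hbd : b ≠ d) : Commute (g q a b) (g q c d) := by
  apply LinearMap.ext
  intro f
  simp only [Module.End.mul_apply]
  apply mul_left_cancel₀ (var_sub_ne_zero hab)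
  have hva : K c d (var a) = var a := by rw [K_var, Equiv.swap_apply_of_ne_of_ne hac had]
  have hvb : K c d (var b) = var b := by rw [K_var, Equiv.swap_apply_of_ne_of_ne hbc hbd]
  have hK : K a b (g q c d f) = g q c d (K a b f) :=
    LinearMap.congr_fun (K_semiconj_g q a b hcd (Equiv.swap_apply_of_ne_of_ne hac.symm hbc.symm)
      (Equiv.swap_apply_of_ne_of_ne had.symm hbd.symm)) f
  have h1 : K c d (algebraMap ℂ _ q⁻¹ * var a - algebraMap ℂ _ q * var b)
      = algebraMap ℂ _ q⁻¹ * var a - algebraMap ℂ _ q * var b := by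
    simp only [map_sub, K_mul, K_algebraMap, hva, hvb]
  have h2 : K c d ((algebraMap ℂ _ q - algebraMap ℂ _ q⁻¹) * var a)
      = (algebraMap ℂ _ q - algebraMap ℂ _ q⁻¹) * var a := by
    rw [K_mul, map_sub (K c d), K_algebraMap, K_algebraMap, hva]
  rw [var_sub_mul_g' q hab, hK, ← g_mul_of_K_eq q hcd h1, ← g_mul_of_K_eq q hcd h2, ← map_add,
    ← var_sub_mul_g' q hab, g_mul_of_K_eq q hcd (by rw [map_sub, hva, hvb])]

/-- The braid relation with denominators cleared. Here `x, y, z` are the three variables, `u = q`,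
`w = q⁻¹`, and the prefixes `s`, `t` mean applying `K a b`, `K b c`. The elements `h1, h2, h3` and
`k1, k2, k3` are the successive stages of the two sides, and `r` is the common value of `stsf` and
`tstf`. -/
theorem braid_aux {R : Type*} [CommRing R]
    {x y z u w f sf tf stf tsf r h1 sh1 th1 sth1 h2 sh2 h3 k1 tk1 sk1 tsk1 k2 tk2 k3 : R}
    (e1 : (x - y) * h1 = (w * x - u * y) * sf + (u - w) * x * f)
    (e2 : (y - x) * sh1 = (w * y - u * x) * f + (u - w) * y * sf)
    (e3 : (x - z) * th1 = (w * x - u * z) * tsf + (u - w) * x * tf)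
    (e4 : (y - z) * sth1 = (w * y - u * z) * r + (u - w) * y * stf)
    (e5 : (y - z) * h2 = (w * y - u * z) * th1 + (u - w) * y * h1)
    (e6 : (x - z) * sh2 = (w * x - u * z) * sth1 + (u - w) * x * sh1)
    (e7 : (x - y) * h3 = (w * x - u * y) * sh2 + (u - w) * x * h2)
    (d1 : (y - z) * k1 = (w * y - u * z) * tf + (u - w) * y * f)
    (d2 : (z - y) * tk1 = (w * z - u * y) * f + (u - w) * z * tf)
    (d3 : (x - z) * sk1 = (w * x - u * z) * stf + (u - w) * x * sf)
    (d4 : (x - y) * tsk1 = (w * x - u * y) * r + (u - w) * x * tsf)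
    (d5 : (x - y) * k2 = (w * x - u * y) * sk1 + (u - w) * x * k1)
    (d6 : (x - z) * tk2 = (w * x - u * z) * tsk1 + (u - w) * x * tk1)
    (d7 : (y - z) * k3 = (w * y - u * z) * tk2 + (u - w) * y * k2) :
    (x - y) ^ 2 * (y - z) ^ 2 * (x - z) * h3 = (x - y) ^ 2 * (y - z) ^ 2 * (x - z) * k3 := by
  linear_combination (y - z) * ((x - y) * (y - z) * (x - z) * e7
      + (x - y) * (y - z) * (w * x - u * y) * e6 + (x - y) * (x - z) * (u - w) * x * e5
      + (x - y) * (w * x - u * y) * (w * x - u * z) * e4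
      - (y - z) * (w * x - u * y) * (u - w) * x * e2
      + (x - y) * (u - w) * x * (w * y - u * z) * e3
      + (x - z) * (u - w) * x * (u - w) * y * e1)
    - (x - y) * ((x - y) * (y - z) * (x - z) * d7
      + (x - y) * (y - z) * (w * y - u * z) * d6 + (y - z) * (x - z) * (u - w) * y * d5
      + (y - z) * (w * y - u * z) * (w * x - u * z) * d4
      - (x - y) * (w * y - u * z) * (u - w) * x * d2
      + (y - z) * (u - w) * y * (w * x - u * y) * d3
      + (x - z) * (u - w) * y * (u - w) * x * d1)

/-- The braid relation. -/
theorem g_braid {N : ℕ} (q : ℂ) {a b c : Fin N} (hab : a ≠ b) (hac : a ≠ c) (hbc : b ≠ c) :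
    g q a b * g q b c * g q a b = g q b c * g q a b * g q b c := by
  apply LinearMap.ext
  intro f
  simp only [Module.End.mul_apply]
  have e1 : Equiv.swap a b c = c := Equiv.swap_apply_of_ne_of_ne hac.symm hbc.symm
  have e2 : Equiv.swap b c a = a := Equiv.swap_apply_of_ne_of_ne hab hac
  -- Lets both longest words in the exchanges be represented by the single element `r` of
  -- `braid_aux`.
  have hsts : K a b (K b c (K a b f)) = K b c (K a b (K b c f)) := by
    have h1 := LinearMap.congr_fun (K_mul_K a b b c) (K a b f)
    have h2 := LinearMap.congr_fun (K_mul_K b c a b) (K b c f)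
    simp only [Module.End.mul_apply, Equiv.swap_apply_right, Equiv.swap_apply_left, e1, e2,
      K_K] at h1 h2
    rw [h1, h2]
  have E1 := fun h => var_sub_mul_g' q hab h
  have E2 := fun h => var_sub_mul_g' q hbc h
  have S1 := fun h => congrArg (K a b) (E1 h)
  have S2 := fun h => congrArg (K a b) (E2 h)
  have T1 := fun h => congrArg (K b c) (E1 h)
  have T2 := fun h => congrArg (K b c) (E2 h)
  have ST1 := fun h => congrArg (K a b) (T1 h)
  have TS2 := fun h => congrArg (K b c) (S2 h)
  simp only [map_add, map_sub, K_mul, K_var, K_algebraMap, Equiv.swap_apply_right,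
    Equiv.swap_apply_left, e1, e2, K_K] at S1 S2 T1 T2 ST1 TS2
  have ST1f := ST1 f
  rw [hsts] at ST1f
  have hne : (var a - var b : Laurent N) ^ 2 * (var b - var c) ^ 2 * (var a - var c) ≠ 0 :=
    mul_ne_zero (mul_ne_zero (pow_ne_zero _ (var_sub_ne_zero hab))
      (pow_ne_zero _ (var_sub_ne_zero hbc))) (var_sub_ne_zero hac)
  apply mul_left_cancel₀ hne
  exact braid_aux (E1 f) (S1 f) (T1 f) ST1f (E2 _) (S2 _) (E1 _) (E2 f) (T2 f) (S2 f) (TS2 f)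
    (E1 _) (T1 _) (E2 _)

/-! ### Relations between the operators `Y` and `g` -/

theorem semiconjBy_list_prod {M ι : Type*} [Monoid M] {a : M} {f h : ι → M} :
    ∀ {L : List ι}, (∀ x ∈ L, SemiconjBy a (f x) (h x)) →
      SemiconjBy a (L.map f).prod (L.map h).prod
  | [], _ => by simp
  | x :: L, H => by
    rw [List.map_cons, List.prod_cons, List.map_cons, List.prod_cons]
    exact (H x (by simp)).mul_right (semiconjBy_list_prod fun y hy => H y (by simp [hy]))

/-- The railway argument: `x` is carried through the pairs `a k`, `b k` one at a time, each passage
being a Yang-Baxter move, while factors with different indices commute. -/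
theorem list_prod_exchange {M ι : Type*} [Monoid M] {x : M} {a b : ι → M} :
    ∀ {L : List ι}, L.Nodup → (∀ k ∈ L, x * a k * b k = b k * a k * x) →
      (∀ k ∈ L, ∀ k' ∈ L, k ≠ k' → Commute (a k) (b k')) →
      x * (L.map a).prod * (L.map b).prod = (L.map b).prod * (L.map a).prod * x
  | [], _, _, _ => by simp
  | k :: L, hn, h1, h2 => by
    have ih := list_prod_exchange (x := x) (a := a) (b := b) (List.nodup_cons.mp hn).2
      (fun k' hk' => h1 k' (by simp [hk'])) (fun k' hk' k'' hk'' => h2 k' (by simp [hk']) k''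
        (by simp [hk'']))
    have hne : ∀ y ∈ L, k ≠ y := fun y hy e => (List.nodup_cons.mp hn).1 (e ▸ hy)
    have c1 : Commute (b k) (L.map a).prod :=
      semiconjBy_list_prod fun y hy => (h2 y (by simp [hy]) k (by simp) (hne y hy).symm).symm
    have c2 : Commute (a k) (L.map b).prod :=
      semiconjBy_list_prod fun y hy => h2 k (by simp) y (by simp [hy]) (hne y hy)
    simp only [List.map_cons, List.prod_cons]
    calc x * (a k * (L.map a).prod) * (b k * (L.map b).prod)
        = x * a k * ((L.map a).prod * b k) * (L.map b).prod := by simp only [mul_assoc]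
      _ = (x * a k * b k) * (L.map a).prod * (L.map b).prod := by
        rw [← c1.eq]; simp only [mul_assoc]
      _ = b k * a k * (x * (L.map a).prod * (L.map b).prod) := by
        rw [h1 k (by simp)]; simp only [mul_assoc]
      _ = b k * (a k * (L.map b).prod) * (L.map a).prod * x := by
        rw [ih]; simp only [mul_assoc]
      _ = _ := by
        rw [c2.eq]; simp only [mul_assoc]

/-- `ξ_{i,j}` as an invertible operator. -/
def xiUnit {N : ℕ} {q : ℂ} (hq : q ≠ 0) {i j : Fin N} (hij : i ≠ j) :
    (Module.End ℂ (Laurent N))ˣ :=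
  ⟨xi q i j, xiInv q i j, (xi_mul_xiInv hq hij).1, (xi_mul_xiInv hq hij).2⟩

/-! ### Braid and Yang-Baxter relations for the operators `xi`. -/

/-- Collecting the exchanges on the left, the braid relation turns `g q j k` into `g q i j`, and
conjugation by the two exchanges turns it back. This passes `g q j k` through two adjacent factors
of `Y p q i`. -/
theorem g_comm_xi_mul_xi_left {N : ℕ} (q : ℂ) {i j k : Fin N} (hij : i ≠ j) (hik : i ≠ k)
    (hjk : j ≠ k) : Commute (g q j k) (xi q i k * xi q i j) := by
  have e : xi q i k * xi q i j = K i k * K i j * (g q j k * g q i j) := by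
    have := K_semiconj_g q i j hjk (Equiv.swap_apply_right i j)
      (Equiv.swap_apply_of_ne_of_ne hik.symm hjk.symm)
    rw [xi, xi, mul_assoc, ← mul_assoc (g q i k), ← this.eq]
    simp only [mul_assoc]
  have h1 : SemiconjBy (g q j k * g q i j) (g q j k) (g q i j) := by
    rw [SemiconjBy, ← g_braid q hij hik hjk, mul_assoc]
  have h2 : SemiconjBy (K i j) (g q i j) (g q j i) :=
    K_semiconj_g q i j hij (Equiv.swap_apply_left i j) (Equiv.swap_apply_right i j)
  have h3 : SemiconjBy (K i k) (g q j i) (g q j k) :=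
    K_semiconj_g q i k hij.symm (Equiv.swap_apply_of_ne_of_ne hij.symm hjk)
      (Equiv.swap_apply_left i k)
  rw [e]
  exact Commute.symm ((h3.mul_left h2).mul_left h1)

theorem g_comm_xi_mul_xi_right {N : ℕ} (q : ℂ) {i j k : Fin N} (hij : i ≠ j) (hik : i ≠ k)
    (hjk : j ≠ k) : Commute (g q j k) (xi q j i * xi q k i) := by
  have e : xi q j i * xi q k i = K j i * K k i * (g q j k * g q k i) := by
    have := K_semiconj_g q k i hjk (Equiv.swap_apply_of_ne_of_ne hjk hij.symm)
      (Equiv.swap_apply_left k i)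
    rw [xi, xi, mul_assoc, ← mul_assoc (g q j i), ← this.eq]
    simp only [mul_assoc]
  have h1 : SemiconjBy (g q j k * g q k i) (g q j k) (g q k i) := by
    rw [SemiconjBy, g_braid q hjk hij.symm hik.symm, mul_assoc]
  have h2 : SemiconjBy (K k i) (g q k i) (g q i k) :=
    K_semiconj_g q k i hik.symm (Equiv.swap_apply_left k i) (Equiv.swap_apply_right k i)
  have h3 : SemiconjBy (K j i) (g q i k) (g q j k) :=
    K_semiconj_g q j i hik (Equiv.swap_apply_right j i)
      (Equiv.swap_apply_of_ne_of_ne hjk.symm hik.symm)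
  rw [e]
  exact Commute.symm ((h3.mul_left h2).mul_left h1)

/-- The Yang-Baxter equation. -/
theorem xi_yang_baxter {N : ℕ} (q : ℂ) {a b k : Fin N} (hab : a ≠ b) (hak : a ≠ k)
    (hbk : b ≠ k) : xi q b k * xi q a k * xi q a b = xi q a b * xi q a k * xi q b k := by
  have h1 : K a b * g q b k = g q a k * K a b :=
    K_semiconj_g q a b hbk (Equiv.swap_apply_right a b)
      (Equiv.swap_apply_of_ne_of_ne hak.symm hbk.symm)
  have h2 : K a k * g q b a = g q b k * K a k :=
    K_semiconj_g q a k hab.symm (Equiv.swap_apply_of_ne_of_ne hab.symm hbk)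
      (Equiv.swap_apply_left a k)
  have h3 : K a b * g q a b = g q b a * K a b :=
    K_semiconj_g q a b hab (Equiv.swap_apply_left a b) (Equiv.swap_apply_right a b)
  have h4 : K b k * g q a b = g q a k * K b k :=
    K_semiconj_g q b k hab (Equiv.swap_apply_of_ne_of_ne hab hak) (Equiv.swap_apply_left b k)
  have h5 : K a k * g q k b = g q a b * K a k :=
    K_semiconj_g q a k hbk.symm (Equiv.swap_apply_right a k)
      (Equiv.swap_apply_of_ne_of_ne hab.symm hbk)
  have h6 : K b k * g q b k = g q k b * K b k :=
    K_semiconj_g q b k hbk (Equiv.swap_apply_left b k) (Equiv.swap_apply_right b k)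
  have hK : K b k * K a k * K a b = K a b * K a k * K b k := by
    have k1 := K_mul_K b k a k
    have k2 := K_mul_K b k a b
    rw [Equiv.swap_apply_right, Equiv.swap_apply_of_ne_of_ne hab hak] at k1
    rw [Equiv.swap_apply_left, Equiv.swap_apply_of_ne_of_ne hab hak] at k2
    rw [k1, mul_assoc, k2, ← mul_assoc]
  calc xi q b k * xi q a k * xi q a b
      = K b k * (g q b k * K a k) * (g q a k * K a b) * g q a b := by
        simp only [xi, mul_assoc]
    _ = K b k * K a k * (g q b a * K a b) * g q b k * g q a b := by
        rw [← h1, ← h2]; simp only [mul_assoc]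
    _ = (K b k * K a k * K a b) * (g q a b * g q b k * g q a b) := by
        rw [← h3]; simp only [mul_assoc]
    _ = (K a b * K a k * K b k) * (g q b k * g q a b * g q b k) := by
        rw [hK, g_braid q hab hak hbk]
    _ = K a b * K a k * (K b k * g q b k) * g q a b * g q b k := by simp only [mul_assoc]
    _ = K a b * (K a k * g q k b) * (K b k * g q a b) * g q b k := by
        rw [h6]; simp only [mul_assoc]
    _ = _ := by
        rw [h5, h4]; simp only [xi, mul_assoc]

theorem xiInv_yang_baxter {N : ℕ} {q : ℂ} (hq : q ≠ 0) {a b k : Fin N} (hab : a ≠ b) (hak : a ≠ k)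
    (hbk : b ≠ k) :
    xiInv q a b * xiInv q a k * xiInv q b k = xiInv q b k * xiInv q a k * xiInv q a b := by
  have h : xiUnit hq hbk * xiUnit hq hak * xiUnit hq hab
      = xiUnit hq hab * xiUnit hq hak * xiUnit hq hbk :=
    Units.ext (xi_yang_baxter q hab hak hbk)
  have h' := congrArg (fun u => u⁻¹) h
  simp only [mul_inv_rev, ← mul_assoc] at h'
  exact congrArg Units.val h'

theorem K_comm_xi {N : ℕ} (q : ℂ) {i j a b : Fin N} (hab : a ≠ b) (hia : i ≠ a) (hib : i ≠ b)
    (hja : j ≠ a) (hjb : j ≠ b) : Commute (K i j) (xi q a b) :=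
  K_semiconj_xi q i j hab (Equiv.swap_apply_of_ne_of_ne hia.symm hja.symm)
    (Equiv.swap_apply_of_ne_of_ne hib.symm hjb.symm)

theorem g_comm_K {N : ℕ} (q : ℂ) {i j a b : Fin N} (hij : i ≠ j) (hia : i ≠ a)
    (hib : i ≠ b) (hja : j ≠ a) (hjb : j ≠ b) : Commute (g q i j) (K a b) :=
  Commute.symm (K_semiconj_g q a b hij (Equiv.swap_apply_of_ne_of_ne hia hib)
    (Equiv.swap_apply_of_ne_of_ne hja hjb))

theorem g_comm_xi {N : ℕ} (q : ℂ) {i j a b : Fin N} (hij : i ≠ j) (hab : a ≠ b) (hia : i ≠ a)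
    (hib : i ≠ b) (hja : j ≠ a) (hjb : j ≠ b) : Commute (g q i j) (xi q a b) :=
  (g_comm_K q hij hia hib hja hjb).mul_right (g_comm_g q hij hab hia hib hja hjb)

theorem g_comm_xiInv {N : ℕ} {q : ℂ} (hq : q ≠ 0) {i j a b : Fin N} (hij : i ≠ j) (hab : a ≠ b)
    (hia : i ≠ a) (hib : i ≠ b) (hja : j ≠ a) (hjb : j ≠ b) :
    Commute (g q i j) (xiInv q a b) :=
  Commute.units_inv_right (u := xiUnit hq hab) (g_comm_xi q hij hab hia hib hja hjb)

theorem xiInv_comm_xiInv {N : ℕ} {q : ℂ} (hq : q ≠ 0) {i j a b : Fin N} (hij : i ≠ j)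
    (hab : a ≠ b) (hia : i ≠ a) (hib : i ≠ b) (hja : j ≠ a) (hjb : j ≠ b) :
    Commute (xiInv q i j) (xiInv q a b) := by
  have h : Commute (xi q i j) (xi q a b) :=
    (K_comm_xi q hab hia hib hja hjb).mul_left (g_comm_xi q hij hab hia hib hja hjb)
  exact Commute.units_inv_right (u := xiUnit hq hab)
    (Commute.units_inv_left (u := xiUnit hq hij) h)

theorem g_comm_xiInv_mul_xiInv {N : ℕ} {q : ℂ} (hq : q ≠ 0) {i j k : Fin N} (hij : i ≠ j)
    (hik : i ≠ k) (hjk : j ≠ k) : Commute (g q j k) (xiInv q i j * xiInv q i k) := by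
  have := Commute.units_inv_right (u := xiUnit hq hik * xiUnit hq hij)
    (g_comm_xi_mul_xi_left q hij hik hjk)
  rwa [mul_inv_rev] at this

theorem pD_comm_xi {N : ℕ} {p : ℂ} (hp : p ≠ 0) (q : ℂ) {a b k : Fin N} (hab : a ≠ b)
    (ha : a ≠ k) (hb : b ≠ k) : Commute (pD p k) (xi q a b) :=
  (pD_comm_K p ha hb).mul_right (pD_comm_g hp q hab ha hb)

theorem pD_comm_xiInv {N : ℕ} {p q : ℂ} (hp : p ≠ 0) (hq : q ≠ 0) {a b k : Fin N} (hab : a ≠ b)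
    (ha : a ≠ k) (hb : b ≠ k) : Commute (pD p k) (xiInv q a b) :=
  Commute.units_inv_right (u := xiUnit hq hab) (pD_comm_xi hp q hab ha hb)

/-! ### Splitting the ordered products in `Y`, and the affine Hecke relations. -/

theorem filter_finRange_eq {N : ℕ} (P : Fin N → Prop) [DecidablePred P] {L : List (Fin N)}
    (hL : L.Pairwise (· < ·)) (h : ∀ x, x ∈ L ↔ P x) : (List.finRange N).filter P = L := by
  refine List.Pairwise.eq_of_mem_iff (r := (· < ·))
    (List.Pairwise.filter _ (List.pairwise_lt_finRange N)) hL fun x => ?_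
  simp [h]

theorem filter_lt_pairwise {N : ℕ} (P : Fin N → Prop) [DecidablePred P] :
    ((List.finRange N).filter P).Pairwise (· < ·) :=
  List.Pairwise.filter _ (List.pairwise_lt_finRange N)

theorem filter_gt_eq_cons {N : ℕ} {i j : Fin N} (hij : (i : ℕ) + 1 = j) :
    (List.finRange N).filter (i < ·) = j :: (List.finRange N).filter (j < ·) := by
  apply filter_finRange_eq
  · rw [List.pairwise_cons]
    exact ⟨fun x hx => by simpa using hx, filter_lt_pairwise _⟩
  · intro x
    simp only [List.mem_cons, List.mem_filter, List.mem_finRange, true_and, decide_eq_true_eq,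
      Fin.ext_iff, ← Fin.val_fin_lt]
    omega

theorem filter_lt_eq_append {N : ℕ} {i j : Fin N} (hij : (i : ℕ) + 1 = j) :
    (List.finRange N).filter (· < j) = (List.finRange N).filter (· < i) ++ [i] := by
  apply filter_finRange_eq
  · rw [List.pairwise_append]
    exact ⟨filter_lt_pairwise _, by simp, fun x hx y hy => by
      rw [List.mem_singleton.mp hy]; simpa using hx⟩
  · intro x
    simp only [List.mem_cons, List.mem_append, List.not_mem_nil, or_false, List.mem_filter,
      List.mem_finRange, true_and, decide_eq_true_eq, Fin.ext_iff, ← Fin.val_fin_lt]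
    omega

theorem filter_adj_split {N : ℕ} (P : Fin N → Prop) [DecidablePred P] {j k : Fin N}
    (hjk : (j : ℕ) + 1 = k) (hj : P j) (hk : P k) :
    (List.finRange N).filter P = (List.finRange N).filter (fun x => x < j ∧ P x)
      ++ j :: k :: (List.finRange N).filter (fun x => k < x ∧ P x) := by
  apply filter_finRange_eq
  · rw [List.pairwise_append, List.pairwise_cons, List.pairwise_cons]
    have := lt_of_adj hjk
    refine ⟨filter_lt_pairwise _, ⟨?_, ?_, filter_lt_pairwise _⟩, ?_⟩
    · intro x hx
      simp only [List.mem_cons, List.mem_filter, List.mem_finRange, true_and,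
        decide_eq_true_eq] at hx
      rcases hx with rfl | hx
      · exact this
      · exact this.trans hx.1
    · intro x hx
      simp only [List.mem_filter, List.mem_finRange, true_and, decide_eq_true_eq] at hx
      exact hx.1
    · intro x hx y hy
      simp only [List.mem_cons, List.mem_filter, List.mem_finRange, true_and,
        decide_eq_true_eq] at hx hy
      rcases hy with rfl | rfl | hy
      · exact hx.1
      · exact hx.1.trans this
      · exact hx.1.trans (this.trans hy.1)
  · intro x
    simp only [List.mem_append, List.mem_cons, List.mem_filter, List.mem_finRange, true_and,
      decide_eq_true_eq]
    constructor
    · rintro (h | rfl | rfl | h)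
      · exact h.2
      · exact hj
      · exact hk
      · exact h.2
    · intro h
      rcases lt_trichotomy x j with h1 | h1 | h1
      · exact Or.inl ⟨h1, h⟩
      · exact Or.inr (Or.inl h1)
      · rcases lt_trichotomy x k with h2 | h2 | h2
        · rw [Fin.lt_def] at h1 h2
          omega
        · exact Or.inr (Or.inr (Or.inl h2))
        · exact Or.inr (Or.inr (Or.inr ⟨h2, h⟩))

/-- `Y_{i+1} = g_{i,i+1} Y_i g_{i,i+1}`. -/
theorem Y_succ {N : ℕ} (p : ℂ) {q : ℂ} (hq : q ≠ 0) {i j : Fin N} (hij : (i : ℕ) + 1 = j) :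
    Y p q j = g q i j * Y p q i * g q i j := by
  have hne := ne_of_adj hij
  have hlt := lt_of_adj hij
  have h1 : SemiconjBy (K i j)
      (((List.finRange N).filter (j < ·)).map (fun k => xiInv q i k)).prod
      (((List.finRange N).filter (j < ·)).map (fun k => xiInv q j k)).prod := by
    apply semiconjBy_list_prod
    intro k hk
    have hk' : j < k := by simpa using hk
    exact K_semiconj_xiInv q i j (hlt.trans hk').ne (Equiv.swap_apply_left i j)
      (Equiv.swap_apply_of_ne_of_ne (hlt.trans hk').ne' hk'.ne')
  have h2 : SemiconjBy (K i j)
      (((List.finRange N).filter (· < i)).map (fun k => xi q k i)).prod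
      (((List.finRange N).filter (· < i)).map (fun k => xi q k j)).prod := by
    apply semiconjBy_list_prod
    intro k hk
    have hk' : k < i := by simpa using hk
    exact K_semiconj_xi q i j hk'.ne (Equiv.swap_apply_of_ne_of_ne hk'.ne (hk'.trans hlt).ne)
      (Equiv.swap_apply_left i j)
  have h3 := K_semiconj_pD p i j i
  rw [Equiv.swap_apply_left] at h3
  -- Apart from the factor for the pair `(i, j)`, which stands first in `Y p q i` as `xiInv` and
  -- last in `Y p q j` as `xi`, the two operators are conjugate under `K i j`. The two `g` account
  -- for that factor.
  have h4 := (h1.mul_right h3).mul_right h2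
  rw [Y, Y, filter_gt_eq_cons hij, filter_lt_eq_append hij]
  simp only [List.map_cons, List.prod_cons, List.map_append, List.prod_append, List.map_nil,
    List.prod_nil, mul_one]
  rw [xi, ← mul_assoc, ← mul_assoc, ← h4.eq, xiInv]
  simp only [← mul_assoc]
  rw [g_mul_gInv hq hne, one_mul]

/-- `g_{j,j+1}` commutes with `Y_i` for `i ≠ j, j + 1`. -/
theorem g_comm_Y {N : ℕ} {p q : ℂ} (hp : p ≠ 0) (hq : q ≠ 0) {i j k : Fin N}
    (hjk : (j : ℕ) + 1 = k) (hij : i ≠ j) (hik : i ≠ k) : Commute (g q j k) (Y p q i) := by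
  have hne := ne_of_adj hjk
  have hlt := lt_of_adj hjk
  have hcI : ∀ x, x ≠ i → x ≠ j → x ≠ k → Commute (g q j k) (xiInv q i x) :=
    fun x h1 h2 h3 => g_comm_xiInv hq hne h1.symm hij.symm h2.symm hik.symm h3.symm
  have hc : ∀ x, x ≠ i → x ≠ j → x ≠ k → Commute (g q j k) (xi q x i) :=
    fun x h1 h2 h3 => g_comm_xi q hne h1 h2.symm hij.symm h3.symm hik.symm
  refine Commute.mul_right (Commute.mul_right ?_ (pD_comm_g hp q hne hij.symm hik.symm).symm) ?_
  · rcases lt_or_gt_of_ne hij with h | h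
    · rw [filter_adj_split (fun x => i < x) hjk h (h.trans hlt)]
      simp only [List.map_append, List.map_cons, List.prod_append, List.prod_cons]
      -- Only the adjacent pair with indices `j`, `k` fails to commute with `g` factor by factor; it
      -- commutes as a pair.
      rw [← mul_assoc (xiInv q i j)]
      refine Commute.mul_right ?_ ((g_comm_xiInv_mul_xiInv hq hij hik hne).mul_right ?_)
      · apply semiconjBy_list_prod
        intro x hx
        simp only [List.mem_filter, List.mem_finRange, true_and, decide_eq_true_eq] at hx
        exact hcI x hx.2.ne' hx.1.ne (hx.1.trans hlt).ne
      · apply semiconjBy_list_prod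
        intro x hx
        simp only [List.mem_filter, List.mem_finRange, true_and, decide_eq_true_eq] at hx
        exact hcI x hx.2.ne' (hlt.trans hx.1).ne' hx.1.ne'
    · apply semiconjBy_list_prod
      intro x hx
      simp only [List.mem_filter, List.mem_finRange, true_and, decide_eq_true_eq] at hx
      have hki : k < i := by
        apply lt_of_le_of_ne _ hik.symm
        rw [Fin.lt_def] at h
        rw [Fin.le_def]
        omega
      exact hcI x hx.ne' (h.trans hx).ne' (hki.trans hx).ne'
  · rcases lt_or_gt_of_ne hij with h | h
    · apply semiconjBy_list_prod
      intro x hx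
      simp only [List.mem_filter, List.mem_finRange, true_and, decide_eq_true_eq] at hx
      exact hc x hx.ne (hx.trans h).ne (hx.trans (h.trans hlt)).ne
    · have hki : k < i := by
        apply lt_of_le_of_ne _ hik.symm
        rw [Fin.lt_def] at h
        rw [Fin.le_def]
        omega
      rw [filter_adj_split (fun x => x < i) hjk h hki]
      simp only [List.map_append, List.map_cons, List.prod_append, List.prod_cons]
      rw [← mul_assoc (xi q j i)]
      refine Commute.mul_right ?_ ((g_comm_xi_mul_xi_right q hij hik hne).mul_right ?_)
      · apply semiconjBy_list_prod
        intro x hx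
        simp only [List.mem_filter, List.mem_finRange, true_and, decide_eq_true_eq] at hx
        exact hc x hx.2.ne hx.1.ne (hx.1.trans hlt).ne
      · apply semiconjBy_list_prod
        intro x hx
        simp only [List.mem_filter, List.mem_finRange, true_and, decide_eq_true_eq] at hx
        exact hc x hx.2.ne (hlt.trans hx.1).ne' hx.1.ne'

/-! ### Pairwise commutativity of the operators `Y`. -/

/-- The base case, where the left tails are short enough to compute: the Yang-Baxter moves of
`list_prod_exchange` reorder the inverse `xi`, and the simultaneous shift of both variables commutes
with `xi q i j`. All other pairs follow from `Y_succ` and `g_comm_Y`. -/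
theorem Y_zero_comm_Y_one {N : ℕ} {p q : ℂ} (hp : p ≠ 0) (hq : q ≠ 0) {i j : Fin N}
    (hi : (i : ℕ) = 0) (hij : (i : ℕ) + 1 = j) : Commute (Y p q i) (Y p q j) := by
  have hne := ne_of_adj hij
  have hlt := lt_of_adj hij
  have e0 : (List.finRange N).filter (· < i) = [] :=
    filter_finRange_eq _ (by simp) fun x => by simp [Fin.lt_def, hi]
  set L := (List.finRange N).filter (j < ·) with hL
  have hmem : ∀ x ∈ L, j < x := fun x hx => by simpa [hL] using hx
  have eYi : Y p q i = xiInv q i j * (L.map fun k => xiInv q i k).prod * pD p i := by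
    rw [Y, filter_gt_eq_cons hij, e0]
    simp [hL]
  have eYj : Y p q j = (L.map fun k => xiInv q j k).prod * pD p j * xi q i j := by
    rw [Y, filter_lt_eq_append hij, e0]
    simp [hL]
  have hex := list_prod_exchange (x := xiInv q i j) (a := fun k => xiInv q i k)
    (b := fun k => xiInv q j k) (L := L) ((filter_lt_pairwise _).imp Fin.ne_of_lt)
    (fun k hk => xiInv_yang_baxter hq hne (hlt.trans (hmem k hk)).ne (hmem k hk).ne)
    (fun k hk k' hk' hkk => xiInv_comm_xiInv hq (hlt.trans (hmem k hk)).ne (hmem k' hk').ne hne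
      (hlt.trans (hmem k' hk')).ne (hmem k hk).ne' hkk)
  have c1 : Commute (pD p i) (L.map fun k => xiInv q j k).prod :=
    semiconjBy_list_prod fun k hk => pD_comm_xiInv hp hq (hmem k hk).ne hne.symm
      (hlt.trans (hmem k hk)).ne'
  have c2 : Commute (pD p j) (L.map fun k => xiInv q i k).prod :=
    semiconjBy_list_prod fun k hk => pD_comm_xiInv hp hq (hlt.trans (hmem k hk)).ne hne
      (hmem k hk).ne'
  have c3 : Commute (pD p i * pD p j) (xi q i j) :=
    (pD_mul_pD_comm_K p i j).mul_right (pD_mul_pD_comm_g hp q hne)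
  have hu := xi_mul_xiInv hq hne
  rw [eYi, eYj, Commute, SemiconjBy]
  set A := (L.map fun k => xiInv q i k).prod
  set B := (L.map fun k => xiInv q j k).prod
  calc xiInv q i j * A * pD p i * (B * pD p j * xi q i j)
      = xiInv q i j * A * (pD p i * B) * pD p j * xi q i j := by simp only [mul_assoc]
    _ = xiInv q i j * A * B * (pD p i * pD p j * xi q i j) := by
        rw [c1.eq]; simp only [mul_assoc]
    _ = B * A * (xiInv q i j * xi q i j) * pD p i * pD p j := by
        rw [c3.eq, hex]; simp only [mul_assoc]
    _ = B * (A * pD p j) * pD p i := by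
        rw [hu.2, mul_one, mul_assoc, (pD_comm p i j).eq]; simp only [mul_assoc]
    _ = B * pD p j * (xi q i j * xiInv q i j) * A * pD p i := by
        rw [← c2.eq, hu.1, mul_one]; simp only [mul_assoc]
    _ = _ := by simp only [mul_assoc]

theorem Y_comm_succ {N : ℕ} {p q : ℂ} (hp : p ≠ 0) (hq : q ≠ 0) :
    ∀ (k : ℕ) {i j : Fin N}, (i : ℕ) = k → (i : ℕ) + 1 = j → Commute (Y p q i) (Y p q j)
  | 0, _, _, hi, hij => Y_zero_comm_Y_one hp hq hi hij
  | k + 1, i, j, hi, hij => by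
    set h : Fin N := ⟨k, by omega⟩ with hh
    have hhi : (h : ℕ) + 1 = i := by simp [hh, hi]
    have ih := Y_comm_succ hp hq k (i := h) (j := i) rfl hhi
    have hhj : h ≠ j := by
      rw [Ne, Fin.ext_iff]
      omega
    have c1 : Commute (Y p q h) (Y p q j) := by
      rw [Y_succ p hq hij]
      have := (g_comm_Y hp hq (p := p) hij (ne_of_adj hhi) hhj).symm
      exact (this.mul_right ih).mul_right this
    have c2 : Commute (g q h i) (Y p q j) :=
      g_comm_Y hp hq hhi hhj.symm (ne_of_adj hij).symm
    rw [Y_succ p hq hhi]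
    exact (c2.mul_left c1).mul_left c2

theorem Y_comm_of_lt {N : ℕ} {p q : ℂ} (hp : p ≠ 0) (hq : q ≠ 0) :
    ∀ (d : ℕ) {i j : Fin N}, (i : ℕ) + d + 1 = j → Commute (Y p q i) (Y p q j)
  | 0, i, j, h => Y_comm_succ hp hq _ rfl h
  | d + 1, i, j, h => by
    set k : Fin N := ⟨i + d + 1, by omega⟩ with hk
    have hkj : (k : ℕ) + 1 = j := by simp [hk]; omega
    have ih := Y_comm_of_lt hp hq d (i := i) (j := k) rfl
    rw [Y_succ p hq hkj]
    have := (g_comm_Y hp hq (p := p) (i := i) hkj (by rw [Ne, Fin.ext_iff]; simp [hk]; omega)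
      (by rw [Ne, Fin.ext_iff]; omega)).symm
    exact (this.mul_right ih).mul_right this

theorem Y_comm {N : ℕ} {p q : ℂ} (hp : p ≠ 0) (hq : q ≠ 0) (i j : Fin N) :
    Commute (Y p q i) (Y p q j) := by
  rcases lt_trichotomy i j with h | rfl | h
  · rw [Fin.lt_def] at h
    exact Y_comm_of_lt hp hq (j - i - 1 : ℕ) (by omega)
  · exact Commute.refl _
  · rw [Fin.lt_def] at h
    exact (Y_comm_of_lt hp hq (i - j - 1 : ℕ) (by omega)).symm

/-! ### Triangular operators -/

/-- The span of the monomials below `z^l`. -/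
def Low {N : ℕ} (l : Fin N → ℤ) : Submodule ℂ (Laurent N) :=
  AddMonoidAlgebra.supported ℂ ℂ {m | Succ l m}

/-- The span of the monomials `z^m` with `m⁺` below `l⁺`. -/
def LowPlus {N : ℕ} (l : Fin N → ℤ) : Submodule ℂ (Laurent N) :=
  AddMonoidAlgebra.supported ℂ ℂ {m | SuccPlus l m}

theorem mono_mem_supported {N : ℕ} {s : Set (Fin N → ℤ)} {m : Fin N → ℤ} (hm : m ∈ s) :
    (mono m : Laurent N) ∈ AddMonoidAlgebra.supported ℂ ℂ s := by
  rw [AddMonoidAlgebra.supported_eq_span_single]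
  exact Submodule.subset_span ⟨m, hm, rfl⟩

theorem supported_le {N : ℕ} {s : Set (Fin N → ℤ)} {Q : Submodule ℂ (Laurent N)}
    (h : ∀ m ∈ s, mono m ∈ Q) : AddMonoidAlgebra.supported ℂ ℂ s ≤ Q := by
  rw [AddMonoidAlgebra.supported_eq_span_single, Submodule.span_le]
  rintro _ ⟨m, hm, rfl⟩
  exact h m hm

theorem coeff_mono {N : ℕ} (l m : Fin N → ℤ) :
    (mono l : Laurent N).coeff m = if l = m then 1 else 0 := by
  simp [mono, Finsupp.single_apply]

theorem LowPlus_le_Low {N : ℕ} (l : Fin N → ℤ) : LowPlus l ≤ Low l :=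
  AddMonoidAlgebra.supported_mono fun _ h => SuccPlus.succ h

theorem LowPlus_congr {N : ℕ} {l l' : Fin N → ℤ} (h : plus l = plus l') :
    LowPlus l = LowPlus l' := by
  rw [LowPlus, LowPlus]
  simp only [SuccPlus, h]

theorem Low_le_Low {N : ℕ} {l m : Fin N → ℤ} (h : Succ l m) : Low m ≤ Low l :=
  AddMonoidAlgebra.supported_mono fun _ h' => h.trans h'

theorem K_mem_LowPlus {N : ℕ} (i j : Fin N) {l : Fin N → ℤ} {f : Laurent N} (hf : f ∈ LowPlus l) :
    K i j f ∈ LowPlus l := by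
  have : LowPlus l ≤ (LowPlus l).comap (K i j) := supported_le fun m hm => by
    rw [Submodule.mem_comap, K_mono]
    apply mono_mem_supported
    rw [Set.mem_ofPred_eq, SuccPlus, plus_comp_perm]
    exact hm
  exact this hf

/-- The product is a sum of `q⁻¹ e(k+1) - q e(k)` along the segment from `l` to its swap. The two
end points give the displayed terms, and the interior ones are lower by `succPlus_update`. -/
theorem lead_mem_LowPlus {N : ℕ} (q : ℂ) {i j : Fin N} (hij : i ≠ j) (l : Fin N → ℤ)
    (h : l i < l j) :
    (q⁻¹ • var i - q • var j) * (∑ k ∈ Finset.range (l j - l i).toNat,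
        mono (Function.update (Function.update l i (l i + k)) j (l j - 1 - k)))
      - (q⁻¹ • mono (l ∘ Equiv.swap i j) - q • mono l) ∈ LowPlus l := by
  set e : ℕ → Laurent N := fun k =>
    mono (Function.update (Function.update l i (l i + k)) j (l j - k)) with he
  obtain ⟨d, hd⟩ : ∃ d : ℕ, (l j - l i).toNat = d + 1 := ⟨(l j - l i).toNat - 1, by omega⟩
  have key : ∀ k ∈ Finset.range (d + 1), (q⁻¹ • var i - q • var j) *
      mono (Function.update (Function.update l i (l i + k)) j (l j - 1 - k))
      = q⁻¹ • e (k + 1) - q • e k := by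
    intro k _
    rw [sub_mul, smul_mul_assoc, smul_mul_assoc, var, var, mono_mul_mono, mono_mul_mono]
    congr 3
    · funext x
      by_cases hx : x = j
      · subst hx; simp [hij]; ring
      · by_cases hx' : x = i
        · subst hx'; simp [hij]; ring
        · simp [hx, hx']
    · funext x
      by_cases hx : x = j
      · subst hx; simp; ring
      · by_cases hx' : x = i
        · subst hx'; simp [hij]
        · simp [hx, hx']
  have e0 : e 0 = mono l := by simp [he]
  have ed : e (d + 1) = mono (l ∘ Equiv.swap i j) := by
    simp only [he]
    rw [comp_swap_eq hij, show l i + ((d + 1 : ℕ) : ℤ) = l j from by omega,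
      show l j - ((d + 1 : ℕ) : ℤ) = l i from by omega]
  have hmem : ∑ k ∈ Finset.range d, e (k + 1) ∈ LowPlus l := by
    refine Submodule.sum_mem _ fun k hk => mono_mem_supported ?_
    have := Finset.mem_range.mp hk
    exact succPlus_update hij l (k + 1) (by omega) (by omega)
  rw [hd, Finset.mul_sum, Finset.sum_congr rfl key, Finset.sum_sub_distrib, ← Finset.smul_sum,
    ← Finset.smul_sum, Finset.sum_range_succ, Finset.sum_range_succ' e, ed, e0]
  convert (LowPlus l).smul_mem (q⁻¹ - q) hmem using 1
  module

theorem g_mono_of_eq {N : ℕ} (q : ℂ) (i j : Fin N) (l : Fin N → ℤ) (h : l i = l j) :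
    g q i j (mono l) = q • mono l := by
  simp [g, divDiff, ofMono_mono, h]

theorem g_mono_of_lt {N : ℕ} (q : ℂ) {i j : Fin N} (hij : i ≠ j) (l : Fin N → ℤ)
    (h : l i < l j) : g q i j (mono l) - q⁻¹ • mono (l ∘ Equiv.swap i j) ∈ LowPlus l := by
  convert lead_mem_LowPlus q hij l h using 1
  have h0 : (l i - l j).toNat = 0 := by omega
  simp only [g, divDiff, LinearMap.add_apply, Module.End.mul_apply, LinearMap.mulLeft_apply,
    LinearMap.smul_apply, Module.End.one_apply, ofMono_mono, h0, Finset.sum_range_zero, sub_zero]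
  abel

theorem g_mono_of_gt {N : ℕ} (q : ℂ) {i j : Fin N} (hij : i ≠ j) (l : Fin N → ℤ)
    (h : l j < l i) :
    g q i j (mono l) - (q • mono (l ∘ Equiv.swap i j) + (q - q⁻¹) • mono l) ∈ LowPlus l := by
  -- The divided difference changes sign when the two exponents are exchanged, so the ascending
  -- formula is applied to the swapped exponent.
  have h1 := lead_mem_LowPlus q hij (l ∘ Equiv.swap i j) (by simpa using h)
  rw [LowPlus_congr (plus_comp_perm l _), comp_swap_comp_swap] at h1
  have hu : ∀ x y : ℤ, Function.update (Function.update (l ∘ Equiv.swap i j) i x) j y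
      = Function.update (Function.update l i x) j y := by
    intro x y
    funext a
    by_cases ha : a = j
    · subst ha; simp
    · by_cases ha' : a = i
      · subst ha'; simp [hij]
      · simp [ha, ha', Equiv.swap_apply_of_ne_of_ne]
  simp only [hu, Function.comp_apply, Equiv.swap_apply_left, Equiv.swap_apply_right] at h1
  rw [← Submodule.neg_mem_iff]
  convert h1 using 1
  have h0 : (l j - l i).toNat = 0 := by omega
  simp only [g, divDiff, LinearMap.add_apply, Module.End.mul_apply, LinearMap.mulLeft_apply,
    LinearMap.smul_apply, Module.End.one_apply, ofMono_mono, h0, Finset.sum_range_zero, zero_sub,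
    mul_neg]
  module

/-- The operator `A` is triangular with diagonal entries `d`. -/
def IsTri {N : ℕ} (A : Module.End ℂ (Laurent N)) (d : (Fin N → ℤ) → ℂ) : Prop :=
  ∀ l, A (mono l) - d l • mono l ∈ Low l

theorem IsTri.mem_Low {N : ℕ} {A : Module.End ℂ (Laurent N)} {d : (Fin N → ℤ) → ℂ}
    (hA : IsTri A d) {l : Fin N → ℤ} {f : Laurent N} (hf : f ∈ Low l) : A f ∈ Low l := by
  have : Low l ≤ (Low l).comap A := supported_le fun m hm => by
    rw [Submodule.mem_comap, ← sub_add_cancel (A (mono m)) (d m • mono m)]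
    exact (Low l).add_mem (Low_le_Low hm (hA m))
      ((Low l).smul_mem _ (mono_mem_supported hm))
  exact this hf

theorem IsTri.one {N : ℕ} : IsTri (1 : Module.End ℂ (Laurent N)) fun _ => 1 := by
  intro l
  simp

theorem IsTri.mul {N : ℕ} {A B : Module.End ℂ (Laurent N)} {d e : (Fin N → ℤ) → ℂ}
    (hA : IsTri A d) (hB : IsTri B e) : IsTri (A * B) fun l => d l * e l := by
  intro l
  have h1 := hA.mem_Low (hB l)
  have h2 := (Low l).smul_mem (e l) (hA l)
  convert (Low l).add_mem h1 h2 using 1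
  rw [Module.End.mul_apply, map_sub, map_smul]
  module

theorem IsTri.list_prod {N : ℕ} {ι : Type*} {A : ι → Module.End ℂ (Laurent N)}
    {d : ι → (Fin N → ℤ) → ℂ} : ∀ {L : List ι}, (∀ x ∈ L, IsTri (A x) (d x)) →
      IsTri (L.map A).prod fun l => (L.map fun x => d x l).prod
  | [], _ => by simpa using IsTri.one
  | x :: L, h => by
    simp only [List.map_cons, List.prod_cons]
    exact (h x (by simp)).mul (IsTri.list_prod fun y hy => h y (by simp [hy]))

theorem isTri_pD {N : ℕ} (p : ℂ) (i : Fin N) : IsTri (pD p i) fun l => p ^ l i := by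
  intro l
  rw [pD_mono, sub_self]
  exact Submodule.zero_mem _

/-- After composing with `K`, the only new monomial with the same sorted exponent is the swap. It
occurs just when `l j < l i`, and it is then lower because `i < j` and the order compares last
entries. -/
theorem isTri_xi {N : ℕ} (q : ℂ) {i j : Fin N} (hij : i < j) :
    IsTri (xi q i j) fun l => if l i < l j then q⁻¹ else q := by
  intro l
  beta_reduce
  rw [xi, Module.End.mul_apply]
  rcases lt_trichotomy (l i) (l j) with h | h | h
  · have h1 := K_mem_LowPlus i j (g_mono_of_lt q hij.ne l h)
    rw [map_sub, map_smul, K_mono, comp_swap_comp_swap] at h1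
    rw [if_pos h]
    exact LowPlus_le_Low l h1
  · rw [if_neg h.not_lt, g_mono_of_eq q i j l h, map_smul, K_mono, comp_swap_of_eq h, sub_self]
    exact Submodule.zero_mem _
  · have h1 := K_mem_LowPlus i j (g_mono_of_gt q hij.ne l h)
    rw [map_sub, map_add, map_smul, map_smul, K_mono, K_mono, comp_swap_comp_swap] at h1
    rw [if_neg h.not_gt]
    have h2 : mono (l ∘ Equiv.swap i j) ∈ Low l := mono_mem_supported (succ_comp_swap hij l h)
    convert (Low l).add_mem (LowPlus_le_Low l h1) ((Low l).smul_mem (q - q⁻¹) h2) using 1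
    module

theorem isTri_xiInv {N : ℕ} (q : ℂ) {i j : Fin N} (hij : i < j) :
    IsTri (xiInv q i j) fun l => if l i < l j then q else q⁻¹ := by
  intro l
  beta_reduce
  rw [xiInv, Module.End.mul_apply, K_mono, gInv, LinearMap.sub_apply, LinearMap.smul_apply,
    Module.End.one_apply]
  rcases lt_trichotomy (l i) (l j) with h | h | h
  · have h1 := g_mono_of_gt q hij.ne (l ∘ Equiv.swap i j) (by simpa using h)
    rw [LowPlus_congr (plus_comp_perm l _), comp_swap_comp_swap] at h1
    rw [if_pos h]
    convert LowPlus_le_Low l h1 using 1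
    module
  · rw [if_neg h.not_lt, comp_swap_of_eq h, g_mono_of_eq q i j l h]
    convert Submodule.zero_mem _ using 1
    module
  · have h1 := g_mono_of_lt q hij.ne (l ∘ Equiv.swap i j) (by simpa using h)
    rw [LowPlus_congr (plus_comp_perm l _), comp_swap_comp_swap] at h1
    rw [if_neg h.not_gt]
    have h2 : mono (l ∘ Equiv.swap i j) ∈ Low l := mono_mem_supported (succ_comp_swap hij l h)
    convert (Low l).sub_mem (LowPlus_le_Low l h1) ((Low l).smul_mem (q - q⁻¹) h2) using 1
    module

theorem list_prod_filter_finRange {N : ℕ} (P : Fin N → Prop) [DecidablePred P] (v : Fin N → ℂ) :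
    (((List.finRange N).filter P).map v).prod = ∏ k with P k, v k := by
  rw [← List.prod_toFinset _ ((List.nodup_finRange N).filter _)]
  congr 1
  ext k
  simp

theorem zeta_eq_prod {N : ℕ} (p : ℂ) {q : ℂ} (hq : q ≠ 0) (l : Fin N → ℤ) (i : Fin N) :
    (((List.finRange N).filter (i < ·)).map fun k => if l i < l k then q else q⁻¹).prod
        * p ^ l i
        * (((List.finRange N).filter (· < i)).map fun k => if l k < l i then q⁻¹ else q).prod
      = zeta p q l i := by
  -- Each `k ≠ i` contributes `q` or `q⁻¹` according to whether it is sorted before `i`. The index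
  -- `k = i` receives the value `q⁻¹`, to be compensated later, so that the product runs over all
  -- indices.
  set v : Fin N → ℂ := fun k => if l i < l k ∨ (l k = l i ∧ k < i) then q else q⁻¹ with hv
  have h1 : ∏ k with i < k, (if l i < l k then q else q⁻¹) = ∏ k with i < k, v k := by
    refine Finset.prod_congr rfl fun k hk => ?_
    simp only [Finset.mem_filter, Finset.mem_univ, true_and] at hk
    simp [hv, hk.not_gt]
  have h2 : ∏ k with k < i, (if l k < l i then q⁻¹ else q) = ∏ k with k < i, v k := by
    refine Finset.prod_congr rfl fun k hk => ?_
    simp only [Finset.mem_filter, Finset.mem_univ, true_and] at hk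
    simp only [hv, hk, and_true]
    rcases lt_trichotomy (l k) (l i) with h | h | h
    · simp [h, h.not_gt, h.ne]
    · simp [h]
    · simp [h, h.not_gt]
  have hvi : v i = q⁻¹ := by simp [hv]
  have h3 : ∏ k, v k = v i * ((∏ k with i < k, v k) * ∏ k with k < i, v k) := by
    rw [← Finset.mul_prod_erase Finset.univ v (Finset.mem_univ i),
      ← Finset.prod_filter_mul_prod_filter_not (Finset.univ.erase i) (fun k => i < k)]
    congr 2
    · congr 1
      ext k
      simp only [Finset.mem_filter, Finset.mem_erase, Finset.mem_univ, true_and, and_true]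
      exact ⟨fun h => h.2, fun h => ⟨h.ne', h⟩⟩
    · congr 1
      ext k
      simp only [Finset.mem_filter, Finset.mem_erase, Finset.mem_univ, true_and, and_true]
      exact ⟨fun h => lt_of_le_of_ne (not_lt.mp h.2) h.1, fun h => ⟨h.ne, h.not_gt⟩⟩
  have h4 : ∏ k, v k = q ^ ((sigma l i : ℕ) : ℤ) * q ^ (((sigma l i : ℕ) : ℤ) - N) := by
    simp only [hv]
    rw [Finset.prod_ite, Finset.prod_const, Finset.prod_const, ← sigma_eq_card]
    have h5 := Finset.card_filter_add_card_filter_not (s := (Finset.univ : Finset (Fin N)))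
      (fun k => l i < l k ∨ (l k = l i ∧ k < i))
    rw [← sigma_eq_card, Finset.card_univ, Fintype.card_fin] at h5
    rw [show ((sigma l i : ℕ) : ℤ) - N = -((Finset.univ.filter fun k =>
      ¬ (l i < l k ∨ (l k = l i ∧ k < i))).card : ℤ) from by omega]
    rw [zpow_neg, zpow_natCast, zpow_natCast, inv_pow]
  rw [list_prod_filter_finRange, list_prod_filter_finRange, h1, h2, zeta]
  have h6 : (∏ k with i < k, v k) * (∏ k with k < i, v k)
      = q * (q ^ ((sigma l i : ℕ) : ℤ) * q ^ (((sigma l i : ℕ) : ℤ) - N)) := by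
    rw [← h4, h3, hvi, ← mul_assoc, mul_inv_cancel₀ hq, one_mul]
  rw [mul_right_comm, h6, ← zpow_add₀ hq, ← zpow_one_add₀ hq, mul_comm]
  congr 2
  ring

theorem isTri_Y {N : ℕ} (p : ℂ) {q : ℂ} (hq : q ≠ 0) (i : Fin N) :
    IsTri (Y p q i) fun l => zeta p q l i := by
  have h1 : IsTri (((List.finRange N).filter (i < ·)).map fun k => xiInv q i k).prod _ :=
    IsTri.list_prod fun k hk => isTri_xiInv q (by simpa using hk)
  have h2 : IsTri (((List.finRange N).filter (· < i)).map fun k => xi q k i).prod _ :=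
    IsTri.list_prod fun k hk => isTri_xi q (by simpa using hk)
  have h3 := (h1.mul (isTri_pD p i)).mul h2
  intro l
  beta_reduce
  rw [← zeta_eq_prod p hq]
  exact h3 l

/-- A triangular operator only creates lower monomials, so nothing else in `f` can contribute to an
exponent with no support above it. -/
theorem IsTri.coeff_of_maximal {N : ℕ} {A : Module.End ℂ (Laurent N)} {d : (Fin N → ℤ) → ℂ}
    (hA : IsTri A d) {f : Laurent N} {m : Fin N → ℤ}
    (hm : ∀ k, f.coeff k ≠ 0 → ¬ Succ k m) : (A f).coeff m = d m * f.coeff m := by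
  have hmono : ∀ k, ¬ Succ k m → (A (mono k)).coeff m = d k * (mono k : Laurent N).coeff m := by
    intro k hk
    have := AddMonoidAlgebra.mem_supported'.mp (hA k) m hk
    simpa [sub_eq_zero] using this
  have hf : f - f.coeff m • mono m
      ∈ AddMonoidAlgebra.supported ℂ ℂ {k | k ≠ m ∧ ¬ Succ k m} := by
    rw [AddMonoidAlgebra.mem_supported']
    intro k hk
    by_cases hkm : k = m
    · subst hkm
      simp [coeff_mono]
    · have : f.coeff k = 0 := by
        by_contra h0
        exact hk ⟨hkm, hm k h0⟩
      simp [coeff_mono, this, Ne.symm hkm]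
  have hle : AddMonoidAlgebra.supported ℂ ℂ {k | k ≠ m ∧ ¬ Succ k m}
      ≤ (AddMonoidAlgebra.supported ℂ ℂ {k | k ≠ m}).comap A := supported_le fun k hk => by
    rw [Submodule.mem_comap, AddMonoidAlgebra.mem_supported']
    intro k' hk'
    have hk' : k' = m := by simpa using hk'
    rw [hk', hmono k hk.2, coeff_mono, if_neg hk.1, mul_zero]
  have h1 := AddMonoidAlgebra.mem_supported'.mp (hle hf) m (by simp)
  rw [map_sub, map_smul] at h1
  have h2 := hmono m (Succ.irrefl m)
  simp only [AddMonoidAlgebra.coeff_sub, AddMonoidAlgebra.coeff_smul, Finsupp.sub_apply,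
    Finsupp.smul_apply, h2, coeff_mono, if_true, mul_one, smul_eq_mul] at h1
  linear_combination h1

theorem exists_maximal_coeff {N : ℕ} {f : Laurent N} (hf : f ≠ 0) :
    ∃ m, f.coeff m ≠ 0 ∧ ∀ k, f.coeff k ≠ 0 → ¬ Succ k m := by
  have hne : f.coeff.support.Nonempty := by
    rw [Finsupp.support_nonempty_iff]
    simpa using hf
  obtain ⟨m, hm, hmax⟩ := Finset.exists_max_image f.coeff.support rank hne
  refine ⟨m, Finsupp.mem_support_iff.mp hm, fun k hk hs => ?_⟩
  exact absurd (hmax k (Finsupp.mem_support_iff.mpr hk)) (not_le.mpr hs.rank_lt)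

theorem succ_induction {N : ℕ} {P : (Fin N → ℤ) → Prop} (h : ∀ l, (∀ m, Succ l m → P m) → P l)
    (l : Fin N → ℤ) : P l := by
  induction hr : rank l using Nat.strong_induction_on generalizing l with
  | _ r ih =>
    subst hr
    exact h l fun m hm => ih _ hm.rank_lt m rfl

/-- A maximal coefficient of a kernel element would be multiplied by a non-zero diagonal entry.
Surjectivity is back substitution, legitimate since each exponent has finitely many below it. -/
theorem IsTri.bijective {N : ℕ} {A : Module.End ℂ (Laurent N)} {d : (Fin N → ℤ) → ℂ}
    (hA : IsTri A d) (hd : ∀ l, d l ≠ 0) : Function.Bijective A := by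
  constructor
  · rw [← LinearMap.ker_eq_bot, LinearMap.ker_eq_bot']
    intro f hf
    by_contra hne
    obtain ⟨m, hm, hmax⟩ := exists_maximal_coeff hne
    have := hA.coeff_of_maximal hmax
    rw [hf] at this
    exact mul_ne_zero (hd m) hm (by simpa using this.symm)
  · have hrange : ∀ l, mono l ∈ LinearMap.range A := by
      intro l
      induction l using succ_induction with
      | h l ih =>
        have h1 : Low l ≤ LinearMap.range A := supported_le ih
        have h2 := (LinearMap.range A).sub_mem ⟨mono l, rfl⟩ (h1 (hA l))
        rw [sub_sub_cancel] at h2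
        have h3 := (LinearMap.range A).smul_mem (d l)⁻¹ h2
        rwa [smul_smul, inv_mul_cancel₀ (hd l), one_smul] at h3
    rw [← LinearMap.range_eq_top, eq_top_iff]
    have h1 : AddMonoidAlgebra.supported ℂ ℂ Set.univ ≤ LinearMap.range A :=
      supported_le fun m _ => hrange m
    exact fun f _ => h1 (AddMonoidAlgebra.mem_supported'.mpr fun m hm => absurd trivial hm)

/-! ### Existence and uniqueness of the non-symmetric Macdonald polynomials -/

theorem exists_zeta_of_eigen {N : ℕ} {p q : ℂ} (hq : q ≠ 0) {f : Laurent N} (hf : f ≠ 0)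
    {χ : Fin N → ℂ} (h : ∀ i, Y p q i f = χ i • f) :
    ∃ m, f.coeff m ≠ 0 ∧ ∀ i, zeta p q m i = χ i := by
  obtain ⟨m, hm, hmax⟩ := exists_maximal_coeff hf
  refine ⟨m, hm, fun i => ?_⟩
  have := (isTri_Y p hq i).coeff_of_maximal hmax
  rw [h i, AddMonoidAlgebra.coeff_smul_apply, smul_eq_mul] at this
  exact (mul_right_cancel₀ hm this).symm

/-- Simplicity of the spectrum: after subtraction the coefficient at `l` vanishes, yet a maximal
exponent of a non-zero remainder would have the spectrum of `l`, hence be `l`. No triangularity of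
`h` is needed. -/
theorem IsMacdonald.eq_smul_of_eigen {N : ℕ} {p q : ℂ} (hpq : IsGeneric p q) {l : Fin N → ℤ}
    {f : Laurent N} (hf : IsMacdonald p q l f) {h : Laurent N}
    (hh : ∀ i, Y p q i h = zeta p q l i • h) : h = h.coeff l • f := by
  rw [← sub_eq_zero]
  by_contra hne
  obtain ⟨m, hm, hz⟩ := exists_zeta_of_eigen (p := p) hpq.q_ne_zero hne (χ := zeta p q l)
    fun i => by rw [map_sub, map_smul, hh, hf.eigen, smul_sub, smul_comm]
  obtain rfl := hpq.zeta_injective hz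
  simp [hf.coeff_self] at hm

theorem IsMacdonald.unique {N : ℕ} {p q : ℂ} (hpq : IsGeneric p q) {l : Fin N → ℤ}
    {f h : Laurent N} (hf : IsMacdonald p q l f) (hh : IsMacdonald p q l h) : h = f := by
  have := hf.eq_smul_of_eigen hpq hh.eigen
  rwa [hh.coeff_self, one_smul] at this

/-- `B` is a product of normalized factors `Y p q i - zeta p q a i`, one for each `a ∈ s`, with `i`
chosen to separate `a` from `l`. Applied to `z^l` with `s` the set of exponents below `l`, it
projects onto the eigenvector. -/
theorem exists_annihilator {N : ℕ} {p q : ℂ} (hpq : IsGeneric p q) (l : Fin N → ℤ)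
    (s : Finset (Fin N → ℤ)) (hl : l ∉ s) (hs : ∀ m ∈ s, ∀ k, Succ m k → k ∈ s) :
    ∃ B : Module.End ℂ (Laurent N), (∀ i, Commute B (Y p q i)) ∧ IsTri B (fun m => B (mono m)
      |>.coeff m) ∧ (B (mono l)).coeff l = 1 ∧ ∀ m ∈ s, B (mono m) = 0 := by
  induction s using Finset.induction_on_max_value rank with
  | empty =>
    refine ⟨1, fun i => Commute.one_left _, fun m => ?_, ?_, by simp⟩
    · simp [coeff_mono]
    · simp [coeff_mono]
  | insert a s ha hmax ih =>
    have hla : l ≠ a := fun e => hl (by simp [e])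
    obtain ⟨B, hB, hBt, hB1, hBs⟩ := ih (fun h => hl (by simp [h])) (fun m hm k hk => by
      have := hs m (by simp [hm]) k hk
      rcases Finset.mem_insert.mp this with rfl | h
      · exact absurd (hmax m hm) (not_le.mpr hk.rank_lt)
      · exact h)
    obtain ⟨i, hi⟩ : ∃ i, zeta p q l i ≠ zeta p q a i := by
      by_contra hcon
      push Not at hcon
      exact hla (hpq.zeta_injective hcon)
    set c := (zeta p q l i - zeta p q a i)⁻¹ with hc
    set A : Module.End ℂ (Laurent N) := c • (Y p q i - zeta p q a i • 1) with hA
    have hAY : ∀ k, Commute A (Y p q k) := fun k =>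
      Commute.smul_left ((Y_comm hpq.p_ne_zero hpq.q_ne_zero i k).sub_left
        ((Commute.one_left _).smul_left _)) _
    have hAt : IsTri A fun m => c * (zeta p q m i - zeta p q a i) := by
      intro m
      have := (Low m).smul_mem c (isTri_Y p hpq.q_ne_zero i m)
      convert this using 1
      simp only [hA, LinearMap.smul_apply, LinearMap.sub_apply, Module.End.one_apply]
      module
    have hBA : Commute B A := ((hB i).sub_right ((Commute.one_right _).smul_right _)).smul_right _
    have hABt := hBt.mul hAt
    have hcoeff : ∀ m, ((B * A) (mono m)).coeff m
        = (B (mono m)).coeff m * (c * (zeta p q m i - zeta p q a i)) := by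
      intro m
      have h1 := hABt.coeff_of_maximal (f := mono m) (m := m) (fun k hk => by
        rw [coeff_mono] at hk
        have : m = k := by
          by_contra h0
          exact hk (if_neg h0)
        exact this ▸ Succ.irrefl m)
      rw [h1, coeff_mono, if_pos rfl, mul_one]
    refine ⟨B * A, fun k => (hB k).mul_left (hAY k), ?_, ?_, fun m hm => ?_⟩
    · intro m
      beta_reduce
      rw [hcoeff]
      exact hABt m
    · rw [hcoeff, hB1, one_mul, hc, inv_mul_cancel₀ (sub_ne_zero.mpr hi)]
    · rcases Finset.mem_insert.mp hm with rfl | hm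
      · have h1 := hAt m
        beta_reduce at h1
        rw [sub_self, mul_zero, zero_smul, sub_zero] at h1
        -- The new factor pushes the monomial at the inserted exponent into strictly lower terms,
        -- which the previous `B` already kills.
        have h2 : Low m ≤ LinearMap.ker B := supported_le fun k hk => by
          apply hBs
          rcases Finset.mem_insert.mp (hs m hm k hk) with rfl | h
          · exact absurd hk (Succ.irrefl _)
          · exact h
        exact h2 h1
      · rw [hBA.eq, Module.End.mul_apply, hBs m hm, map_zero]

theorem exists_isMacdonald {N : ℕ} {p q : ℂ} (hpq : IsGeneric p q) (l : Fin N → ℤ) :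
    ∃ f : Laurent N, IsMacdonald p q l f := by
  obtain ⟨B, hB, hBt, hB1, hBs⟩ := exists_annihilator hpq l (finite_setOf_succ l).toFinset
    (by simpa using Succ.irrefl l) (fun m hm k hk => by
      simp only [Set.Finite.mem_toFinset, Set.mem_ofPred_eq] at hm ⊢
      exact hm.trans hk)
  have hker : Low l ≤ LinearMap.ker B := supported_le fun m hm => hBs m (by simpa using hm)
  have ht := hBt l
  beta_reduce at ht
  rw [hB1, one_smul] at ht
  refine ⟨B (mono l), fun i => ?_, hB1, fun m hm h0 => ?_⟩
  · have h1 : B (Y p q i (mono l) - zeta p q l i • mono l) = 0 :=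
      hker (isTri_Y p hpq.q_ne_zero i l)
    rw [map_sub, map_smul, sub_eq_zero] at h1
    rw [← h1]
    exact (LinearMap.congr_fun (hB i).eq (mono l)).symm
  · by_contra hs
    have := AddMonoidAlgebra.mem_supported'.mp ht m hs
    simp [coeff_mono, hm.symm] at this
    exact h0 this

/-- The basis of non-symmetric Macdonald polynomials. -/
def macdonaldBasis {N : ℕ} {p q : ℂ} {Φ : (Fin N → ℤ) → Laurent N}
    (hΦ : ∀ l, IsMacdonald p q l (Φ l)) : Module.Basis (Fin N → ℤ) ℂ (Laurent N) :=
  (AddMonoidAlgebra.basis (Fin N → ℤ) ℂ).map <| LinearEquiv.ofBijective (ofMono Φ) <|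
    IsTri.bijective (d := fun _ => 1) (fun l => AddMonoidAlgebra.mem_supported'.mpr fun m hm => by
      rw [ofMono_mono]
      by_cases hml : m = l
      · subst hml
        simp [coeff_mono, (hΦ m).coeff_self]
      · have : (Φ l).coeff m = 0 := by
          by_contra h0
          exact hm ((hΦ l).triangular m hml h0)
        simp [coeff_mono, this, Ne.symm hml]) fun _ => one_ne_zero

theorem macdonaldBasis_apply {N : ℕ} {p q : ℂ} {Φ : (Fin N → ℤ) → Laurent N}
    (hΦ : ∀ l, IsMacdonald p q l (Φ l)) (l : Fin N → ℤ) : macdonaldBasis hΦ l = Φ l := by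
  simp only [macdonaldBasis, Module.Basis.map_apply, AddMonoidAlgebra.basis_apply]
  exact ofMono_mono Φ l

/-! ### The action of `g` on the Macdonald polynomials -/

theorem Y_mul_g_left {N : ℕ} (p : ℂ) {q : ℂ} (hq : q ≠ 0) {i j : Fin N} (hij : (i : ℕ) + 1 = j) :
    Y p q i * g q i j = g q i j * Y p q j - (q - q⁻¹) • Y p q j := by
  have hne := ne_of_adj hij
  have h1 : gInv q i j * Y p q j = Y p q i * g q i j := by
    rw [Y_succ p hq hij, ← mul_assoc, ← mul_assoc, gInv_mul_g hq hne, one_mul]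
  rw [← h1, gInv, sub_mul, smul_mul_assoc, one_mul]

theorem Y_mul_g_right {N : ℕ} (p : ℂ) {q : ℂ} (hq : q ≠ 0) {i j : Fin N} (hij : (i : ℕ) + 1 = j) :
    Y p q j * g q i j = g q i j * Y p q i + (q - q⁻¹) • Y p q j := by
  have hne := ne_of_adj hij
  rw [Y_succ p hq hij, mul_assoc, g_mul_g hq hne, mul_add, mul_smul_comm, mul_one, add_comm]

/-- The intertwiner of the affine Hecke algebra exchanges the eigenvalues of `Y_i` and
`Y_{i+1}`. -/
theorem Y_intertwiner {N : ℕ} {p q : ℂ} (hp : p ≠ 0) (hq : q ≠ 0) {i j : Fin N}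
    (hij : (i : ℕ) + 1 = j) {f : Laurent N} {χ : Fin N → ℂ} (hf : ∀ k, Y p q k f = χ k • f)
    (k : Fin N) :
    Y p q k ((χ j - χ i) • g q i j f - ((q - q⁻¹) * χ j) • f)
      = χ (Equiv.swap i j k) • ((χ j - χ i) • g q i j f - ((q - q⁻¹) * χ j) • f) := by
  by_cases hki : k = i
  · subst hki
    have h := LinearMap.congr_fun (Y_mul_g_left p hq hij) f
    simp only [Module.End.mul_apply, LinearMap.sub_apply, LinearMap.smul_apply, hf,
      map_smul] at h
    rw [map_sub, map_smul, map_smul, h, hf, Equiv.swap_apply_left]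
    module
  by_cases hkj : k = j
  · subst hkj
    have h := LinearMap.congr_fun (Y_mul_g_right p hq hij) f
    simp only [Module.End.mul_apply, LinearMap.add_apply, LinearMap.smul_apply, hf,
      map_smul] at h
    rw [map_sub, map_smul, map_smul, h, hf, Equiv.swap_apply_right]
    module
  · have h := LinearMap.congr_fun (g_comm_Y hp hq (p := p) hij hki hkj).eq f
    simp only [Module.End.mul_apply, hf, map_smul] at h
    rw [map_sub, map_smul, map_smul, ← h, hf, Equiv.swap_apply_of_ne_of_ne hki hkj]
    module

theorem coeff_K {N : ℕ} (i j : Fin N) (f : Laurent N) (m : Fin N → ℤ) :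
    (K i j f).coeff m = f.coeff (m ∘ Equiv.swap i j) := by
  induction f using AddMonoidAlgebra.induction_linear with
  | zero => simp
  | add f g hf hg => simp [hf, hg]
  | single l c =>
    have e : (AddMonoidAlgebra.single l c : Laurent N) = c • mono l := by simp [mono]
    have e2 : l ∘ Equiv.swap i j = m ↔ l = m ∘ Equiv.swap i j := by
      constructor
      · rintro rfl
        exact (comp_swap_comp_swap i j l).symm
      · rintro rfl
        exact comp_swap_comp_swap i j m
    rw [e, map_smul, K_mono, AddMonoidAlgebra.coeff_smul_apply, AddMonoidAlgebra.coeff_smul_apply,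
      coeff_mono, coeff_mono]
    simp only [e2]

theorem g_one {N : ℕ} {i j : Fin N} (hij : i ≠ j) (f : Laurent N) : g 1 i j f = K i j f := by
  simp only [g, inv_one, one_smul, LinearMap.add_apply, Module.End.mul_apply,
    LinearMap.mulLeft_apply, Module.End.one_apply, var_sub_mul_divDiff hij, sub_add_cancel]

theorem IsMacdonald.g_of_eq {N : ℕ} {p q : ℂ} (hpq : IsGeneric p q) {i j : Fin N}
    (hij : (i : ℕ) + 1 = j) {l : Fin N → ℤ} {f : Laurent N} (hf : IsMacdonald p q l f)
    (h : l i = l j) : g q i j f = q • f := by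
  have hne := ne_of_adj hij
  have hz := zeta_of_eq (p := p) hpq.q_ne_zero hij h
  have hY := Y_intertwiner hpq.p_ne_zero hpq.q_ne_zero hij hf.eigen
  -- For `q = 1` the intertwiner is identically zero. Instead `g` is the exchange `K`, which
  -- preserves this joint eigenspace, and the scalar is read off at the swap-invariant monomial
  -- `z^l`.
  by_cases hq1 : q = 1
  · subst hq1
    rw [one_pow, one_mul] at hz
    have hYg : ∀ k, Y p 1 k (g 1 i j f) = zeta p 1 l k • g 1 i j f := by
      intro k
      by_cases hki : k = i
      · subst hki
        have h := LinearMap.congr_fun (Y_mul_g_left p one_ne_zero hij) f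
        simpa [hf.eigen, hz] using h
      by_cases hkj : k = j
      · subst hkj
        have h := LinearMap.congr_fun (Y_mul_g_right p one_ne_zero hij) f
        simpa [hf.eigen, hz] using h
      · have h := LinearMap.congr_fun
          (g_comm_Y hpq.p_ne_zero hpq.q_ne_zero (p := p) hij hki hkj).eq f
        simp only [Module.End.mul_apply, hf.eigen, map_smul] at h
        exact h.symm
    have h1 := hf.eq_smul_of_eigen hpq hYg
    rw [h1]
    congr 1
    rw [g_one hne, coeff_K, comp_swap_of_eq h, hf.coeff_self]
  -- If non-zero, the intertwined vector would realize the swapped spectrum, which belongs to no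
  -- exponent. Substituting `ζ_j = q² ζ_i` in its vanishing gives the eigenvalue `q`.
  · have h0 : (zeta p q l j - zeta p q l i) • g q i j f - ((q - q⁻¹) * zeta p q l j) • f = 0 := by
      by_contra hcon
      obtain ⟨m, -, hm⟩ := exists_zeta_of_eigen (p := p) hpq.q_ne_zero hcon
        (χ := fun k => zeta p q l (Equiv.swap i j k)) hY
      exact hpq.zeta_swap_ne hq1 hne h m hm
    have hq := hpq.q_ne_zero
    have hz0 := zeta_ne_zero hpq l i
    have h2 : (q ^ 2 - 1) * zeta p q l i ≠ 0 :=
      mul_ne_zero (sub_ne_zero.mpr (hpq.q_sq_ne_one hq1)) hz0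
    rw [← sub_eq_zero]
    apply (smul_eq_zero.mp (_ : ((q ^ 2 - 1) * zeta p q l i) • (g q i j f - q • f) = 0)).resolve_left
      h2
    rw [← h0, hz, smul_sub, smul_smul]
    congr 2
    · ring
    · field_simp

theorem g_mono_mem {N : ℕ} (q : ℂ) {i j : Fin N} (hij : i ≠ j) (l : Fin N → ℤ) :
    g q i j (mono l) ∈ AddMonoidAlgebra.supported ℂ ℂ
      {m | m = l ∨ m = l ∘ Equiv.swap i j ∨ SuccPlus l m} := by
  set Q := AddMonoidAlgebra.supported ℂ ℂ {m | m = l ∨ m = l ∘ Equiv.swap i j ∨ SuccPlus l m}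
  have h1 : mono l ∈ Q := mono_mem_supported (Or.inl rfl)
  have h2 : mono (l ∘ Equiv.swap i j) ∈ Q := mono_mem_supported (Or.inr (Or.inl rfl))
  have h3 : LowPlus l ≤ Q := AddMonoidAlgebra.supported_mono fun m hm => Or.inr (Or.inr hm)
  rcases lt_trichotomy (l i) (l j) with h | h | h
  · rw [← sub_add_cancel (g q i j (mono l)) (q⁻¹ • mono (l ∘ Equiv.swap i j))]
    exact Q.add_mem (h3 (g_mono_of_lt q hij l h)) (Q.smul_mem _ h2)
  · rw [g_mono_of_eq q i j l h]
    exact Q.smul_mem _ h1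
  · rw [← sub_add_cancel (g q i j (mono l))
      (q • mono (l ∘ Equiv.swap i j) + (q - q⁻¹) • mono l)]
    exact Q.add_mem (h3 (g_mono_of_gt q hij l h)) (Q.add_mem (Q.smul_mem _ h2) (Q.smul_mem _ h1))

theorem IsMacdonald.sub_mem_Low {N : ℕ} {p q : ℂ} {l : Fin N → ℤ} {f : Laurent N}
    (hf : IsMacdonald p q l f) : f - mono l ∈ Low l := by
  refine AddMonoidAlgebra.mem_supported'.mpr fun m hm => ?_
  by_cases hml : m = l
  · subst hml
    simp [coeff_mono, hf.coeff_self]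
  · have : f.coeff m = 0 := by
      by_contra h0
      exact hm (hf.triangular m hml h0)
    simp [coeff_mono, this, Ne.symm hml]

theorem IsMacdonald.coeff_g {N : ℕ} {p q : ℂ} {i j : Fin N} (hij : i < j) {l : Fin N → ℤ}
    {f : Laurent N} (hf : IsMacdonald p q l f) (h : l i < l j) :
    (g q i j f).coeff (l ∘ Equiv.swap i j) = q⁻¹ := by
  have hs : Succ (l ∘ Equiv.swap i j) l := by
    have := succ_comp_swap hij (l ∘ Equiv.swap i j) (by simpa using h)
    rwa [comp_swap_comp_swap] at this
  -- No lower monomial of `f` yields the swapped exponent under `g`: that exponent lies above `l`,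
  -- is the swap of `l` only, and is not lower in dominance than anything below `l`. Only the term
  -- `z^l` contributes.
  have h1 : Low l ≤ (AddMonoidAlgebra.supported ℂ ℂ {m | m ≠ l ∘ Equiv.swap i j}).comap
      (g q i j) := supported_le fun m hm => by
    have hm : Succ l m := hm
    have hsub : {k | k = m ∨ k = m ∘ Equiv.swap i j ∨ SuccPlus m k}
        ⊆ {k | k ≠ l ∘ Equiv.swap i j} := by
      intro k hk e
      rcases hk with hk | hk | hk
      · rw [← hk, e] at hm
        exact Succ.irrefl l (hm.trans hs)
      · have hml : m = l := by
          rw [← comp_swap_comp_swap i j m, ← hk, e, comp_swap_comp_swap]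
        exact Succ.irrefl l (by rwa [hml] at hm)
      · rw [e, SuccPlus, plus_comp_perm] at hk
        exact Succ.irrefl l (hm.trans (SuccPlus.succ hk))
    rw [Submodule.mem_comap]
    have hmono := AddMonoidAlgebra.supported_mono (R := ℂ) (S := ℂ) hsub
    exact hmono (g_mono_mem q hij.ne m)
  have h1' := Submodule.mem_comap.mp (h1 hf.sub_mem_Low)
  have h2 := AddMonoidAlgebra.mem_supported'.mp h1' (l ∘ Equiv.swap i j) (by simp)
  have h3 := AddMonoidAlgebra.mem_supported'.mp (g_mono_of_lt q hij.ne l h)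
    (l ∘ Equiv.swap i j) (fun hk => by
      have hk : SuccPlus l (l ∘ Equiv.swap i j) := hk
      rw [SuccPlus, plus_comp_perm] at hk
      exact hk.2 rfl)
  rw [map_sub, AddMonoidAlgebra.coeff_sub, Finsupp.sub_apply, sub_eq_zero] at h2
  rw [AddMonoidAlgebra.coeff_sub, Finsupp.sub_apply, sub_eq_zero,
    AddMonoidAlgebra.coeff_smul_apply, coeff_mono, if_pos rfl, smul_eq_mul, mul_one] at h3
  rw [h2, h3]

/-- The coefficient `(q - q⁻¹) ζ_i(l) / (ζ_i(l) - ζ_j(l))`. -/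
def ratio {N : ℕ} (p q : ℂ) (l : Fin N → ℤ) (i j : Fin N) : ℂ :=
  (q - q⁻¹) * zeta p q l i / (zeta p q l i - zeta p q l j)

theorem IsMacdonald.g_of_lt {N : ℕ} {p q : ℂ} (hpq : IsGeneric p q) {i j : Fin N}
    (hij : (i : ℕ) + 1 = j) {l : Fin N → ℤ} {f f' : Laurent N} (hf : IsMacdonald p q l f)
    (hf' : IsMacdonald p q (l ∘ Equiv.swap i j) f') (h : l i < l j) :
    f' = q • (g q i j f - ratio p q l j i • f) := by
  have hlt := lt_of_adj hij
  have hY := Y_intertwiner hpq.p_ne_zero hpq.q_ne_zero hij hf.eigen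
  simp only [← zeta_comp_swap hij l h.ne] at hY
  -- The intertwined vector has the spectrum of the swapped exponent, so it is a multiple of `f'`.
  -- The multiple is its coefficient there, which comes from `g f` alone since `f` does not contain
  -- that higher monomial.
  have h1 := hf'.eq_smul_of_eigen hpq hY
  have hs : Succ (l ∘ Equiv.swap i j) l := by
    have := succ_comp_swap hlt (l ∘ Equiv.swap i j) (by simpa using h)
    rwa [comp_swap_comp_swap] at this
  have h2 : f.coeff (l ∘ Equiv.swap i j) = 0 := by
    by_contra h0
    have hne : l ∘ Equiv.swap i j ≠ l := fun e => Succ.irrefl l (by rwa [e] at hs)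
    exact Succ.irrefl _ (hs.trans (hf.triangular _ hne h0))
  rw [AddMonoidAlgebra.coeff_sub, Finsupp.sub_apply, AddMonoidAlgebra.coeff_smul_apply,
    AddMonoidAlgebra.coeff_smul_apply, hf.coeff_g hlt h, h2, smul_zero, sub_zero, smul_eq_mul] at h1
  have hz := sub_ne_zero.mpr (hpq.zeta_ne_of_lt h)
  have hq := hpq.q_ne_zero
  have h3 := congrArg (fun x => (q * (zeta p q l j - zeta p q l i)⁻¹) • x) h1
  simp only [smul_smul, smul_sub] at h3
  rw [show q * (zeta p q l j - zeta p q l i)⁻¹ * ((zeta p q l j - zeta p q l i) * q⁻¹) = 1 by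
    field_simp, one_smul] at h3
  rw [← h3, smul_sub, smul_smul, ratio]
  congr 2
  · field_simp
  · field_simp

/-! ### The Yang-Baxter equation and modules over the Hecke algebra -/

/-- The defining relations of the Hecke algebra of type `A_{N-1}`. -/
structure IsHecke {N : ℕ} {M : Type*} [AddCommGroup M] [Module ℂ M] (q : ℂ)
    (T : Fin N → Fin N → Module.End ℂ M) : Prop where
  quad : ∀ i j : Fin N, (i : ℕ) + 1 = j → ∀ v, T i j (T i j v) = (q - q⁻¹) • T i j v + v
  braid : ∀ i j k : Fin N, (i : ℕ) + 1 = j → (j : ℕ) + 1 = k → ∀ v,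
    T i j (T j k (T i j v)) = T j k (T i j (T j k v))
  comm : ∀ i j k l : Fin N, (i : ℕ) + 1 = j → (k : ℕ) + 1 = l → j < k → ∀ v,
    T i j (T k l v) = T k l (T i j v)

section Hecke

variable {N : ℕ} {M : Type*} [AddCommGroup M] [Module ℂ M]

/-- The normalized `R`-matrix `q (T - x)`. -/
def rho (q : ℂ) (T : Module.End ℂ M) (x : ℂ) (v : M) : M := q • (T v - x • v)

theorem rho_comm {q : ℂ} {T U : Module.End ℂ M} (h : ∀ v, T (U v) = U (T v)) (x y : ℂ) (v : M) :
    rho q T x (rho q U y v) = rho q U y (rho q T x v) := by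
  simp only [rho, map_smul, map_sub, h]
  module

/-- The Yang-Baxter equation. The condition on `x, y, z` is what makes the difference of the two
sides, a multiple of `T v - U v`, vanish. -/
theorem rho_braid {q c : ℂ} {T U : Module.End ℂ M} (hT : ∀ v, T (T v) = c • T v + v)
    (hU : ∀ v, U (U v) = c • U v + v) (hTU : ∀ v, T (U (T v)) = U (T (U v))) {x y z : ℂ}
    (hxyz : x * z = y * (x + z - c)) (v : M) :
    rho q T x (rho q U y (rho q T z v)) = rho q U z (rho q T y (rho q U x v)) := by
  simp only [rho, map_smul, map_sub, hTU, hT, hU]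
  linear_combination (norm := module) (-q ^ 3 * hxyz) • (T v - U v)

/-- This is the Yang-Baxter equation with one parameter equal to `q`: on the other side the factor
with parameter `q` acts first on `v` and annihilates it, as `U v = q v`. Hence `T - q` annihilates
the vector in question. -/
theorem rho_stable {q c : ℂ} {T U : Module.End ℂ M} (hT : ∀ v, T (T v) = c • T v + v)
    (hTU : ∀ v, T (U (T v)) = U (T (U v))) {x y : ℂ} (hxy : q * x = y * (q - c + x))
    (hqc : q * (q - c) = 1) {v : M} (hv : U v = q • v) :
    T (rho q U y (rho q T x v)) = q • rho q U y (rho q T x v) := by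
  simp only [rho, map_smul, map_sub, hTU, hT, hv]
  linear_combination (norm := module) (-q ^ 2 * hxy) • T v + (q ^ 3 * hxy + q ^ 2 * y * hqc) • v

end Hecke

/-! ### Transport of vectors along sorting paths, and Hecke homomorphisms. -/

section Hecke

variable {N : ℕ} {M : Type*} [AddCommGroup M] [Module ℂ M]

theorem card_invSet_of_gt {α : Type*} [LinearOrder α] {i j : Fin N} (hij : (i : ℕ) + 1 = j)
    {l : Fin N → α} (h : l j < l i) :
    (invSet (l ∘ Equiv.swap i j)).card < (invSet l).card := by
  have := card_invSet_comp_swap hij (l ∘ Equiv.swap i j) (by simpa using h)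
  rw [comp_swap_comp_swap] at this
  omega

open Classical in
/-- The family of vectors `r(l)`, given by `w` on non-decreasing `l`, and by
`r(l) = q (T_i - x) r(s_i l)` at descents `l_i > l_{i+1}`. -/
def orbitVec (p q : ℂ) (T : Fin N → Fin N → Module.End ℂ M) (w : (Fin N → ℤ) → M)
    (l : Fin N → ℤ) : M :=
  if h : ∃ x : Fin N × Fin N, (x.1 : ℕ) + 1 = x.2 ∧ l x.2 < l x.1 then
    rho q (T h.choose.1 h.choose.2) (ratio p q l h.choose.1 h.choose.2)
      (orbitVec p q T w (l ∘ Equiv.swap h.choose.1 h.choose.2))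
  else w l
termination_by (invSet l).card
decreasing_by exact card_invSet_of_gt h.choose_spec.1 h.choose_spec.2

variable {p q : ℂ} {T : Fin N → Fin N → Module.End ℂ M} {w : (Fin N → ℤ) → M}

theorem orbitVec_of_monotone {l : Fin N → ℤ} (hl : Monotone l) : orbitVec p q T w l = w l := by
  rw [orbitVec, dif_neg]
  rintro ⟨x, h1, h2⟩
  exact absurd (hl (lt_of_adj h1).le) (not_le.mpr h2)

theorem exists_descent_eq {l : Fin N → ℤ}
    (h : ∃ x : Fin N × Fin N, (x.1 : ℕ) + 1 = x.2 ∧ l x.2 < l x.1) :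
    ∃ i j : Fin N, (i : ℕ) + 1 = j ∧ l j < l i ∧
      orbitVec p q T w l = rho q (T i j) (ratio p q l i j)
        (orbitVec p q T w (l ∘ Equiv.swap i j)) := by
  refine ⟨h.choose.1, h.choose.2, h.choose_spec.1, h.choose_spec.2, ?_⟩
  rw [orbitVec, dif_pos h]

/-- The recursion for `orbitVec` holds at the descent `(i, j)` of `l`. -/
def DescentAt (p q : ℂ) (T : Fin N → Fin N → Module.End ℂ M) (w : (Fin N → ℤ) → M)
    (l : Fin N → ℤ) : Prop :=
  ∀ i j : Fin N, (i : ℕ) + 1 = j → l j < l i →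
    orbitVec p q T w l = rho q (T i j) (ratio p q l i j) (orbitVec p q T w (l ∘ Equiv.swap i j))

theorem ratio_comp_swap {i j : Fin N} (hij : (i : ℕ) + 1 = j) {l : Fin N → ℤ} (h : l i ≠ l j)
    (a b : Fin N) :
    ratio p q (l ∘ Equiv.swap i j) a b = ratio p q l (Equiv.swap i j a) (Equiv.swap i j b) := by
  rw [ratio, ratio, zeta_comp_swap hij l h, zeta_comp_swap hij l h]

theorem swap_braid {i j k : Fin N} (hij : i ≠ j) (hik : i ≠ k) (hjk : j ≠ k) {α : Type*}
    (l : Fin N → α) :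
    ((l ∘ Equiv.swap i j) ∘ Equiv.swap j k) ∘ Equiv.swap i j
      = ((l ∘ Equiv.swap j k) ∘ Equiv.swap i j) ∘ Equiv.swap j k := by
  have h1 := Equiv.swap_mul_swap_mul_swap (x := k) (y := j) (z := i) hjk.symm hik.symm
  have h2 := Equiv.swap_mul_swap_mul_swap (x := i) (y := j) (z := k) hij hik
  rw [Equiv.swap_comm k j, Equiv.swap_comm j i] at h1
  rw [Equiv.swap_comm k i, ← h1] at h2
  funext x
  exact congrArg l (congrArg (fun σ : Equiv.Perm (Fin N) => σ x) h2).symm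

theorem swap_far {i j a b : Fin N} (hia : i ≠ a) (hib : i ≠ b) (hja : j ≠ a) (hjb : j ≠ b)
    {α : Type*} (l : Fin N → α) :
    (l ∘ Equiv.swap i j) ∘ Equiv.swap a b = (l ∘ Equiv.swap a b) ∘ Equiv.swap i j := by
  have h := Equiv.swap_apply_apply (Equiv.swap i j) a b
  rw [Equiv.swap_apply_of_ne_of_ne hia.symm hja.symm,
    Equiv.swap_apply_of_ne_of_ne hib.symm hjb.symm] at h
  have h2 : Equiv.swap a b * Equiv.swap i j = Equiv.swap i j * Equiv.swap a b := by
    nth_rewrite 1 [h]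
    simp
  funext x
  exact congrArg l (congrArg (fun σ : Equiv.Perm (Fin N) => σ x) h2).symm

theorem ratio_yang_baxter (hpq : IsGeneric p q) {l : Fin N → ℤ} {i j k : Fin N} (hij : l i ≠ l j)
    (hik : l i ≠ l k) (hjk : l j ≠ l k) :
    ratio p q l i j * ratio p q l j k
      = ratio p q l i k * (ratio p q l i j + ratio p q l j k - (q - q⁻¹)) := by
  have h1 := sub_ne_zero.mpr (hpq.zeta_ne hij).symm
  have h2 := sub_ne_zero.mpr (hpq.zeta_ne hik).symm
  have h3 := sub_ne_zero.mpr (hpq.zeta_ne hjk).symm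
  simp only [ratio]
  generalize q - q⁻¹ = c
  field_simp
  ring

/-- Two overlapping descents: by induction both sides unfold to three R-matrices applied to the
vector at the same reversed exponent, and the Yang-Baxter equation compares them. -/
theorem rho_descent_braid (hpq : IsGeneric p q) (hT : IsHecke q T) {l : Fin N → ℤ}
    (ih : ∀ l' : Fin N → ℤ, (invSet l').card < (invSet l).card → DescentAt p q T w l')
    {i j k : Fin N} (hij : (i : ℕ) + 1 = j) (hjk : (j : ℕ) + 1 = k) (h1 : l j < l i)
    (h2 : l k < l j) :
    rho q (T i j) (ratio p q l i j) (orbitVec p q T w (l ∘ Equiv.swap i j))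
      = rho q (T j k) (ratio p q l j k) (orbitVec p q T w (l ∘ Equiv.swap j k)) := by
  have nij := ne_of_adj hij
  have njk := ne_of_adj hjk
  have nik : i ≠ k := ((lt_of_adj hij).trans (lt_of_adj hjk)).ne
  have ek : Equiv.swap i j k = k := Equiv.swap_apply_of_ne_of_ne nik.symm njk.symm
  have ei : Equiv.swap j k i = i := Equiv.swap_apply_of_ne_of_ne nij nik
  have c1 := card_invSet_of_gt hij h1
  have c2 := card_invSet_of_gt hjk h2
  have d1 : (l ∘ Equiv.swap i j) k < (l ∘ Equiv.swap i j) j := by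
    simpa [ek] using h2.trans h1
  have d2 : (l ∘ Equiv.swap j k) j < (l ∘ Equiv.swap j k) i := by
    simpa [ei] using h2.trans h1
  have c1' := card_invSet_of_gt hjk d1
  have c2' := card_invSet_of_gt hij d2
  have d1' : ((l ∘ Equiv.swap i j) ∘ Equiv.swap j k) j
      < ((l ∘ Equiv.swap i j) ∘ Equiv.swap j k) i := by
    simpa [ek, ei] using h2
  have d2' : ((l ∘ Equiv.swap j k) ∘ Equiv.swap i j) k
      < ((l ∘ Equiv.swap j k) ∘ Equiv.swap i j) j := by
    simpa [ek, ei] using h1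
  rw [ih _ c1 j k hjk d1, ih _ (c1'.trans c1) i j hij d1',
    ih _ c2 i j hij d2, ih _ (c2'.trans c2) j k hjk d2', ← swap_braid nij nik njk]
  simp only [ratio_comp_swap hjk d1.ne', ratio_comp_swap hij h1.ne', ratio_comp_swap hij d2.ne',
    ratio_comp_swap hjk h2.ne', Equiv.swap_apply_left, Equiv.swap_apply_right, ek, ei]
  exact rho_braid (hT.quad i j hij) (hT.quad j k hjk) (hT.braid i j k hij hjk)
    (ratio_yang_baxter hpq h1.ne' (h2.trans h1).ne' h2.ne') _

theorem rho_descent_far (hT : IsHecke q T) {l : Fin N → ℤ}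
    (ih : ∀ l' : Fin N → ℤ, (invSet l').card < (invSet l).card → DescentAt p q T w l')
    {i j a b : Fin N} (hij : (i : ℕ) + 1 = j) (hab : (a : ℕ) + 1 = b) (hja : j < a)
    (h1 : l j < l i) (h2 : l b < l a) :
    rho q (T i j) (ratio p q l i j) (orbitVec p q T w (l ∘ Equiv.swap i j))
      = rho q (T a b) (ratio p q l a b) (orbitVec p q T w (l ∘ Equiv.swap a b)) := by
  have hia := (lt_of_adj hij).trans hja
  have hib := hia.trans (lt_of_adj hab)
  have hjb := hja.trans (lt_of_adj hab)
  have ea : Equiv.swap i j a = a := Equiv.swap_apply_of_ne_of_ne hia.ne' hja.ne'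
  have eb : Equiv.swap i j b = b := Equiv.swap_apply_of_ne_of_ne hib.ne' hjb.ne'
  have ei : Equiv.swap a b i = i := Equiv.swap_apply_of_ne_of_ne hia.ne hib.ne
  have ej : Equiv.swap a b j = j := Equiv.swap_apply_of_ne_of_ne hja.ne hjb.ne
  have d1 : (l ∘ Equiv.swap i j) b < (l ∘ Equiv.swap i j) a := by simpa [ea, eb] using h2
  have d2 : (l ∘ Equiv.swap a b) j < (l ∘ Equiv.swap a b) i := by simpa [ei, ej] using h1
  rw [ih _ (card_invSet_of_gt hij h1) a b hab d1, ih _ (card_invSet_of_gt hab h2) i j hij d2,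
    swap_far hia.ne hib.ne hja.ne hjb.ne, ratio_comp_swap hij h1.ne', ratio_comp_swap hab h2.ne',
    ea, eb, ei, ej]
  exact rho_comm (hT.comm i j a b hij hab hja) _ _ _

/-- Independence of the descent chosen in `orbitVec`, by local confluence: two descents coincide,
overlap, or are far apart. -/
theorem descentAt (hpq : IsGeneric p q) (hT : IsHecke q T) (l : Fin N → ℤ) :
    DescentAt p q T w l := by
  induction hn : (invSet l).card using Nat.strong_induction_on generalizing l with
  | _ n ih =>
    subst hn
    replace ih : ∀ l' : Fin N → ℤ, (invSet l').card < (invSet l).card → DescentAt p q T w l' :=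
      fun l' h => ih _ h l' rfl
    intro i j hij h
    obtain ⟨a, b, hab, hba, e⟩ := exists_descent_eq (p := p) (q := q) (T := T) (w := w)
      ⟨(i, j), hij, h⟩
    rw [e]
    rcases lt_trichotomy i a with hia | rfl | hia
    · by_cases hja : j = a
      · subst hja
        exact (rho_descent_braid hpq hT ih hij hab h hba).symm
      · have hja : j < a := by
          rw [Fin.lt_def] at hia ⊢
          rw [Fin.ext_iff] at hja
          omega
        exact (rho_descent_far hT ih hij hab hja h hba).symm
    · obtain rfl : j = b := Fin.ext (by omega)
      rfl
    · by_cases hja : b = i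
      · subst hja
        exact rho_descent_braid hpq hT ih hab hij hba h
      · have hja : b < i := by
          rw [Fin.lt_def] at hia ⊢
          rw [Fin.ext_iff] at hja
          omega
        exact rho_descent_far hT ih hab hij hja hba h

/-- The condition on `w` at equal neighbours propagates along a descent `(a, b)`. If the descent is
disjoint from `(i, j)` the operators commute; if it shares an index, `rho_stable` applies. -/
theorem orbitVec_stable (hpq : IsGeneric p q) (hT : IsHecke q T)
    (hw : ∀ l, Monotone l → ∀ i j : Fin N, (i : ℕ) + 1 = j → l i = l j → T i j (w l) = q • w l)
    (l : Fin N → ℤ) : ∀ i j : Fin N, (i : ℕ) + 1 = j → l i = l j →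
      T i j (orbitVec p q T w l) = q • orbitVec p q T w l := by
  induction hn : (invSet l).card using Nat.strong_induction_on generalizing l with
  | _ n ih =>
    subst hn
    replace ih : ∀ l' : Fin N → ℤ, (invSet l').card < (invSet l).card →
      ∀ i j : Fin N, (i : ℕ) + 1 = j → l' i = l' j →
        T i j (orbitVec p q T w l') = q • orbitVec p q T w l' := fun l' h => ih _ h l' rfl
    intro i j hij h
    by_cases hd : ∃ x : Fin N × Fin N, (x.1 : ℕ) + 1 = x.2 ∧ l x.2 < l x.1
    swap
    · have hmono : Monotone l := monotone_of_adj fun a b hab => by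
        by_contra hcon
        exact hd ⟨(a, b), hab, not_le.mp hcon⟩
      rw [orbitVec_of_monotone hmono]
      exact hw l hmono i j hij h
    obtain ⟨⟨a, b⟩, hab, hba⟩ := hd
    simp only at hab hba
    have hq := hpq.q_ne_zero
    have hqc : q * (q - (q - q⁻¹)) = 1 := by field_simp; ring
    have nij := ne_of_adj hij
    have nab := ne_of_adj hab
    have hz := zeta_of_eq (p := p) hq hij h
    have hia : i ≠ a := by
      rintro rfl
      obtain rfl : j = b := Fin.ext (by omega)
      exact hba.ne' h
    rw [descentAt hpq hT l a b hab hba]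
    have c1 := card_invSet_of_gt hab hba
    -- Here `l i = l j > l b`. Two descents carry the smaller entry in front of the equal pair,
    -- which then occupies `(j, b)`, where the induction hypothesis applies.
    by_cases hja : j = a
    · subst hja
      have nib : i ≠ b := ((lt_of_adj hij).trans (lt_of_adj hab)).ne
      have ei : Equiv.swap j b i = i := Equiv.swap_apply_of_ne_of_ne nij nib
      have eb : Equiv.swap i j b = b := Equiv.swap_apply_of_ne_of_ne nib.symm nab.symm
      have d1 : (l ∘ Equiv.swap j b) j < (l ∘ Equiv.swap j b) i := by simpa [ei, h] using hba
      have hst := ih _ ((card_invSet_of_gt hij d1).trans c1) j b hab (by simp [ei, eb, h])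
      rw [descentAt hpq hT _ i j hij d1]
      refine rho_stable (hT.quad i j hij) (hT.braid i j b hij hab) ?_ hqc hst
      rw [ratio_comp_swap hab hba.ne', ei, Equiv.swap_apply_left]
      have z1 := sub_ne_zero.mpr (hpq.zeta_ne hba.ne)
      have z2 := sub_ne_zero.mpr (hpq.zeta_ne (h ▸ hba.ne : l b ≠ l i))
      simp only [ratio, hz] at z1 z2 ⊢
      field_simp
      ring
    -- The mirror image: the larger entry `l a` is moved behind the equal pair.
    by_cases hbi : b = i
    · subst hbi
      have naj : a ≠ j := ((lt_of_adj hab).trans (lt_of_adj hij)).ne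
      have ej : Equiv.swap a b j = j := Equiv.swap_apply_of_ne_of_ne naj.symm nij.symm
      have ea : Equiv.swap b j a = a := Equiv.swap_apply_of_ne_of_ne nab naj
      have d1 : (l ∘ Equiv.swap a b) j < (l ∘ Equiv.swap a b) b := by simpa [ej, ← h] using hba
      have hst := ih _ ((card_invSet_of_gt hij d1).trans c1) a b hab (by simp [ej, ea, h])
      rw [descentAt hpq hT _ b j hij d1]
      refine rho_stable (hT.quad b j hij) (fun v => (hT.braid a b j hab hij v).symm) ?_ hqc hst
      rw [ratio_comp_swap hab hba.ne', ej, Equiv.swap_apply_right]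
      have z1 := sub_ne_zero.mpr (hpq.zeta_ne hba.ne)
      have z2 := sub_ne_zero.mpr (hpq.zeta_ne (h ▸ hba.ne : l j ≠ l a))
      simp only [ratio, hz] at z1 z2 ⊢
      field_simp
      ring
    · have nib : i ≠ b := Ne.symm hbi
      have njb : j ≠ b := by
        rintro rfl
        exact hia (Fin.ext (by omega))
      have ei : Equiv.swap a b i = i := Equiv.swap_apply_of_ne_of_ne hia nib
      have ej : Equiv.swap a b j = j := Equiv.swap_apply_of_ne_of_ne hja njb
      have hst := ih _ c1 i j hij (by simpa [ei, ej] using h)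
      have hcomm : ∀ v, T i j (T a b v) = T a b (T i j v) := by
        rcases lt_or_gt_of_ne hia with hlt | hlt
        · refine hT.comm i j a b hij hab ?_
          rw [Fin.lt_def] at hlt ⊢
          rw [Fin.ext_iff] at hja
          omega
        · refine fun v => (hT.comm a b i j hab hij ?_ v).symm
          rw [Fin.lt_def] at hlt ⊢
          rw [Ne, Fin.ext_iff] at nib
          omega
      simp only [rho, map_smul, map_sub, hcomm, hst]
      module

/-- Every family `w(m)` of vectors of a Hecke module with `T_i w(m) = q w(m)` for `m_i = m_{i+1}`
extends to a homomorphism of Hecke modules on the Laurent polynomials that sends the Macdonald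
polynomial `Φ^m` to `w(m)` for every non-decreasing `m`. -/
theorem exists_hecke_hom (hpq : IsGeneric p q) (hT : IsHecke q T)
    (hw : ∀ l, Monotone l → ∀ i j : Fin N, (i : ℕ) + 1 = j → l i = l j → T i j (w l) = q • w l)
    {Φ : (Fin N → ℤ) → Laurent N} (hΦ : ∀ l, IsMacdonald p q l (Φ l)) :
    ∃ F : Laurent N →ₗ[ℂ] M, (∀ m, Monotone m → F (Φ m) = w m) ∧
      ∀ i j : Fin N, (i : ℕ) + 1 = j → ∀ f, F (g q i j f) = T i j (F f) := by
  set F := (macdonaldBasis hΦ).constr ℂ (orbitVec p q T w) with hF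
  have hFΦ : ∀ l, F (Φ l) = orbitVec p q T w l := fun l => by
    rw [← macdonaldBasis_apply hΦ l, hF, Module.Basis.constr_basis]
  refine ⟨F, fun m hm => by rw [hFΦ, orbitVec_of_monotone hm], fun i j hij f => ?_⟩
  have hne := ne_of_adj hij
  have hq := hpq.q_ne_zero
  have hup : ∀ l : Fin N → ℤ, l i < l j →
      Φ (l ∘ Equiv.swap i j) = q • (g q i j (Φ l) - ratio p q l j i • Φ l) ∧
      orbitVec p q T w (l ∘ Equiv.swap i j)
        = q • (T i j (orbitVec p q T w l) - ratio p q l j i • orbitVec p q T w l) := by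
    intro l h
    refine ⟨(hΦ l).g_of_lt hpq hij (hΦ _) h, ?_⟩
    rw [descentAt hpq hT (l ∘ Equiv.swap i j) i j hij (by simpa using h), comp_swap_comp_swap,
      ratio_comp_swap hij h.ne, Equiv.swap_apply_left, Equiv.swap_apply_right, rho]
  have hlt : ∀ l : Fin N → ℤ, l i < l j → F (g q i j (Φ l)) = T i j (F (Φ l)) := by
    intro l h
    obtain ⟨h1, h2⟩ := hup l h
    rw [← hFΦ, ← hFΦ l, h1, map_smul, map_sub, map_smul] at h2
    have h3 := congrArg (fun v => q⁻¹ • v) h2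
    simp only [inv_smul_smul₀ hq] at h3
    exact sub_left_injective h3
  have key : F ∘ₗ g q i j = T i j ∘ₗ F := by
    apply (macdonaldBasis hΦ).ext
    intro l
    rw [macdonaldBasis_apply, LinearMap.comp_apply, LinearMap.comp_apply]
    rcases lt_trichotomy (l i) (l j) with h | h | h
    · exact hlt l h
    · rw [(hΦ l).g_of_eq hpq hij h, map_smul, hFΦ, orbitVec_stable hpq hT hw l i j hij h]
    -- At a descent the claim follows from the ascending case for the swapped exponent, since the
    -- quadratic relation holds on both sides.
    · have h' : (l ∘ Equiv.swap i j) i < (l ∘ Equiv.swap i j) j := by simpa using h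
      have h1 := (hup _ h').1
      have h2 := hlt _ h'
      rw [comp_swap_comp_swap] at h1
      have h3 := LinearMap.congr_fun (g_mul_g hq hne) (Φ (l ∘ Equiv.swap i j))
      simp only [Module.End.mul_apply, LinearMap.add_apply, LinearMap.smul_apply,
        Module.End.one_apply] at h3
      rw [h1]
      simp only [map_smul, map_sub, h3, map_add, h2, hT.quad i j hij]
  exact LinearMap.congr_fun key f

end Hecke

/-! ### The Hecke algebra on the tensor power -/

/-- The basis of the tensor power. -/
def tpowBasis (n N : ℕ) : Module.Basis (Fin N → Fin n) ℂ (TPow n N) :=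
  Basis.piTensorProduct fun _ : Fin N => Pi.basisFun ℂ (Fin n)

theorem tpowBasis_apply {n N : ℕ} (e : Fin N → Fin n) : tpowBasis n N e = vTensor e := by
  simp [tpowBasis, vTensor]

theorem S_braid {n N : ℕ} {q : ℂ} (hq : q ≠ 0) {i j k : Fin N} (hij : i ≠ j) (hik : i ≠ k)
    (hjk : j ≠ k) :
    (S q i j * S q j k * S q i j : Module.End ℂ (TPow n N)) = S q j k * S q i j * S q j k := by
  apply tpow_ext
  intro e
  have ek : Equiv.swap i j k = k := Equiv.swap_apply_of_ne_of_ne hik.symm hjk.symm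
  have ei : Equiv.swap j k i = i := Equiv.swap_apply_of_ne_of_ne hij hik
  have hb := swap_braid hij hik hjk e
  simp only [Module.End.mul_apply]
  have htri : ∀ a b : Fin n, (a < b ∧ ¬ b < a ∧ ¬ a = b ∧ ¬ b = a) ∨ a = b ∨
      (b < a ∧ ¬ a < b ∧ ¬ a = b ∧ ¬ b = a) := by
    intro a b
    rcases lt_trichotomy a b with h | h | h
    · exact Or.inl ⟨h, h.not_gt, h.ne, h.ne'⟩
    · exact Or.inr (Or.inl h)
    · exact Or.inr (Or.inr ⟨h, h.not_gt, h.ne', h.ne⟩)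
  -- Both sides depend only on the relative order of three entries; of the 27 patterns the
  -- inconsistent ones are discarded by `order`.
  rcases htri (e i) (e j) with h1 | h1 | h1 <;>
  rcases htri (e j) (e k) with h2 | h2 | h2 <;>
  rcases htri (e i) (e k) with h3 | h3 | h3 <;>
  first
  | (exfalso; order)
  | (simp only [S_vTensor q hij, S_vTensor q hjk, h1, h2, h3, map_add, map_smul, if_true, if_false,
      Function.comp_apply, Equiv.swap_apply_left, Equiv.swap_apply_right, ek, ei,
      comp_swap_comp_swap, hb, lt_irrefl]
     try (match_scalars <;> field_simp <;> ring))

theorem S_comm {n N : ℕ} (q : ℂ) {i j a b : Fin N} (hij : i ≠ j) (hab : a ≠ b) (hia : i ≠ a)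
    (hib : i ≠ b) (hja : j ≠ a) (hjb : j ≠ b) :
    Commute (S q i j : Module.End ℂ (TPow n N)) (S q a b) := by
  apply tpow_ext
  intro e
  have ea : Equiv.swap i j a = a := Equiv.swap_apply_of_ne_of_ne hia.symm hja.symm
  have eb : Equiv.swap i j b = b := Equiv.swap_apply_of_ne_of_ne hib.symm hjb.symm
  have ei : Equiv.swap a b i = i := Equiv.swap_apply_of_ne_of_ne hia hib
  have ej : Equiv.swap a b j = j := Equiv.swap_apply_of_ne_of_ne hja hjb
  simp only [Module.End.mul_apply]
  by_cases h1 : e i = e j <;> by_cases h2 : e a = e b <;>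
    simp only [S_vTensor q hij, S_vTensor q hab, h1, h2, map_add, map_smul, if_true, if_false,
      Function.comp_apply, ea, eb, ei, ej, swap_far hia hib hja hjb e] <;> module

/-- Transposition reverses products, but each defining relation is preserved by reversal, so the
dual is again a module over the same algebra. -/
theorem isHecke_dual (n N : ℕ) {q : ℂ} (hq : q ≠ 0) :
    IsHecke (N := N) (M := Module.Dual ℂ (TPow n N)) q fun i j => (S q i j).dualMap where
  quad i j hij φ := by
    refine LinearMap.ext fun v => ?_
    have h := LinearMap.congr_fun (S_mul_S (n := n) hq (ne_of_adj hij)) v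
    simp only [Module.End.mul_apply, LinearMap.add_apply, LinearMap.smul_apply,
      Module.End.one_apply] at h
    simp only [LinearMap.dualMap_apply, LinearMap.add_apply, LinearMap.smul_apply, h, map_add,
      map_smul]
  braid i j k hij hjk φ := by
    refine LinearMap.ext fun v => ?_
    have h := LinearMap.congr_fun (S_braid (n := n) hq (ne_of_adj hij)
      ((lt_of_adj hij).trans (lt_of_adj hjk)).ne (ne_of_adj hjk)) v
    simp only [Module.End.mul_apply] at h
    simp only [LinearMap.dualMap_apply, h]
  comm i j a b hij hab hja φ := by
    refine LinearMap.ext fun v => ?_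
    have hia := (lt_of_adj hij).trans hja
    have hjb := hja.trans (lt_of_adj hab)
    have h := LinearMap.congr_fun (S_comm (n := n) q (ne_of_adj hij) (ne_of_adj hab) hia.ne
      (hia.trans (lt_of_adj hab)).ne hja.ne hjb.ne).eq v
    simp only [Module.End.mul_apply] at h
    simp only [LinearMap.dualMap_apply, h]

/-! ### The functional dual to a label -/

/-- With the second coordinate reversed, a label is a strictly increasing sequence of pairs. So its
pairs are distinct and their set determines it. -/
theorem strictMono_label {n N : ℕ} {m : Fin N → ℤ} {e : Fin N → Fin n} (hm : Monotone m)
    (he : e ∈ ESet n m) : StrictMono fun k => toLex (m k, OrderDual.toDual (e k)) := by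
  apply strictMono_of_adj
  intro i j hij
  rw [Prod.Lex.toLex_lt_toLex]
  rcases (hm (lt_of_adj hij).le).lt_or_eq with h | h
  · exact Or.inl h
  · exact Or.inr ⟨h, OrderDual.toDual_lt_toDual.mpr (he i j hij h)⟩

/-- `f` is obtained from `e` by a permutation that preserves `m`. -/
def SameOrbit {n N : ℕ} (m : Fin N → ℤ) (e f : Fin N → Fin n) : Prop :=
  ∃ τ : Equiv.Perm (Fin N), m ∘ τ = m ∧ f = e ∘ τ

theorem SameOrbit.refl {n N : ℕ} (m : Fin N → ℤ) (e : Fin N → Fin n) : SameOrbit m e e :=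
  ⟨1, rfl, rfl⟩

theorem SameOrbit.swap {n N : ℕ} {m : Fin N → ℤ} {e f : Fin N → Fin n} {i j : Fin N}
    (h : m i = m j) (hf : SameOrbit m e f) : SameOrbit m e (f ∘ Equiv.swap i j) := by
  obtain ⟨τ, h1, rfl⟩ := hf
  refine ⟨τ * Equiv.swap i j, ?_, rfl⟩
  rw [Equiv.Perm.coe_mul, ← Function.comp_assoc, h1, comp_swap_of_eq h]

theorem SameOrbit.swap_iff {n N : ℕ} {m : Fin N → ℤ} {e f : Fin N → Fin n} {i j : Fin N}
    (h : m i = m j) : SameOrbit m e (f ∘ Equiv.swap i j) ↔ SameOrbit m e f := by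
  refine ⟨fun hf => ?_, SameOrbit.swap h⟩
  have := hf.swap h
  rwa [comp_swap_comp_swap] at this

theorem SameOrbit.ne {n N : ℕ} {m : Fin N → ℤ} {e f : Fin N → Fin n} (hm : Monotone m)
    (he : e ∈ ESet n m) (hf : SameOrbit m e f) {i j : Fin N} (hij : i ≠ j) (h : m i = m j) :
    f i ≠ f j := by
  obtain ⟨τ, h1, rfl⟩ := hf
  intro hcon
  apply hij
  apply τ.injective
  apply (strictMono_label hm he).injective
  have h2 := congrFun h1 i
  have h3 := congrFun h1 j
  simp only [Function.comp_apply] at h2 h3 hcon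
  simp only [h2, h3, h, hcon]

/-- A permutation preserving `m` does not change the set of pairs, and a strictly increasing
sequence is determined by its range. Thus each orbit contains at most one label. -/
theorem SameOrbit.eq {n N : ℕ} {m : Fin N → ℤ} {e f : Fin N → Fin n} (hm : Monotone m)
    (he : e ∈ ESet n m) (hf : f ∈ ESet n m) (h : SameOrbit m e f) : f = e := by
  obtain ⟨τ, h1, h2⟩ := h
  have hr : (fun k => toLex (m k, OrderDual.toDual (f k)))
      = (fun k => toLex (m k, OrderDual.toDual (e k))) ∘ τ := by
    funext k
    have := congrFun h1 k
    simp only [Function.comp_apply] at this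
    simp [h2, this]
  have := (StrictMono.range_inj (strictMono_label hm hf) (strictMono_label hm he)).mp (by
    rw [hr, EquivLike.range_comp])
  funext k
  simpa using congrFun this k

open Classical in
/-- The functional on the tensor power that is supported on the orbit of `e`. -/
def orbitFunctional {n N : ℕ} (q : ℂ) (m : Fin N → ℤ) (e : Fin N → Fin n) :
    Module.Dual ℂ (TPow n N) :=
  (tpowBasis n N).constr ℂ fun f =>
    if SameOrbit m e f then (-q⁻¹) ^ (invSet fun k => toLex (m k, f k)).card else 0

open Classical in
theorem orbitFunctional_vTensor {n N : ℕ} (q : ℂ) (m : Fin N → ℤ) (e f : Fin N → Fin n) :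
    orbitFunctional q m e (vTensor f) =
      if SameOrbit m e f then (-q⁻¹) ^ (invSet fun k => toLex (m k, f k)).card else 0 := by
  rw [← tpowBasis_apply, orbitFunctional, Module.Basis.constr_basis]

theorem orbitFunctional_swap {n N : ℕ} (q : ℂ) {m : Fin N → ℤ} (e : Fin N → Fin n)
    {i j : Fin N} (hij : (i : ℕ) + 1 = j) (h : m i = m j) {f : Fin N → Fin n} (hf : f i < f j) :
    orbitFunctional q m e (vTensor (f ∘ Equiv.swap i j))
      = -q⁻¹ * orbitFunctional q m e (vTensor f) := by
  rw [orbitFunctional_vTensor, orbitFunctional_vTensor, SameOrbit.swap_iff h]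
  split_ifs
  · have hx : (fun k => toLex (m k, (f ∘ Equiv.swap i j) k))
        = (fun k => toLex (m k, f k)) ∘ Equiv.swap i j := by
      funext k
      have := congrFun (comp_swap_of_eq h) k
      simp only [Function.comp_apply] at this
      simp [this]
    rw [hx, card_invSet_comp_swap hij, pow_succ, mul_comm]
    rw [Prod.Lex.toLex_lt_toLex]
    exact Or.inr ⟨h, hf⟩
  · simp

/-- The weight `-q⁻¹` per inversion is the one for which `(q - q⁻¹) - (-q⁻¹) = q` on ascending
neighbours. Equal neighbours do not occur in the orbit, so the functional vanishes there. -/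
theorem dualMap_S_orbitFunctional {n N : ℕ} {q : ℂ} (hq : q ≠ 0) {m : Fin N → ℤ}
    (hm : Monotone m) {e : Fin N → Fin n} (he : e ∈ ESet n m) {i j : Fin N}
    (hij : (i : ℕ) + 1 = j) (h : m i = m j) :
    (S q i j).dualMap (orbitFunctional q m e) = q • orbitFunctional q m e := by
  apply (tpowBasis n N).ext
  intro f
  have hne := ne_of_adj hij
  rw [tpowBasis_apply, LinearMap.dualMap_apply, S_vTensor q hne, LinearMap.smul_apply]
  rcases lt_trichotomy (f i) (f j) with hf | hf | hf
  · rw [if_neg hf.ne, if_pos hf, map_add, map_smul, map_smul, orbitFunctional_swap q e hij h hf]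
    simp only [smul_eq_mul]
    ring
  · have h0 : orbitFunctional q m e (vTensor f) = 0 := by
      rw [orbitFunctional_vTensor, if_neg fun ho => ho.ne hm he hne h hf]
    rw [if_pos hf, map_smul, h0, smul_zero, smul_zero]
  · have h1 := orbitFunctional_swap q e hij h (f := f ∘ Equiv.swap i j) (by simpa using hf)
    rw [comp_swap_comp_swap] at h1
    rw [if_neg hf.ne', if_neg hf.not_gt, zero_smul, zero_add, map_smul, h1]
    simp only [smul_eq_mul]
    field_simp

/-! ### The relations in the wedge product -/

section Relations

variable {n N : ℕ} {q : ℂ}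

/-- As `g` and `S` commute and satisfy the same quadratic relation, `(g + S⁻¹)(g - S) = 0`, so the
image of `g - S` lies in the kernel. -/
theorem g_sub_S_mem_Omega (hq : q ≠ 0) {i j : Fin N} (hij : (i : ℕ) + 1 = j) (y : TVz n N) :
    LinearMap.rTensor (TPow n N) (g q i j) y - LinearMap.lTensor (Laurent N) (S q i j) y
      ∈ Omega n N q := by
  have hne := ne_of_adj hij
  refine Submodule.mem_iSup_of_mem i (Submodule.mem_iSup_of_mem j
    (Submodule.mem_iSup_of_mem hij ?_))
  rw [LinearMap.mem_ker]
  induction y using TensorProduct.induction_on with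
  | zero => simp
  | add y z hy hz =>
    rw [map_add, map_add, add_sub_add_comm, map_add, hy, hz, add_zero]
  | tmul f v =>
    have hg := LinearMap.congr_fun (g_mul_g hq hne) f
    have hS := LinearMap.congr_fun (SInv_mul_S (n := n) hq hne) v
    simp only [Module.End.mul_apply, LinearMap.add_apply, LinearMap.smul_apply,
      Module.End.one_apply] at hg hS
    simp only [LinearMap.rTensor_tmul, LinearMap.lTensor_tmul, LinearMap.add_apply, map_sub, hg, hS]
    rw [SInv, LinearMap.add_apply, LinearMap.smul_apply, Module.End.one_apply,
      TensorProduct.add_tmul, TensorProduct.tmul_add, ← TensorProduct.smul_tmul',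
      TensorProduct.tmul_smul]
    module

theorem Lam_g_tmul (hq : q ≠ 0) {i j : Fin N} (hij : (i : ℕ) + 1 = j) (f : Laurent N)
    (v : TPow n N) : Lam n N q (g q i j f ⊗ₜ v) = Lam n N q (f ⊗ₜ S q i j v) := by
  have := g_sub_S_mem_Omega hq hij (f ⊗ₜ[ℂ] v : TVz n N)
  rw [LinearMap.rTensor_tmul, LinearMap.lTensor_tmul] at this
  exact (Submodule.Quotient.eq _).mpr this

/-- The converse inclusion: each kernel vector is in the image of `g - S`, provided `(q + q⁻¹)² ≠
0`. -/
theorem Omega_le_ker (hq : q ≠ 0) (hq2 : q ^ 2 + 1 ≠ 0) (ψ : TVz n N →ₗ[ℂ] ℂ)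
    (hψ : ∀ i j : Fin N, (i : ℕ) + 1 = j → ∀ y,
      ψ (LinearMap.rTensor (TPow n N) (g q i j) y)
        = ψ (LinearMap.lTensor (Laurent N) (S q i j) y)) :
    Omega n N q ≤ LinearMap.ker ψ := by
  refine iSup_le fun i => iSup_le fun j => iSup_le fun hij => ?_
  intro x hx
  have hne := ne_of_adj hij
  rw [LinearMap.mem_ker, LinearMap.add_apply, add_eq_zero_iff_eq_neg] at hx
  rw [LinearMap.mem_ker]
  set G := LinearMap.rTensor (TPow n N) (g q i j) with hG
  set U := LinearMap.lTensor (Laurent N) (S q i j : Module.End ℂ (TPow n N)) with hU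
  have hI : ∀ z, LinearMap.lTensor (Laurent N) (SInv q i j : Module.End ℂ (TPow n N)) z
      = U z + (q⁻¹ - q) • z := by
    intro z
    rw [SInv, LinearMap.lTensor_add, LinearMap.lTensor_smul, LinearMap.add_apply,
      LinearMap.smul_apply, Module.End.one_eq_id, LinearMap.lTensor_id, LinearMap.id_apply]
  have hUU : ∀ z, U (U z) = (q - q⁻¹) • U z + z := by
    intro z
    have h := congrArg (fun A => LinearMap.lTensor (Laurent N) A z)
      (S_mul_S (n := n) hq hne)
    simp only [LinearMap.lTensor_add, LinearMap.lTensor_smul, LinearMap.add_apply,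
      LinearMap.smul_apply, Module.End.one_eq_id, LinearMap.lTensor_id, LinearMap.id_apply] at h
    rw [← h, Module.End.mul_eq_comp, LinearMap.lTensor_comp, LinearMap.comp_apply]
  have hGU : ∀ z, G (U z) = U (G z) := by
    intro z
    rw [hG, hU, ← LinearMap.comp_apply, ← LinearMap.comp_apply, LinearMap.rTensor_comp_lTensor,
      LinearMap.lTensor_comp_rTensor]
  -- For `x` in the kernel, `G - U` sends this vector to `-(q + q⁻¹)² x`, so it is an explicit
  -- preimage of `x` up to a non-zero scalar.
  have h1 := hψ i j hij ((2 : ℂ) • U x - (q - q⁻¹) • x)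
  rw [← hG, ← hU] at h1
  rw [hI] at hx
  simp only [map_sub, map_smul, map_add, map_neg, hGU, hx, hUU, smul_eq_mul] at h1
  have hc : ((q ^ 2 + 1) ^ 2 * (q⁻¹) ^ 2) * ψ x = 0 := by
    have h2 : (4 + (q - q⁻¹) ^ 2) * ψ x = 0 := by linear_combination -h1
    rw [← h2]
    congr 1
    field_simp
    ring
  exact (mul_eq_zero.mp hc).resolve_left (by positivity)

end Relations

/-! ### Linear independence -/

theorem exists_dual_functional {n N : ℕ} {p q : ℂ} (hpq : IsGeneric p q)
    {Φ : (Fin N → ℤ) → Laurent N} (hΦ : ∀ l, IsMacdonald p q l (Φ l)) (x : Label n N) :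
    ∃ ψ : Wedge n N q →ₗ[ℂ] ℂ, ψ (phi q Φ x) ≠ 0 ∧ ∀ y, y ≠ x → ψ (phi q Φ y) = 0 := by
  obtain ⟨⟨m, e⟩, hm, he⟩ := x
  simp only at hm he
  have hq := hpq.q_ne_zero
  classical
  obtain ⟨F, hF, hFg⟩ := exists_hecke_hom (N := N) hpq (isHecke_dual n N hq)
    (w := fun l => if l = m then orbitFunctional q m e else 0) (fun l hl i j hij h => by
      by_cases hlm : l = m
      · subst hlm
        rw [if_pos rfl]
        exact dualMap_S_orbitFunctional hq hl he hij h
      · rw [if_neg hlm, map_zero, smul_zero]) hΦ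
  -- Uncurrying `F` gives the functional, and its Hecke equivariance is exactly the hypothesis
  -- needed to descend to the quotient.
  have hker := Omega_le_ker hq hpq.q_sq_ne_neg_one (TensorProduct.lift F) (fun i j hij y => by
    induction y using TensorProduct.induction_on with
    | zero => simp
    | add y z hy hz => simp only [map_add, hy, hz]
    | tmul f v =>
      rw [LinearMap.rTensor_tmul, LinearMap.lTensor_tmul, TensorProduct.lift.tmul,
        TensorProduct.lift.tmul, hFg i j hij, LinearMap.dualMap_apply])
  have hval : ∀ y : Label n N, (Omega n N q).liftQ (TensorProduct.lift F) hker (phi q Φ y)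
      = (if y.1.1 = m then orbitFunctional q m e else 0) (vTensor y.1.2) := by
    intro y
    rw [phi, Lam, Submodule.mkQ_apply, Submodule.liftQ_apply, TensorProduct.lift.tmul,
      hF _ y.2.1.1]
  refine ⟨(Omega n N q).liftQ (TensorProduct.lift F) hker, ?_, fun y hy => ?_⟩
  · rw [hval, if_pos rfl, orbitFunctional_vTensor, if_pos (SameOrbit.refl m e)]
    exact pow_ne_zero _ (neg_ne_zero.mpr (inv_ne_zero hq))
  · rw [hval]
    split_ifs with h
    · rw [orbitFunctional_vTensor, if_neg]
      intro ho
      apply hy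
      obtain ⟨⟨m', e'⟩, hm', he'⟩ := y
      simp only at h ho he'
      subst h
      obtain rfl := ho.eq hm.1 he he'
      rfl
    · rfl

theorem linearIndependent_phi {n N : ℕ} {p q : ℂ} (hpq : IsGeneric p q)
    {Φ : (Fin N → ℤ) → Laurent N} (hΦ : ∀ l, IsMacdonald p q l (Φ l)) :
    LinearIndependent ℂ (phi (n := n) q Φ) := by
  rw [linearIndependent_iff']
  intro s c hc x hx
  obtain ⟨ψ, h1, h2⟩ := exists_dual_functional hpq hΦ x
  have h3 := congrArg ψ hc
  rw [map_sum, map_zero, Finset.sum_eq_single x] at h3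
  · rw [map_smul, smul_eq_mul] at h3
    exact (mul_eq_zero.mp h3).resolve_right h1
  · intro y _ hy
    rw [map_smul, h2 y hy, smul_zero]
  · exact fun h => absurd hx h

/-! ### Spanning -/

/-- Straightening of the tensor indices inside blocks of equal exponents, by induction on the
inversions with respect to the decreasing order. An ascent is exchanged at the cost of the factor
`-q`; equal neighbours give zero. -/
theorem Lam_vTensor_mem_span {n N : ℕ} {p q : ℂ} (hpq : IsGeneric p q)
    {Φ : (Fin N → ℤ) → Laurent N} (hΦ : ∀ l, IsMacdonald p q l (Φ l)) {m : Fin N → ℤ}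
    (hm : Monotone m) (e : Fin N → Fin n) :
    Lam n N q (Φ m ⊗ₜ vTensor e) ∈ Submodule.span ℂ (Set.range (phi (n := n) q Φ)) := by
  have hq := hpq.q_ne_zero
  induction hk : (invSet fun k => toLex (m k, OrderDual.toDual (e k))).card using
    Nat.strong_induction_on generalizing e with
  | _ k ih =>
    subst hk
    by_cases he : e ∈ ESet n m
    -- Within a block the indices are distinct elements of an `n`-element set, so no block is longer
    -- than `n`.
    · have hM : m ∈ MSet n N := by
        refine ⟨hm, fun a => ?_⟩
        rw [← Fintype.card_fin n, ← Finset.card_univ]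
        apply Finset.card_le_card_of_injOn e (fun _ _ => Finset.mem_univ _)
        intro i hi j hj hij
        apply (strictMono_label hm he).injective
        simp only [Finset.coe_filter, Finset.mem_univ, true_and, Set.mem_ofPred_eq] at hi hj
        simp only [hi, hj, hij]
      exact Submodule.subset_span ⟨⟨(m, e), hM, he⟩, rfl⟩
    · simp only [ESet, Set.mem_ofPred_eq, not_forall] at he
      obtain ⟨i, j, hij, h, hlt⟩ := he
      have hne := ne_of_adj hij
      have hrel := Lam_g_tmul hq hij (Φ m) (vTensor e)
      rw [(hΦ m).g_of_eq hpq hij h, ← TensorProduct.smul_tmul', map_smul, S_vTensor q hne] at hrel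
      rcases (not_lt.mp hlt).lt_or_eq with hlt | heq
      · rw [if_neg hlt.ne, if_pos hlt, TensorProduct.tmul_add, TensorProduct.tmul_smul,
          TensorProduct.tmul_smul, map_add, map_smul, map_smul] at hrel
        have hx : (fun k => toLex (m k, OrderDual.toDual ((e ∘ Equiv.swap i j) k)))
            = (fun k => toLex (m k, OrderDual.toDual (e k))) ∘ Equiv.swap i j := by
          funext k
          have := congrFun (comp_swap_of_eq h) k
          simp only [Function.comp_apply] at this
          simp [this]
        have hmem := ih _ (by
          rw [hx]
          apply card_invSet_of_gt hij
          rw [Prod.Lex.toLex_lt_toLex]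
          exact Or.inr ⟨h.symm, OrderDual.toDual_lt_toDual.mpr hlt⟩) (e ∘ Equiv.swap i j) rfl
        have h2 : Lam n N q (Φ m ⊗ₜ vTensor e)
            = (-q) • Lam n N q (Φ m ⊗ₜ vTensor (e ∘ Equiv.swap i j)) := by
          have hqq : q * q⁻¹ = 1 := mul_inv_cancel₀ hq
          linear_combination (norm := module) q • hrel
            - hqq • Lam n N q (Φ m ⊗ₜ vTensor e)
        rw [h2]
        exact Submodule.smul_mem _ _ hmem
      · rw [if_pos heq, TensorProduct.tmul_smul, map_smul] at hrel
        have h2 : (q + q⁻¹) • Lam n N q (Φ m ⊗ₜ vTensor e) = 0 := by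
          linear_combination (norm := module) hrel
        have h3 : q + q⁻¹ ≠ 0 := by
          intro h0
          apply hpq.q_sq_ne_neg_one
          field_simp at h0
          rwa [mul_zero] at h0
        rw [(smul_eq_zero.mp h2).resolve_left h3]
        exact Submodule.zero_mem _

/-- At a descent, `Φ l` is a combination of `g (Φ l')` and `Φ l'` for the swapped `l'`. Moving `g`
to the tensor factor leaves only `Φ l'`, which has fewer inversions; this is why the tensor `v` must
stay arbitrary in the induction. -/
theorem Lam_tmul_mem_span {n N : ℕ} {p q : ℂ} (hpq : IsGeneric p q)
    {Φ : (Fin N → ℤ) → Laurent N} (hΦ : ∀ l, IsMacdonald p q l (Φ l)) (l : Fin N → ℤ)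
    (v : TPow n N) :
    Lam n N q (Φ l ⊗ₜ v) ∈ Submodule.span ℂ (Set.range (phi (n := n) q Φ)) := by
  induction hk : (invSet l).card using Nat.strong_induction_on generalizing l v with
  | _ k ih =>
    subst hk
    by_cases hd : ∃ x : Fin N × Fin N, (x.1 : ℕ) + 1 = x.2 ∧ l x.2 < l x.1
    · obtain ⟨⟨i, j⟩, hij, h⟩ := hd
      simp only at hij h
      have hmem := ih _ (card_invSet_of_gt hij h) (l ∘ Equiv.swap i j)
      have h1 := (hΦ (l ∘ Equiv.swap i j)).g_of_lt hpq hij (hΦ _) (by simpa using h)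
      rw [comp_swap_comp_swap] at h1
      rw [h1, ← TensorProduct.smul_tmul', TensorProduct.sub_tmul, ← TensorProduct.smul_tmul',
        map_smul, map_sub, map_smul, Lam_g_tmul hpq.q_ne_zero hij]
      exact Submodule.smul_mem _ _ (Submodule.sub_mem _ (hmem _ rfl)
        (Submodule.smul_mem _ _ (hmem _ rfl)))
    · have hm : Monotone l := monotone_of_adj fun a b hab => by
        by_contra hcon
        exact hd ⟨(a, b), hab, not_le.mp hcon⟩
      have hle : Submodule.span ℂ (Set.range (tpowBasis n N))
          ≤ (Submodule.span ℂ (Set.range (phi (n := n) q Φ))).comap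
            (Lam n N q ∘ₗ TensorProduct.mk ℂ (Laurent N) (TPow n N) (Φ l)) := by
        rw [Submodule.span_le]
        rintro _ ⟨e, rfl⟩
        rw [tpowBasis_apply]
        exact Lam_vTensor_mem_span hpq hΦ hm e
      rw [Module.Basis.span_eq] at hle
      exact hle (Submodule.mem_top (x := v))

theorem span_phi {n N : ℕ} {p q : ℂ} (hpq : IsGeneric p q)
    {Φ : (Fin N → ℤ) → Laurent N} (hΦ : ∀ l, IsMacdonald p q l (Φ l)) :
    Submodule.span ℂ (Set.range (phi (n := n) q Φ)) = ⊤ := by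
  rw [eq_top_iff]
  rintro x -
  obtain ⟨y, rfl⟩ := Submodule.mkQ_surjective _ x
  induction y using TensorProduct.induction_on with
  | zero => simp
  | add y z hy hz => rw [map_add]; exact Submodule.add_mem _ hy hz
  | tmul f v =>
    have hle : Submodule.span ℂ (Set.range (macdonaldBasis hΦ))
        ≤ (Submodule.span ℂ (Set.range (phi (n := n) q Φ))).comap
          (Lam n N q ∘ₗ (TensorProduct.mk ℂ (Laurent N) (TPow n N)).flip v) := by
      rw [Submodule.span_le]
      rintro _ ⟨l, rfl⟩
      rw [macdonaldBasis_apply]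
      exact Lam_tmul_mem_span hpq hΦ l v
    rw [Module.Basis.span_eq] at hle
    exact hle (Submodule.mem_top (x := f))

end QWedge

end

theorem propositionp (n N : ℕ) (hn : 2 ≤ n) (hN : 1 ≤ N) (p q : ℂ)
    (hpq : QWedge.IsGeneric p q) :
    ∃ Φ : (Fin N → ℤ) → QWedge.Laurent N,
      (∀ (l : Fin N → ℤ) (f : QWedge.Laurent N), QWedge.IsMacdonald p q l f ↔ f = Φ l) ∧
      LinearIndependent ℂ (QWedge.phi (n := n) q Φ) ∧
      Submodule.span ℂ (Set.range (QWedge.phi (n := n) q Φ)) = ⊤ := by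
  choose Φ hΦ using fun l : Fin N → ℤ => QWedge.exists_isMacdonald hpq l
  refine ⟨Φ, fun l f => ⟨fun hf => (hΦ l).unique hpq hf, ?_⟩,
    QWedge.linearIndependent_phi hpq hΦ, QWedge.span_phi hpq hΦ⟩
  rintro rfl
  exact hΦ l
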